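/- **Setting.** Let $\lambda$ be Lebesgue measure on $\mathbb{R}$. A *quantizer* is a Borel measurable map $q:\mathbb{R}\to\mathbb{R}$ with countable range such that every codecell $q^{-1}(c)$, $c\in q(\mathbb{R})$, is an interval containing $c$ in its interior. Let $r>1$ and $\alpha\in(0,1)$. For a Borel probability measure $\mu$ on $\mathbb{R}$ put $$H^\alpha_\mu(q)=\frac{1}{1-\alpha}\log\sum_{c\in q(\mathbb{R})}\mu(q^{-1}(c))^\alpha\in[0,\infty],\qquad D_\mu(q)=\int|x-q(x)|^r\,d\mu(x),$$ and $D^\alpha_\mu(R)=\inf\{D_\mu(q): q\text{ a quantizer},\ H^\alpha_\mu(q)\le R\}$. A sequence of quantizers $(q_n)$ is *asymptotically optimal* for $\mu$ if $H^\alpha_\mu(q_n)\to\infty$ and $D_\mu(q_n)/D^\alpha_\mu(H^\alpha_\mu(q_n))\to1$. A probability density $g$ on $\mathbb{R}$ is *weakly unimodal* if it is continuous on its support (the smallest closed set whose complement is $g\lambda$-null) and there is $l_0>0$ such that $\{x:g(x)\ge l\}$ is a compact interval for every $l\in(0,l_0)$. Put $$\beta_1=\frac{1-\alpha+\alpha r}{1-\alpha+r},\qquad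 \beta_2=\frac{1-\alpha+r}{1-\alpha},\qquad C(r)=\frac{1}{2^r(1+r)}.$$ **Theorem 4.1.** Let $r>1$ and $\alpha\in(0,1)$. Let $\mu=g\lambda$ and $\nu=f\lambda$, where $g$ and $f$ are weakly unimodal densities such that $f/g$ is bounded, that is, $f\le Mg$ $\lambda$-almost everywhere for some constant $M$. Assume $\int|x|^{r+\delta}\,d\mu(x)<\infty$ for some $\delta>0$. If $(q_n)_{n\in\mathbb{N}}$ is an asymptotically optimal sequence of quantizers for $\mu$, then $$\lim_{n\to\infty}e^{(1-\alpha)(H^\alpha_\nu(q_n)-H^\alpha_\mu(q_n))}=\frac{\int(f/g)^\alpha g^{\beta_1}\,d\lambda}{\int g^{\beta_1}\,d\lambda}$$ and $$\lim_{n\to\infty}e^{rH^\alpha_\nu(q_n)}D_\nu(q_n)=C(r)\left(\int f^\alpha\big(g^{1/\beta_2}\big)^{1-\alpha}\,d\lambda\right)^{\frac{r}{1-\alpha}}\int f\,\big(g^{1/\beta_2}\big)^{-r}\,d\lambda,$$ where all integrals on the right-hand sides are finite and their integrands are read as $0$ where $g=0$. -/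

import Mathlib

open MeasureTheory Filter Set
open scoped ENNReal Topology

noncomputable section

namespace RenyiQuantization

/-- `g` is a probability density on the real line with respect to Lebesgue measure. -/
structure IsDensity (g : ℝ → ℝ) : Prop where
  measurable : Measurable g
  nonneg : ∀ x, 0 ≤ g x
  lintegral_eq_one : ∫⁻ x, ENNReal.ofReal (g x) = 1

/-- The measure `g λ` with Lebesgue density `g`. -/
def densityMeasure (g : ℝ → ℝ) : Measure ℝ :=
  volume.withDensity fun x => ENNReal.ofReal (g x)

/-- A probability density is weakly unimodal if it is continuous on its support (the smallest
closed set whose complement is a null set of `g λ`) and if all its superlevel sets at sufficiently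
small positive levels are compact intervals. -/
structure IsWeaklyUnimodal (g : ℝ → ℝ) : Prop where
  isDensity : IsDensity g
  continuousOn : ContinuousOn g (densityMeasure g).support
  superlevel : ∃ l₀ : ℝ, 0 < l₀ ∧
    ∀ l ∈ Ioo 0 l₀, ∃ a b : ℝ, a ≤ b ∧ {x | l ≤ g x} = Icc a b

/-- A scalar quantizer: a Borel measurable map with countable range, all of whose codecells
`q ⁻¹' {c}`, for `c` in the codebook `range q`, are intervals containing the codepoint `c` in their
interior. -/
structure IsQuantizer (q : ℝ → ℝ) : Prop where
  measurable : Measurable q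
  countable_range : (range q).Countable
  ordConnected : ∀ c ∈ range q, (q ⁻¹' {c}).OrdConnected
  mem_interior : ∀ c ∈ range q, c ∈ interior (q ⁻¹' {c})

/-- The Rényi entropy of order `α` of the quantizer `q` with respect to `μ`,
`(1 - α)⁻¹ * log (∑ c, μ (q ⁻¹' {c}) ^ α)`, an extended real number. -/
def entropy (α : ℝ) (μ : Measure ℝ) (q : ℝ → ℝ) : EReal :=
  (((1 - α)⁻¹ : ℝ) : EReal) * ENNReal.log (∑' c : range q, μ (q ⁻¹' {(c : ℝ)}) ^ α)

/-- The `r`-th power distortion of `q` with respect to `μ`. -/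
def distortion (r : ℝ) (μ : Measure ℝ) (q : ℝ → ℝ) : ℝ≥0∞ :=
  ∫⁻ x, ENNReal.ofReal (|x - q x| ^ r) ∂μ

/-- The optimal quantization distortion of `μ` under the entropy constraint `R`. -/
def optimalDistortion (α r : ℝ) (μ : Measure ℝ) (R : EReal) : ℝ≥0∞ :=
  ⨅ (q : ℝ → ℝ) (_ : IsQuantizer q) (_ : entropy α μ q ≤ R), distortion r μ q

/-- Asymptotic optimality of a sequence of quantizers for `μ`. For a density with finite `r`-th
moment the limit of the ratios forces the entropies to be finite from some index on, because
`optimalDistortion α r μ ⊤ = 0`, and in `ℝ≥0∞` a quotient by `0` is `0` or `∞`. -/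
structure IsAsymptoticallyOptimal (α r : ℝ) (μ : Measure ℝ) (q : ℕ → ℝ → ℝ) : Prop where
  isQuantizer : ∀ n, IsQuantizer (q n)
  tendsto_entropy : Tendsto (fun n => entropy α μ (q n)) atTop (𝓝 ⊤)
  tendsto_ratio : Tendsto
    (fun n => distortion r μ (q n) / optimalDistortion α r μ (entropy α μ (q n))) atTop (𝓝 1)

/-- The exponent `β₁ = (1 - α + α r) / (1 - α + r)`. -/
def beta₁ (α r : ℝ) : ℝ := (1 - α + α * r) / (1 - α + r)

/-- The exponent `β₂ = (1 - α + r) / (1 - α)`. -/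
def beta₂ (α r : ℝ) : ℝ := (1 - α + r) / (1 - α)

/-- The constant `C(r) = 1 / (2 ^ r (1 + r))`. -/
def constC (r : ℝ) : ℝ := 1 / (2 ^ r * (1 + r))

end RenyiQuantization

end

open RenyiQuantization

noncomputable section

namespace RenyiQuantization

/-! Write `s = cellSum α μ q` and `G = ∫ g ^ β₁`. Two measures describe a quantizer:
`entropyMeasure` gives each cell its share of `s`, and `distortionMeasure` is the distortion scaled
by `s ^ (r / (1 - α)) / (C(r) G ^ β₂)`. The heart of the proof is that, along an asymptotically
optimal sequence, both converge weakly to the same probability measure `γ = g ^ β₁ / G · λ`.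

Lower bound: on a short cell `g` is nearly constant, and Young's inequality with weights `1 / β₂`
and `1 - 1 / β₂` (`young_cell`) bounds a weighted sum of the two measures of the cell below by
nearly its `γ`-measure, for every value of a free parameter `t > 0`. Summing over cells gives
`limitMeasure_le_liminf_mixMeasure`.

Upper bound: the entropy measures have mass 1, and explicit quantizers with point density
proportional to `g ^ (1 / β₂)` (`exists_quantizer_le`) show that the distortion measures have mass
at most 1 in the limit. So there is equality at `t = 1`; the first order condition in `t` then makes
the two limits agree (`eq_of_forall_young`), which yields
`tendsto_lintegral_entropyMeasure_distortionMeasure`.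

Mismatch: for `ν = ρ μ` the quotient of the two cell sums is the integral of `(ν(cell) / μ(cell)) ^
α` against the entropy measure, and this integrand tends to `ρ ^ α` locally uniformly where `g` is
positive and `ρ` continuous. The distortion of `ν` is, up to normalization, the integral of `ρ`
against the distortion measure. Both limits are therefore integrals against `γ`
(`tendsto_mismatch`), with `ρ = f / g`. -/

/-! ### Inequalities for a single cell. -/

lemma setLIntegral_abs_sub_midpoint (r : ℝ) (hr : 1 < r) (a b : ℝ) (hab : a ≤ b) :
    ∫⁻ x in Icc a b, ENNReal.ofReal (|x - (a + b) / 2| ^ r) =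
      ENNReal.ofReal (constC r * (b - a) ^ (r + 1)) := by
  have hc : Continuous fun x : ℝ => |x - (a + b) / 2| ^ r :=
    (continuous_abs.comp (continuous_id.sub continuous_const)).rpow_const
      fun _ => Or.inr (by linarith)
  rw [← ofReal_integral_eq_lintegral_ofReal]
  · congr 1
    rw [integral_Icc_eq_integral_Ioc, ← intervalIntegral.integral_of_le hab]
    have h1 : ∫ x in a..b, |x - (a + b) / 2| ^ r =
        ∫ x in (-((b - a) / 2))..((b - a) / 2), |x| ^ r := by
      rw [intervalIntegral.integral_comp_sub_right (fun x => |x| ^ r)]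
      congr 1 <;> ring
    have hc' : Continuous fun x : ℝ => |x| ^ r :=
      continuous_abs.rpow_const fun _ => Or.inr (by linarith)
    set h := (b - a) / 2 with hh
    have h0 : 0 ≤ h := by rw [hh]; linarith
    have h2 : ∫ x in (0 : ℝ)..h, |x| ^ r = h ^ (r + 1) / (r + 1) := by
      rw [intervalIntegral.integral_congr (g := fun x => x ^ r), integral_rpow (Or.inl (by linarith)),
        Real.zero_rpow (by linarith), sub_zero]
      intro x hx
      rw [uIcc_of_le h0] at hx
      simp [abs_of_nonneg hx.1]
    have h3 : ∫ x in (-h)..0, |x| ^ r = ∫ x in (0 : ℝ)..h, |x| ^ r := by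
      have := intervalIntegral.integral_comp_neg (a := 0) (b := h) (fun x : ℝ => |x| ^ r)
      simpa using this.symm
    rw [h1, ← intervalIntegral.integral_add_adjacent_intervals (b := 0)
      (hc'.intervalIntegrable _ _) (hc'.intervalIntegrable _ _), h3, h2]
    -- The two halves give `2 h ^ (r + 1) / (r + 1)` with `h` half the length; this is where `C(r)`
    -- comes from.
    have : (b - a) = 2 * h := by rw [hh]; ring
    rw [this, Real.mul_rpow (by norm_num) h0, constC, Real.rpow_add_one (two_ne_zero : (2 : ℝ) ≠ 0) r]
    generalize h ^ (r + 1) = y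
    have : (2 : ℝ) ^ r ≠ 0 := by positivity
    have : 1 + r ≠ 0 := by linarith
    have : r + 1 ≠ 0 := by linarith
    field_simp
    ring
  · exact hc.integrableOn_Icc
  · exact Eventually.of_forall fun x => by positivity

/-- The mean of the `r`-th power of the distance to a point `c` over an interval is smallest for
the midpoint. -/
lemma constC_mul_rpow_le_setLIntegral (r : ℝ) (hr : 1 < r) (a b c : ℝ) (hab : a ≤ b) :
    ENNReal.ofReal (constC r * (b - a) ^ (r + 1)) ≤
      ∫⁻ x in Icc a b, ENNReal.ofReal (|x - c| ^ r) := by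
  have hc : ∀ c : ℝ, Continuous fun x : ℝ => |x - c| ^ r := fun c =>
    (continuous_abs.comp (continuous_id.sub continuous_const)).rpow_const
      fun _ => Or.inr (by linarith)
  rw [← setLIntegral_abs_sub_midpoint r hr a b hab, ← ofReal_integral_eq_lintegral_ofReal
    (hc _).integrableOn_Icc (Eventually.of_forall fun x => by positivity),
    ← ofReal_integral_eq_lintegral_ofReal
    (hc _).integrableOn_Icc (Eventually.of_forall fun x => by positivity)]
  apply ENNReal.ofReal_le_ofReal
  rw [integral_Icc_eq_integral_Ioc, ← intervalIntegral.integral_of_le hab,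
    integral_Icc_eq_integral_Ioc, ← intervalIntegral.integral_of_le hab]
  -- Reflection in the midpoint exchanges `c` with `a + b - c` without changing the integral; by
  -- convexity the midpoint error is at most the average of these two errors.
  have hrefl : ∫ x in a..b, |x - (a + b - c)| ^ r = ∫ x in a..b, |x - c| ^ r := by
    have := intervalIntegral.integral_comp_sub_left (a := a) (b := b)
      (fun x : ℝ => |x - c| ^ r) (a + b)
    rw [show a + b - b = a by ring, show a + b - a = b by ring] at this
    rw [← this]
    refine intervalIntegral.integral_congr fun x _ => ?_
    rw [← abs_neg]
    congr 2
    ring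
  have hmid : ∀ x : ℝ, |x - (a + b) / 2| ^ r ≤
      2⁻¹ * |x - c| ^ r + 2⁻¹ * |x - (a + b - c)| ^ r := by
    intro x
    have hconv := (convexOn_rpow hr.le).2 (mem_Ici.2 (abs_nonneg (x - c)))
      (mem_Ici.2 (abs_nonneg (x - (a + b - c)))) (show (0 : ℝ) ≤ 2⁻¹ by norm_num)
      (show (0 : ℝ) ≤ 2⁻¹ by norm_num) (by norm_num)
    refine le_trans (Real.rpow_le_rpow (abs_nonneg _) ?_ (by linarith)) hconv
    simp only [smul_eq_mul]
    rw [← mul_add]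
    have := abs_add_le (x - c) (x - (a + b - c))
    rw [show x - c + (x - (a + b - c)) = 2 * (x - (a + b) / 2) by ring, abs_mul, abs_two] at this
    linarith
  have hi : ∀ c : ℝ, Continuous fun x : ℝ => 2⁻¹ * |x - c| ^ r := fun c =>
    continuous_const.mul (hc c)
  calc ∫ x in a..b, |x - (a + b) / 2| ^ r
      ≤ ∫ x in a..b, (2⁻¹ * |x - c| ^ r + 2⁻¹ * |x - (a + b - c)| ^ r) :=
        intervalIntegral.integral_mono hab ((hc _).intervalIntegrable _ _)
          (((hi _).add (hi _)).intervalIntegrable _ _) hmid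
    _ = ∫ x in a..b, |x - c| ^ r := by
        rw [intervalIntegral.integral_add ((hi _).intervalIntegrable _ _)
          ((hi _).intervalIntegrable _ _),
          intervalIntegral.integral_const_mul, intervalIntegral.integral_const_mul, hrefl]
        ring

lemma constC_pos (r : ℝ) (hr : 1 < r) : 0 < constC r := by
  unfold constC
  positivity

/-- Weighted Young inequality behind the local lower bound: the optimal trade-off between
the entropy and the distortion of a cell of length `ℓ` on which the density equals `m`. -/
lemma young_cell (r α : ℝ) (hr : 1 < r) (hα : α ∈ Ioo (0 : ℝ) 1) (t s m ℓ G : ℝ) (ht : 0 < t)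
    (hs : 0 < s) (hm : 0 < m) (hl : 0 < ℓ) (hG : 0 < G) :
    m ^ beta₁ α r * ℓ / G ≤
      1 / beta₂ α r * t ^ (1 - 1 / beta₂ α r) *
        (s ^ (r / (1 - α)) * (m * ℓ ^ (r + 1)) / G ^ beta₂ α r) +
      (1 - 1 / beta₂ α r) * t ^ (-(1 / beta₂ α r)) * ((m * ℓ) ^ α / s) := by
  obtain ⟨h0, h1⟩ := hα
  have hb : 1 < beta₂ α r := by
    unfold beta₂
    rw [lt_div_iff₀ (by linarith)]
    linarith
  set θ := 1 / beta₂ α r with hθ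
  have hθ0 : 0 ≤ θ := by positivity
  have hθ1 : θ ≤ 1 := by
    rw [hθ, div_le_one (by linarith)]
    exact hb.le
  have key := Real.geom_mean_le_arith_mean2_weighted hθ0 (sub_nonneg.2 hθ1)
    (p₁ := t ^ (1 - θ) * (s ^ (r / (1 - α)) * (m * ℓ ^ (r + 1)) / G ^ beta₂ α r))
    (p₂ := t ^ (-θ) * ((m * ℓ) ^ α / s)) (by positivity) (by positivity) (by ring)
  refine le_trans (le_of_eq ?_) (key.trans (le_of_eq (by ring)))
  -- With weights `θ` and `1 - θ` the powers of `t` and `s` cancel, and those of `m`, `ℓ`, `G`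
  -- become `β₁`, `1`, `-1`. Logarithms turn this into linear algebra.
  refine Real.log_injOn_pos (mem_Ioi.2 (by positivity)) (mem_Ioi.2 (by positivity)) ?_
  have p1 : 0 < t ^ (1 - θ) * (s ^ (r / (1 - α)) * (m * ℓ ^ (r + 1)) / G ^ beta₂ α r) := by
    positivity
  have p2 : 0 < t ^ (-θ) * ((m * ℓ) ^ α / s) := by positivity
  rw [Real.log_mul (by positivity) (by positivity), Real.log_rpow p1, Real.log_rpow p2,
    Real.log_div (by positivity) (by positivity), Real.log_mul (by positivity) (by positivity),
    Real.log_rpow hm, Real.log_mul (by positivity) (by positivity),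
    Real.log_div (by positivity) (by positivity), Real.log_mul (by positivity) (by positivity),
    Real.log_mul (by positivity) (by positivity), Real.log_rpow ht, Real.log_rpow hs,
    Real.log_rpow hl, Real.log_rpow hG, Real.log_mul (by positivity) (by positivity),
    Real.log_rpow ht, Real.log_div (by positivity) (by positivity), Real.log_rpow (by positivity),
    Real.log_mul (by positivity) (by positivity), hθ]
  unfold beta₁ beta₂
  have : 1 - α ≠ 0 := by linarith
  have : 1 - α + r ≠ 0 := by linarith
  field_simp
  ring

/-! ### Cells of a quantizer. -/

lemma ordConnected_bounded {I : Set ℝ} (hI : I.OrdConnected) (hne : (interior I).Nonempty)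
    (hb : Bornology.IsBounded I) :
    ∃ a b, a < b ∧ Ioo a b ⊆ I ∧ I ⊆ Icc a b := by
  have hne' : I.Nonempty := hne.mono interior_subset
  have h1 : Ioo (sInf I) (sSup I) ⊆ I :=
    IsConnected.Ioo_csInf_csSup_subset ⟨hne', hI.isPreconnected⟩ hb.bddBelow hb.bddAbove
  have h2 : I ⊆ Icc (sInf I) (sSup I) := subset_Icc_csInf_csSup hb.bddBelow hb.bddAbove
  refine ⟨sInf I, sSup I, ?_, h1, h2⟩
  by_contra hlt
  push Not at hlt
  obtain ⟨x, hx⟩ := hne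
  have := interior_mono h2 hx
  rw [interior_Icc] at this
  exact absurd (this.1.trans this.2) (not_lt.2 hlt)

lemma lintegral_eq_tsum_cells {q : ℝ → ℝ} (hq : IsQuantizer q) (μ : Measure ℝ) (F : ℝ → ℝ≥0∞) :
    ∫⁻ x, F x ∂μ = ∑' c : range q, ∫⁻ x in q ⁻¹' {(c : ℝ)}, F x ∂μ := by
  have := hq.countable_range.to_subtype
  rw [← lintegral_iUnion (fun c => hq.measurable (measurableSet_singleton _))]
  · rw [show (⋃ c : range q, q ⁻¹' {(c : ℝ)}) = univ by ext x; simp, Measure.restrict_univ]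
  · intro c d hcd
    refine Set.disjoint_left.2 fun x hx hy => hcd (Subtype.ext ?_)
    rw [mem_preimage, mem_singleton_iff] at hx hy
    rw [← hx, ← hy]

/-! ### Regularity of weakly unimodal densities. -/

lemma IsDensity.measure_superlevel_pos {g : ℝ → ℝ} (hg : IsDensity g) :
    ∃ l : ℝ, 0 < l ∧ 0 < volume {x | l ≤ g x} := by
  by_contra! h
  have h0 : volume {x | 0 < g x} = 0 := by
    refine measure_mono_null (t := ⋃ n : ℕ, {x | 1 / ((n : ℝ) + 1) ≤ g x}) ?_ ?_
    · intro x hx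
      obtain ⟨n, hn⟩ := exists_nat_one_div_lt (show 0 < g x from hx)
      exact mem_iUnion.2 ⟨n, hn.le⟩
    · exact measure_iUnion_null fun n => le_antisymm (h _ (by positivity)) (zero_le)
  have h1 : ∫⁻ x, ENNReal.ofReal (g x) = 0 := by
    rw [lintegral_eq_zero_iff hg.measurable.ennreal_ofReal]
    have : ∀ᵐ x, ¬ 0 < g x := by rw [ae_iff]; simpa using h0
    filter_upwards [this] with x hx
    simpa using hx
  rw [hg.lintegral_eq_one] at h1
  exact one_ne_zero h1

namespace IsWeaklyUnimodal

variable {g : ℝ → ℝ}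

/-- The definition allows superlevel sets that are single points. Going below a level whose
superlevel set has positive measure makes the interval nondegenerate. -/
lemma exists_superlevel (hg : IsWeaklyUnimodal g) {m : ℝ} (hm : 0 < m) :
    ∃ l a b : ℝ, 0 < l ∧ l ≤ m ∧ a < b ∧ {x | l ≤ g x} = Icc a b := by
  obtain ⟨l₀, hl₀, h⟩ := hg.superlevel
  obtain ⟨l₁, hl₁, hpos⟩ := hg.isDensity.measure_superlevel_pos
  have hl : 0 < min m (min l₁ (l₀ / 2)) := lt_min hm (lt_min hl₁ (by linarith))
  have hl0 : min m (min l₁ (l₀ / 2)) < l₀ := by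
    have : min m (min l₁ (l₀ / 2)) ≤ l₀ / 2 := (min_le_right _ _).trans (min_le_right _ _)
    linarith
  obtain ⟨a, b, -, hab⟩ := h _ ⟨hl, hl0⟩
  refine ⟨_, a, b, hl, min_le_left _ _, ?_, hab⟩
  have : 0 < volume (Icc a b) := by
    rw [← hab]
    refine hpos.trans_le (measure_mono fun x hx => ?_)
    exact le_trans ((min_le_right _ _).trans (min_le_left _ _)) (show l₁ ≤ g x from hx)
  rw [Real.volume_Icc, ENNReal.ofReal_pos] at this
  linarith

/-- Two points of positivity lie in a common superlevel set, which is an interval. -/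
lemma ordConnected_pos (hg : IsWeaklyUnimodal g) : {x | 0 < g x}.OrdConnected := by
  refine ⟨fun x hx y hy z hz => ?_⟩
  obtain ⟨l, a, b, hl, hlm, -, h⟩ := hg.exists_superlevel (lt_min hx hy)
  have hx' : x ∈ Icc a b := h ▸ (hlm.trans (min_le_left _ _))
  have hy' : y ∈ Icc a b := h ▸ (hlm.trans (min_le_right _ _))
  have hz' : z ∈ {x | l ≤ g x} := h ▸ ⟨hx'.1.trans hz.1, hz.2.trans hy'.2⟩
  exact hl.trans_le hz'

/-- A nondegenerate `Icc a b` is the closure of `Ioo a b`, so each neighbourhood of `x` meets `Ioo a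
b` in a nonempty open set where `g ≥ l`. This transfers continuity from the support to the
positivity set. -/
lemma pos_subset_support (hg : IsWeaklyUnimodal g) :
    {x | 0 < g x} ⊆ (densityMeasure g).support := by
  intro x hx
  obtain ⟨l, a, b, hl, hlm, hab, h⟩ := hg.exists_superlevel hx
  have hx' : x ∈ Icc a b := h ▸ hlm
  rw [Measure.mem_support_iff_forall]
  intro U hU
  obtain ⟨V, hVU, hV, hxV⟩ := mem_nhds_iff.1 hU
  rw [← closure_Ioo hab.ne] at hx'
  have hne := mem_closure_iff.1 hx' V hV hxV
  have hpos : 0 < volume (V ∩ Ioo a b) := (hV.inter isOpen_Ioo).measure_pos _ hne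
  refine lt_of_lt_of_le ?_ (measure_mono (inter_subset_left.trans hVU : V ∩ Ioo a b ⊆ U))
  rw [densityMeasure, withDensity_apply _ (hV.inter isOpen_Ioo).measurableSet]
  calc 0 < ENNReal.ofReal l * volume (V ∩ Ioo a b) := by
        simpa using ⟨hl, hpos⟩
    _ = ∫⁻ _ in V ∩ Ioo a b, ENNReal.ofReal l := by rw [setLIntegral_const]
    _ ≤ _ := by
        refine setLIntegral_mono' (hV.inter isOpen_Ioo).measurableSet fun y hy => ?_
        refine ENNReal.ofReal_le_ofReal ?_
        have : y ∈ {x | l ≤ g x} := h ▸ Ioo_subset_Icc_self hy.2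
        exact this

lemma continuousOn_pos (hg : IsWeaklyUnimodal g) : ContinuousOn g {x | 0 < g x} :=
  hg.continuousOn.mono hg.pos_subset_support

/-- Continuity bounds `g` on a compact superlevel set; elsewhere `g` is below the level. -/
lemma bddAbove (hg : IsWeaklyUnimodal g) : ∃ B : ℝ, 0 < B ∧ ∀ x, g x ≤ B := by
  obtain ⟨l, a, b, hl, -, hab, h⟩ := hg.exists_superlevel one_pos
  have hc : ContinuousOn g (Icc a b) := by
    refine hg.continuousOn_pos.mono ?_
    rw [← h]
    exact fun x hx => hl.trans_le hx
  obtain ⟨B, hB⟩ := (isCompact_Icc.image_of_continuousOn hc).bddAbove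
  refine ⟨max B l, lt_max_of_lt_right hl, fun x => ?_⟩
  by_cases hx : l ≤ g x
  · exact (hB ⟨x, h ▸ hx, rfl⟩).trans (le_max_left _ _)
  · exact (not_le.1 hx).le.trans (le_max_right _ _)

lemma volume_frontier_pos (hg : IsWeaklyUnimodal g) : volume (frontier {x | 0 < g x}) = 0 :=
  hg.ordConnected_pos.convex.addHaar_frontier volume

lemma continuousAt_of_notMem_frontier (hg : IsWeaklyUnimodal g) {x : ℝ}
    (hx : x ∉ frontier {x | 0 < g x}) : ContinuousAt g x := by
  by_cases h : x ∈ closure {x | 0 < g x}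
  · have hi : x ∈ interior {x | 0 < g x} := by
      by_contra hi
      exact hx ⟨h, hi⟩
    exact hg.continuousOn_pos.continuousAt (mem_interior_iff_mem_nhds.1 hi)
  · have : g =ᶠ[𝓝 x] fun _ => 0 := by
      filter_upwards [isClosed_closure.isOpen_compl.mem_nhds h] with y hy
      have : ¬ 0 < g y := fun hy' => hy (subset_closure hy')
      exact le_antisymm (not_lt.1 this) (hg.isDensity.nonneg y)
    exact continuousAt_const.congr this.symm

lemma ae_continuousAt (hg : IsWeaklyUnimodal g) : ∀ᵐ x, ContinuousAt g x := by
  have : ∀ᵐ x, x ∉ frontier {x | 0 < g x} := by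
    rw [ae_iff]
    simpa using hg.volume_frontier_pos
  filter_upwards [this] with x hx using hg.continuousAt_of_notMem_frontier hx

end IsWeaklyUnimodal

/-! ### The entropy and distortion measures of a quantizer. -/

/-- The sum of the `α`-th powers of the cell masses, whose logarithm defines the entropy. -/
def cellSum (α : ℝ) (μ : Measure ℝ) (q : ℝ → ℝ) : ℝ≥0∞ :=
  ∑' c : range q, μ (q ⁻¹' {(c : ℝ)}) ^ α

/-- The probability measure giving each cell its share in `cellSum`. -/
def entropyMeasure (α : ℝ) (μ : Measure ℝ) (q : ℝ → ℝ) : Measure ℝ :=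
  μ.withDensity fun x => μ (q ⁻¹' {q x}) ^ (α - 1) * (cellSum α μ q)⁻¹

/-- The distribution of the distortion of `q`, normalized by the optimal asymptotic distortion
for a density with `∫ g ^ β₁ = G`. -/
def distortionMeasure (α r G : ℝ) (μ : Measure ℝ) (q : ℝ → ℝ) : Measure ℝ :=
  μ.withDensity fun x => ENNReal.ofReal (|x - q x| ^ r) *
    (cellSum α μ q ^ (r / (1 - α)) * (ENNReal.ofReal (constC r * G ^ beta₂ α r))⁻¹)

/-- The weighted sum of distortion and entropy measures occurring in Young's inequality. -/
def mixMeasure (α r G t : ℝ) (μ : Measure ℝ) (q : ℝ → ℝ) : Measure ℝ :=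
  ENNReal.ofReal (1 / beta₂ α r * t ^ (1 - 1 / beta₂ α r)) • distortionMeasure α r G μ q +
    ENNReal.ofReal ((1 - 1 / beta₂ α r) * t ^ (-(1 / beta₂ α r))) • entropyMeasure α μ q

/-- The limit of the entropy measures of an asymptotically optimal sequence. -/
def limitMeasure (b G : ℝ) (g : ℝ → ℝ) : Measure ℝ :=
  volume.withDensity fun x => ENNReal.ofReal (g x ^ b / G)

lemma measure_eq_tsum_cells {q : ℝ → ℝ} (hq : IsQuantizer q) (μ : Measure ℝ) {E : Set ℝ}
    (hE : MeasurableSet E) : μ E = ∑' c : range q, μ (E ∩ q ⁻¹' {(c : ℝ)}) := by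
  rw [← lintegral_indicator_one hE, lintegral_eq_tsum_cells hq]
  refine tsum_congr fun c => ?_
  rw [lintegral_indicator_one hE, Measure.restrict_apply hE]

lemma setLIntegral_densityMeasure {g : ℝ → ℝ} (hg : Measurable g) {E : Set ℝ}
    (hE : MeasurableSet E) {F : ℝ → ℝ≥0∞} (hF : Measurable F) :
    ∫⁻ x in E, F x ∂(densityMeasure g) = ∫⁻ x in E, ENNReal.ofReal (g x) * F x := by
  rw [densityMeasure, setLIntegral_withDensity_eq_setLIntegral_mul _ hg.ennreal_ofReal hF hE]
  rfl

lemma IsQuantizer.measurable_error {q : ℝ → ℝ} (hq : IsQuantizer q) (r : ℝ) :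
    Measurable fun x => ENNReal.ofReal (|x - q x| ^ r) :=
  ((continuous_abs.measurable.comp (measurable_id.sub hq.measurable)).pow_const r).ennreal_ofReal

/-! ### Small cells and the local lower bound. -/

/-- Uniform continuity on a compact thickening of `K` inside `O`, so that `y` may leave `K`: cells
meeting `K` need not be contained in it. -/
lemma exists_uniform_continuity {F : ℝ → ℝ} {O K : Set ℝ} (hO : IsOpen O) (hF : ContinuousOn F O)
    (hK : IsCompact K) (hKO : K ⊆ O) {ε : ℝ} (hε : 0 < ε) :
    ∃ ζ > 0, ∀ x ∈ K, ∀ y, |y - x| < ζ → y ∈ O ∧ |F y - F x| < ε := by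
  obtain ⟨η, hη, hsub⟩ := hK.exists_cthickening_subset_open hO hKO
  have hK' : IsCompact (Metric.cthickening η K) := hK.cthickening
  have hu := hK'.uniformContinuousOn_of_continuous (hF.mono hsub)
  obtain ⟨δ, hδ, h⟩ := Metric.uniformContinuousOn_iff.1 hu ε hε
  refine ⟨min δ η, lt_min hδ hη, fun x hx y hy => ?_⟩
  have hyK : y ∈ Metric.cthickening η K :=
    Metric.mem_cthickening_of_dist_le y x η K hx
      (by rw [Real.dist_eq]; exact hy.le.trans (min_le_right _ _))
  refine ⟨hsub hyK, ?_⟩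
  have := h y hyK x (Metric.self_subset_cthickening K hx)
    (by rw [Real.dist_eq]; exact hy.trans_le (min_le_left _ _))
  rwa [Real.dist_eq] at this

lemma exists_pos_lower_bound {g : ℝ → ℝ} {O K : Set ℝ} (hg : ContinuousOn g O)
    (hpos : ∀ x ∈ O, 0 < g x) (hK : IsCompact K) (hKO : K ⊆ O) : ∃ m > 0, ∀ x ∈ K, m ≤ g x := by
  rcases K.eq_empty_or_nonempty with rfl | hne
  · exact ⟨1, one_pos, by simp⟩
  · obtain ⟨x, hx, hmin⟩ := hK.exists_isMinOn hne (hg.mono hKO)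
    exact ⟨g x, hpos x (hKO hx), fun y hy => hmin hy⟩

/-- A quantizer with small distortion has small cells near a compact set on which the density is
positive. -/
lemma exists_cells_small {g : ℝ → ℝ} (hgm : Measurable g) {O K : Set ℝ} (hO : IsOpen O)
    (hg : ContinuousOn g O) (hpos : ∀ x ∈ O, 0 < g x) (hK : IsCompact K) (hKO : K ⊆ O) {r : ℝ}
    (hr : 1 < r) {ζ : ℝ} (hζ : 0 < ζ) :
    ∃ d > 0, ∀ q, IsQuantizer q → distortion r (densityMeasure g) q < d →
      ∀ x ∈ K, ∀ y, q y = q x → |y - x| < ζ := by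
  obtain ⟨m, hm, hmK⟩ := exists_pos_lower_bound hg hpos hK hKO
  obtain ⟨η, hη, hc⟩ := exists_uniform_continuity hO hg hK hKO (half_pos hm)
  have hC := constC_pos r hr
  set z := min ζ (η / 2) with hz
  have hz0 : 0 < z := lt_min hζ (half_pos hη)
  -- If a cell meeting `K` at `x` reached as far as `ζ` from `x`, it would contain an interval of
  -- length `z` with end point `x`, where `g ≥ m / 2`; the threshold is the least distortion this
  -- forces.
  refine ⟨ENNReal.ofReal (m / 2 * (constC r * z ^ (r + 1))), by simp; positivity, ?_⟩
  intro q hq hd x hx y hxy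
  by_contra hfar
  have hfar' : z ≤ |y - x| := (min_le_left _ _).trans (not_lt.1 hfar)
  have hord := hq.ordConnected (q x) ⟨x, rfl⟩
  obtain ⟨a, b, hab, hsub, hnear⟩ : ∃ a b, b - a = z ∧ Icc a b ⊆ q ⁻¹' {q x} ∧
      ∀ w ∈ Icc a b, |w - x| < η := by
    have hzη : z < η := (min_le_right _ _).trans_lt (half_lt_self hη)
    rcases le_total x y with h | h
    · rw [abs_of_nonneg (by linarith)] at hfar'
      refine ⟨x, x + z, by ring, (Icc_subset_Icc_right (by linarith)).trans (hord.out rfl hxy), ?_⟩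
      intro w hw
      rw [abs_of_nonneg (by linarith [hw.1])]
      linarith [hw.2]
    · rw [abs_of_nonpos (by linarith)] at hfar'
      refine ⟨x - z, x, by ring, (Icc_subset_Icc_left (by linarith)).trans (hord.out hxy rfl), ?_⟩
      intro w hw
      rw [abs_of_nonpos (by linarith [hw.2])]
      linarith [hw.1]
  refine absurd hd (not_lt.2 ?_)
  calc ENNReal.ofReal (m / 2 * (constC r * z ^ (r + 1)))
      = ENNReal.ofReal (m / 2) * ENNReal.ofReal (constC r * (b - a) ^ (r + 1)) := by
        rw [ENNReal.ofReal_mul (by positivity), hab]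
    _ ≤ ENNReal.ofReal (m / 2) * ∫⁻ w in Icc a b, ENNReal.ofReal (|w - q x| ^ r) := by
        gcongr
        exact constC_mul_rpow_le_setLIntegral r hr a b _ (by linarith)
    _ ≤ ∫⁻ w in Icc a b, ENNReal.ofReal (m / 2) * ENNReal.ofReal (|w - q x| ^ r) :=
        lintegral_const_mul_le _ _
    _ ≤ ∫⁻ w in Icc a b, ENNReal.ofReal (g w) * ENNReal.ofReal (|w - q w| ^ r) := by
        refine setLIntegral_mono' measurableSet_Icc fun w hw => ?_
        have hqw : q w = q x := hsub hw
        rw [hqw]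
        gcongr
        have h1 := (abs_lt.1 (hc x hx w (hnear w hw)).2).1
        linarith [hmK x hx]
    _ = ∫⁻ w in Icc a b, ENNReal.ofReal (|w - q w| ^ r) ∂(densityMeasure g) :=
        (setLIntegral_densityMeasure hgm measurableSet_Icc (hq.measurable_error r)).symm
    _ ≤ distortion r (densityMeasure g) q := setLIntegral_le_lintegral _ _

lemma entropyMeasure_cell {q : ℝ → ℝ} (hq : IsQuantizer q) {α : ℝ} (hα : 0 < α) (μ : Measure ℝ)
    [IsFiniteMeasure μ] (c : ℝ) :
    entropyMeasure α μ q (q ⁻¹' {c}) = μ (q ⁻¹' {c}) ^ α * (cellSum α μ q)⁻¹ := by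
  have hm := hq.measurable (measurableSet_singleton c)
  rw [entropyMeasure, withDensity_apply _ hm]
  have : ∫⁻ x in q ⁻¹' {c}, μ (q ⁻¹' {q x}) ^ (α - 1) * (cellSum α μ q)⁻¹ ∂μ =
      ∫⁻ x in q ⁻¹' {c}, μ (q ⁻¹' {c}) ^ (α - 1) * (cellSum α μ q)⁻¹ ∂μ := by
    refine setLIntegral_congr_fun hm fun x hx => ?_
    have : q x = c := hx
    simp only [this]
  rw [this, setLIntegral_const]
  -- On a null cell the density factor may be infinite, but it is multiplied by 0, and `0 ^ α = 0`.
  rcases eq_or_ne (μ (q ⁻¹' {c})) 0 with h0 | h0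
  · simp [h0, hα]
  · rw [mul_right_comm]
    congr 1
    nth_rw 2 [← ENNReal.rpow_one (μ (q ⁻¹' {c}))]
    rw [← ENNReal.rpow_add _ _ h0 (measure_ne_top _ _), sub_add_cancel]

lemma entropyMeasure_univ {q : ℝ → ℝ} (hq : IsQuantizer q) {α : ℝ} (hα : 0 < α) (μ : Measure ℝ)
    [IsFiniteMeasure μ] (h0 : cellSum α μ q ≠ 0) (h1 : cellSum α μ q ≠ ∞) :
    entropyMeasure α μ q univ = 1 := by
  rw [measure_eq_tsum_cells hq _ MeasurableSet.univ]
  simp_rw [univ_inter, entropyMeasure_cell hq hα]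
  rw [ENNReal.tsum_mul_right]
  exact ENNReal.mul_inv_cancel h0 h1

/-- With `ℓ = b - a`, the entropy measure of the cell is at least `(m ℓ) ^ α / s`, and by optimality
of the midpoint its distortion measure is at least `s ^ (r / (1 - α)) m ℓ ^ (r + 1) / G ^ β₂`. These
are the two terms of `young_cell`. -/
lemma mixMeasure_cell_ge {r α : ℝ} (hr : 1 < r) (hα : α ∈ Ioo (0 : ℝ) 1) {G t : ℝ} (hG : 0 < G)
    (ht : 0 < t) {g : ℝ → ℝ} (hg : Measurable g) [IsFiniteMeasure (densityMeasure g)]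
    {q : ℝ → ℝ} (hq : IsQuantizer q)
    (h0 : cellSum α (densityMeasure g) q ≠ 0) (h1 : cellSum α (densityMeasure g) q ≠ ∞)
    {c a b m : ℝ} (hm : 0 < m) (hab : a < b)
    (hab1 : Ioo a b ⊆ q ⁻¹' {c}) (hgm : ∀ x ∈ q ⁻¹' {c}, m ≤ g x) :
    ENNReal.ofReal (m ^ beta₁ α r * (b - a) / G) ≤
      mixMeasure α r G t (densityMeasure g) q (q ⁻¹' {c}) := by
  obtain ⟨s, hs, hs'⟩ : ∃ s : ℝ, 0 < s ∧ cellSum α (densityMeasure g) q = ENNReal.ofReal s :=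
    ⟨_, ENNReal.toReal_pos h0 h1, (ENNReal.ofReal_toReal h1).symm⟩
  have hC := constC_pos r hr
  have h1α : 0 < 1 - α := by linarith [hα.2]
  have hb : 1 < beta₂ α r := by
    unfold beta₂
    rw [lt_div_iff₀ h1α]
    linarith
  have hθ1 : 0 ≤ 1 - 1 / beta₂ α r := by
    rw [sub_nonneg, div_le_one (by linarith)]
    exact hb.le
  have hℓ : 0 < b - a := sub_pos.2 hab
  have hcell := hq.measurable (measurableSet_singleton c)
  have hA : ENNReal.ofReal ((m * (b - a)) ^ α / s) ≤
      entropyMeasure α (densityMeasure g) q (q ⁻¹' {c}) := by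
    rw [entropyMeasure_cell hq hα.1, hs', ENNReal.ofReal_div_of_pos hs, div_eq_mul_inv,
      ← ENNReal.ofReal_rpow_of_pos (by positivity)]
    gcongr
    · exact hα.1.le
    calc ENNReal.ofReal (m * (b - a)) = ∫⁻ _ in Ioo a b, ENNReal.ofReal m := by
          rw [setLIntegral_const, Real.volume_Ioo, ENNReal.ofReal_mul hm.le]
      _ ≤ ∫⁻ x in Ioo a b, ENNReal.ofReal (g x) :=
          setLIntegral_mono' measurableSet_Ioo fun x hx =>
            ENNReal.ofReal_le_ofReal (hgm x (hab1 hx))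
      _ = densityMeasure g (Ioo a b) := by
          rw [densityMeasure, withDensity_apply _ measurableSet_Ioo]
      _ ≤ _ := measure_mono hab1
  have hB : ENNReal.ofReal (s ^ (r / (1 - α)) * (m * (b - a) ^ (r + 1)) / G ^ beta₂ α r) ≤
      distortionMeasure α r G (densityMeasure g) q (q ⁻¹' {c}) := by
    rw [distortionMeasure, withDensity_apply _ hcell,
      lintegral_mul_const _ (hq.measurable_error r), hs']
    have e : s ^ (r / (1 - α)) * (m * (b - a) ^ (r + 1)) / G ^ beta₂ α r =
        (m * (constC r * (b - a) ^ (r + 1))) *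
          (s ^ (r / (1 - α)) * (constC r * G ^ beta₂ α r)⁻¹) := by
      have := hC.ne'
      have : G ^ beta₂ α r ≠ 0 := by positivity
      field_simp
    rw [e, ENNReal.ofReal_mul (by positivity),
      ENNReal.ofReal_mul (p := s ^ (r / (1 - α))) (by positivity),
      ENNReal.ofReal_inv_of_pos (by positivity), ENNReal.ofReal_rpow_of_pos hs]
    gcongr
    calc ENNReal.ofReal (m * (constC r * (b - a) ^ (r + 1)))
        = ENNReal.ofReal m * ENNReal.ofReal (constC r * (b - a) ^ (r + 1)) := by
          rw [ENNReal.ofReal_mul (by positivity)]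
      _ ≤ ENNReal.ofReal m * ∫⁻ w in Icc a b, ENNReal.ofReal (|w - c| ^ r) := by
          gcongr
          exact constC_mul_rpow_le_setLIntegral r hr a b _ hab.le
      _ = ENNReal.ofReal m * ∫⁻ w in Ioo a b, ENNReal.ofReal (|w - c| ^ r) := by
          rw [setLIntegral_congr Ioo_ae_eq_Icc]
      _ ≤ ∫⁻ w in Ioo a b, ENNReal.ofReal m * ENNReal.ofReal (|w - c| ^ r) :=
          lintegral_const_mul_le _ _
      _ ≤ ∫⁻ w in Ioo a b, ENNReal.ofReal (g w) * ENNReal.ofReal (|w - q w| ^ r) := by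
          refine setLIntegral_mono' measurableSet_Ioo fun w hw => ?_
          have hqw : q w = c := hab1 hw
          rw [hqw]
          gcongr
          exact hgm w (hab1 hw)
      _ = ∫⁻ w in Ioo a b, ENNReal.ofReal (|w - q w| ^ r) ∂(densityMeasure g) :=
          (setLIntegral_densityMeasure hg measurableSet_Ioo (hq.measurable_error r)).symm
      _ ≤ _ := lintegral_mono_set hab1
  have hy := ENNReal.ofReal_le_ofReal
    (young_cell r α hr hα t s m (b - a) G ht hs hm hℓ hG)
  refine hy.trans ?_
  rw [ENNReal.ofReal_add (by positivity) (by positivity), ENNReal.ofReal_mul (by positivity),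
    ENNReal.ofReal_mul (p := (1 - 1 / beta₂ α r) * t ^ (-(1 / beta₂ α r))) (by positivity)]
  simp only [mixMeasure, Measure.add_apply, Measure.smul_apply, smul_eq_mul]
  gcongr

/-- For small distortion, every cell meeting `K` lies in `U` and `g` varies little on it. The factor
`κ` is lost twice: comparing `g` on `K ∩` cell with `g x` from above, and `g x` with `g` on the
whole cell from below. -/
lemma exists_mixMeasure_open_ge {r α : ℝ} (hr : 1 < r) (hα : α ∈ Ioo (0 : ℝ) 1) {G t : ℝ}
    (hG : 0 < G) (ht : 0 < t) {g : ℝ → ℝ} (hgm : Measurable g)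
    [IsFiniteMeasure (densityMeasure g)] {O K U : Set ℝ} (hO : IsOpen O)
    (hg : ContinuousOn g O) (hpos : ∀ x ∈ O, 0 < g x) (hU : IsOpen U) (hK : IsCompact K)
    (hKO : K ⊆ U ∩ O) {κ : ℝ} (hκ : κ ∈ Ioo (0 : ℝ) 1) :
    ∃ d > 0, ∀ q, IsQuantizer q → distortion r (densityMeasure g) q < d →
      cellSum α (densityMeasure g) q ≠ 0 → cellSum α (densityMeasure g) q ≠ ∞ →
      ENNReal.ofReal ((κ * κ) ^ beta₁ α r) * limitMeasure (beta₁ α r) G g K ≤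
        mixMeasure α r G t (densityMeasure g) q U := by
  obtain ⟨m₀, hm₀, hmK⟩ := exists_pos_lower_bound hg hpos hK (hKO.trans inter_subset_right)
  -- An absolute oscillation below `(1 - κ) m₀`, with `m₀` a lower bound of `g` on `K`, is the
  -- relative bound `κ * g x ≤ g y`.
  obtain ⟨ζ, hζ, hcont⟩ := exists_uniform_continuity (hU.inter hO) (hg.mono inter_subset_right) hK
    hKO (mul_pos (sub_pos.2 hκ.2) hm₀)
  obtain ⟨d, hd, hsmall⟩ := exists_cells_small hgm hO hg hpos hK (hKO.trans inter_subset_right)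
    hr hζ
  refine ⟨d, hd, fun q hq hdist h0 h1 => ?_⟩
  have hratio : ∀ x ∈ K, ∀ y, q y = q x → y ∈ U ∧ κ * g x ≤ g y := by
    intro x hx y hxy
    obtain ⟨h2, h3⟩ := hcont x hx y (hsmall q hq hdist x hx y hxy)
    refine ⟨h2.1, ?_⟩
    have h4 := (abs_lt.1 h3).1
    have h5 : (1 - κ) * m₀ ≤ (1 - κ) * g x :=
      mul_le_mul_of_nonneg_left (hmK x hx) (sub_pos.2 hκ.2).le
    linarith
  have hβ : 0 ≤ beta₁ α r := by
    unfold beta₁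
    have h1 := hα.1
    have h2 := hα.2
    have : 0 < 1 - α := by linarith
    positivity
  rw [measure_eq_tsum_cells hq _ hK.measurableSet, measure_eq_tsum_cells hq _ hU.measurableSet,
    ← ENNReal.tsum_mul_left]
  refine ENNReal.tsum_le_tsum fun c => ?_
  rcases (K ∩ q ⁻¹' {(c : ℝ)}).eq_empty_or_nonempty with he | ⟨x, hxK, hxc⟩
  · rw [he]
    simp
  have hxc' : q x = c := hxc
  have hsubU : q ⁻¹' {(c : ℝ)} ⊆ U := fun y hy =>
    (hratio x hxK y ((show q y = c from hy).trans hxc'.symm)).1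
  rw [inter_eq_right.2 hsubU]
  have hbdd : Bornology.IsBounded (q ⁻¹' {(c : ℝ)}) := by
    refine (Metric.isBounded_ball (x := x) (r := ζ)).subset fun y hy => ?_
    rw [Metric.mem_ball, Real.dist_eq]
    exact hsmall q hq hdist x hxK y ((show q y = c from hy).trans hxc'.symm)
  obtain ⟨a, b, hab, hab1, hab2⟩ := ordConnected_bounded (hq.ordConnected c c.2)
    ⟨_, hq.mem_interior c c.2⟩ hbdd
  have hgx : 0 < g x := hpos x (hKO hxK).2
  have hm : 0 < κ * g x := mul_pos hκ.1 hgx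
  refine le_trans ?_ (mixMeasure_cell_ge hr hα hG ht hgm hq h0 h1 hm hab hab1
    fun y hy => (hratio x hxK y ((show q y = c from hy).trans hxc'.symm)).2)
  have hmeas : MeasurableSet (K ∩ q ⁻¹' {(c : ℝ)}) :=
    hK.measurableSet.inter (hq.measurable (measurableSet_singleton _))
  have hκ0 := hκ.1
  calc ENNReal.ofReal ((κ * κ) ^ beta₁ α r) *
        limitMeasure (beta₁ α r) G g (K ∩ q ⁻¹' {(c : ℝ)})
      = ENNReal.ofReal ((κ * κ) ^ beta₁ α r) *
        ∫⁻ y in K ∩ q ⁻¹' {(c : ℝ)}, ENNReal.ofReal (g y ^ beta₁ α r / G) := by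
        rw [limitMeasure, withDensity_apply _ hmeas]
    _ ≤ ENNReal.ofReal ((κ * κ) ^ beta₁ α r) *
        ∫⁻ _ in K ∩ q ⁻¹' {(c : ℝ)}, ENNReal.ofReal ((κ⁻¹ * g x) ^ beta₁ α r / G) := by
        gcongr _ * ?_
        refine setLIntegral_mono' hmeas fun y hy => ENNReal.ofReal_le_ofReal ?_
        have h2 := (hratio y hy.1 x (hxc'.trans (show q y = c from hy.2).symm)).2
        have h3 : g y ≤ κ⁻¹ * g x := by
          rw [le_inv_mul_iff₀ hκ0]
          exact h2
        have h4 : 0 < g y := hpos y (hKO hy.1).2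
        gcongr
    _ ≤ ENNReal.ofReal ((κ * κ) ^ beta₁ α r) *
        (ENNReal.ofReal ((κ⁻¹ * g x) ^ beta₁ α r / G) * ENNReal.ofReal (b - a)) := by
        rw [setLIntegral_const, ← Real.volume_Icc]
        gcongr
        exact inter_subset_right.trans hab2
    _ = ENNReal.ofReal ((κ * g x) ^ beta₁ α r * (b - a) / G) := by
        rw [← ENNReal.ofReal_mul (by positivity), ← ENNReal.ofReal_mul (by positivity)]
        congr 1
        have : κ * g x = κ * κ * (κ⁻¹ * g x) := by field_simp
        rw [this, Real.mul_rpow (x := κ * κ) (y := κ⁻¹ * g x) (by positivity) (by positivity)]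
        ring

/-! ### Weak convergence from equality in Young's inequality. -/

/-- The equality case of Young's inequality, in the form of a first order condition. -/
lemma eq_of_forall_young {θ : ℝ} (hθ : θ ∈ Ioo (0 : ℝ) 1) {a a' b b' c c' L : ℝ}
    (ha : a + a' = L) (hb : b + b' ≤ L) (hc : c + c' = L)
    (h : ∀ t : ℝ, 0 < t → c ≤ θ * t ^ (1 - θ) * b + (1 - θ) * t ^ (-θ) * a)
    (h' : c' ≤ θ * b' + (1 - θ) * a') : a = c ∧ b = c := by
  obtain ⟨h0, h1⟩ := hθ
  have h1' : 0 < 1 - θ := by linarith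
  -- `θ b + (1 - θ) a ≤ L - (θ b' + (1 - θ) a') ≤ L - c' = c`: the complementary bound gives the
  -- reverse inequality at `t = 1`.
  have hle : θ * b + (1 - θ) * a ≤ c := by nlinarith
  have heq : θ * b + (1 - θ) * a = c := by
    refine le_antisymm hle ?_
    simpa using h 1 one_pos
  -- So `t = 1` is a minimum, and the derivative there, `θ (1 - θ) (b - a)`, vanishes.
  have hder : HasDerivAt (fun t : ℝ => θ * t ^ (1 - θ) * b + (1 - θ) * t ^ (-θ) * a)
      (θ * ((1 - θ) * (1 : ℝ) ^ (1 - θ - 1)) * b + (1 - θ) * (-θ * (1 : ℝ) ^ (-θ - 1)) * a) 1 := by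
    have e1 := Real.hasDerivAt_rpow_const (x := 1) (p := 1 - θ) (Or.inl one_ne_zero)
    have e2 := Real.hasDerivAt_rpow_const (x := 1) (p := -θ) (Or.inl one_ne_zero)
    exact ((e1.const_mul θ).mul_const b).add ((e2.const_mul (1 - θ)).mul_const a)
  have hmin : IsLocalMin (fun t : ℝ => θ * t ^ (1 - θ) * b + (1 - θ) * t ^ (-θ) * a) 1 := by
    filter_upwards [lt_mem_nhds (one_pos : (0 : ℝ) < 1)] with t ht
    have := h t ht
    simp only [Real.one_rpow, mul_one]
    linarith
  have hz := hmin.hasDerivAt_eq_zero hder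
  simp only [Real.one_rpow, mul_one] at hz
  have hba : b = a := by
    have : θ * (1 - θ) * (b - a) = 0 := by linarith
    have := (mul_eq_zero.1 this).resolve_left (mul_pos h0 h1').ne'
    linarith
  subst hba
  constructor <;> linarith

lemma one_div_beta₂_mem {r α : ℝ} (hr : 1 < r) (hα : α ∈ Ioo (0 : ℝ) 1) :
    1 / beta₂ α r ∈ Ioo (0 : ℝ) 1 := by
  have h1α : 0 < 1 - α := by linarith [hα.2]
  have hb : 1 < beta₂ α r := by
    unfold beta₂
    rw [lt_div_iff₀ h1α]
    linarith
  exact ⟨by positivity, by rw [div_lt_one (by linarith)]; exact hb⟩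

/-- Inner regularity replaces `U ∩ O` by a compact set of almost the same measure, and `κ` is taken
close to 1. -/
lemma limitMeasure_le_liminf_mixMeasure {r α : ℝ} (hr : 1 < r) (hα : α ∈ Ioo (0 : ℝ) 1) {G t : ℝ}
    (hG : 0 < G) (ht : 0 < t) {g : ℝ → ℝ} (hgm : Measurable g)
    [IsFiniteMeasure (densityMeasure g)] {O U : Set ℝ} (hO : IsOpen O)
    (hg : ContinuousOn g O) (hpos : ∀ x ∈ O, 0 < g x) (hU : IsOpen U)
    (hOc : limitMeasure (beta₁ α r) G g Oᶜ = 0) (huniv : limitMeasure (beta₁ α r) G g univ = 1)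
    {q : ℕ → ℝ → ℝ} (hq : ∀ n, IsQuantizer (q n))
    (hs : ∀ᶠ n in atTop, cellSum α (densityMeasure g) (q n) ≠ 0 ∧
      cellSum α (densityMeasure g) (q n) ≠ ∞)
    (hD : Tendsto (fun n => distortion r (densityMeasure g) (q n)) atTop (𝓝 0)) :
    limitMeasure (beta₁ α r) G g U ≤
      liminf (fun n => mixMeasure α r G t (densityMeasure g) (q n) U) atTop := by
  have : IsFiniteMeasure (limitMeasure (beta₁ α r) G g) := ⟨by rw [huniv]; exact ENNReal.one_lt_top⟩
  have hUO : limitMeasure (beta₁ α r) G g U = limitMeasure (beta₁ α r) G g (U ∩ O) := by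
    refine le_antisymm ?_ (measure_mono inter_subset_left)
    calc limitMeasure (beta₁ α r) G g U
        ≤ limitMeasure (beta₁ α r) G g (U ∩ O ∪ Oᶜ) := measure_mono fun x hx => by
          by_cases h : x ∈ O
          · exact Or.inl ⟨hx, h⟩
          · exact Or.inr h
      _ ≤ _ := (measure_union_le _ _).trans (by rw [hOc, add_zero])
  rw [hUO]
  refine le_of_forall_lt fun c hc => ?_
  obtain ⟨K, hKU, hK, hcK⟩ := (hU.inter hO).exists_lt_isCompact hc
  have hκ : ∃ κ ∈ Ioo (0 : ℝ) 1,
      c < ENNReal.ofReal ((κ * κ) ^ beta₁ α r) * limitMeasure (beta₁ α r) G g K := by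
    have hlim : Tendsto (fun κ : ℝ => ENNReal.ofReal ((κ * κ) ^ beta₁ α r) *
        limitMeasure (beta₁ α r) G g K) (𝓝[<] 1)
        (𝓝 (ENNReal.ofReal ((1 * 1) ^ beta₁ α r) * limitMeasure (beta₁ α r) G g K)) := by
      refine tendsto_nhdsWithin_of_tendsto_nhds ?_
      refine ENNReal.Tendsto.mul_const ?_ (Or.inr (measure_ne_top _ _))
      refine ENNReal.tendsto_ofReal ?_
      refine Tendsto.rpow_const (tendsto_id.mul tendsto_id) (Or.inl (by norm_num))
    simp only [mul_one, Real.one_rpow, ENNReal.ofReal_one, one_mul] at hlim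
    obtain ⟨κ, h1, h2⟩ := ((hlim.eventually (lt_mem_nhds hcK)).and
      (Ioo_mem_nhdsLT (zero_lt_one (α := ℝ)))).exists
    exact ⟨κ, h2, h1⟩
  obtain ⟨κ, hκ, hcκ⟩ := hκ
  obtain ⟨d, hd, hlow⟩ := exists_mixMeasure_open_ge hr hα hG ht hgm hO hg hpos hU hK hKU hκ
  refine hcκ.trans_le (le_liminf_of_le ?_ ?_)
  · isBoundedDefault
  · filter_upwards [hs, hD.eventually (gt_mem_nhds hd)] with n hn hdn
    exact hlow (q n) (hq n) hdn hn.1 hn.2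

lemma lintegral_mixMeasure {α r G t : ℝ} {μ : Measure ℝ} {q : ℝ → ℝ} (F : ℝ → ℝ≥0∞) :
    ∫⁻ x, F x ∂(mixMeasure α r G t μ q) =
      ENNReal.ofReal (1 / beta₂ α r * t ^ (1 - 1 / beta₂ α r)) *
          ∫⁻ x, F x ∂(distortionMeasure α r G μ q) +
        ENNReal.ofReal ((1 - 1 / beta₂ α r) * t ^ (-(1 / beta₂ α r))) *
          ∫⁻ x, F x ∂(entropyMeasure α μ q) := by
  rw [mixMeasure, lintegral_add_measure, lintegral_smul_measure, lintegral_smul_measure]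
  rfl

/-- Along a sequence of quantizers whose distortion is asymptotically at most the optimal one,
both the entropy measures and the distortion measures converge weakly to the limit measure. -/
theorem tendsto_lintegral_entropyMeasure_distortionMeasure {r α : ℝ} (hr : 1 < r)
    (hα : α ∈ Ioo (0 : ℝ) 1) {G : ℝ}
    (hG : 0 < G) {g : ℝ → ℝ} (hgm : Measurable g)
    [IsFiniteMeasure (densityMeasure g)] {O : Set ℝ} (hO : IsOpen O)
    (hg : ContinuousOn g O) (hpos : ∀ x ∈ O, 0 < g x)
    (hOc : limitMeasure (beta₁ α r) G g Oᶜ = 0) (huniv : limitMeasure (beta₁ α r) G g univ = 1)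
    {q : ℕ → ℝ → ℝ} (hq : ∀ n, IsQuantizer (q n))
    (hs : ∀ᶠ n in atTop, cellSum α (densityMeasure g) (q n) ≠ 0 ∧
      cellSum α (densityMeasure g) (q n) ≠ ∞)
    (hD : Tendsto (fun n => distortion r (densityMeasure g) (q n)) atTop (𝓝 0))
    (hB : limsup (fun n => distortionMeasure α r G (densityMeasure g) (q n) univ) atTop ≤ 1)
    {φ : ℝ → ℝ} (hφ : Continuous φ) (hφ0 : ∀ x, 0 ≤ φ x) {L : ℝ} (hφL : ∀ x, φ x ≤ L) :
    Tendsto (fun n => ∫⁻ x, ENNReal.ofReal (φ x) ∂(entropyMeasure α (densityMeasure g) (q n)))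
      atTop (𝓝 (∫⁻ x, ENNReal.ofReal (φ x) ∂(limitMeasure (beta₁ α r) G g))) ∧
    Tendsto (fun n => ∫⁻ x, ENNReal.ofReal (φ x) ∂(distortionMeasure α r G (densityMeasure g) (q n)))
      atTop (𝓝 (∫⁻ x, ENNReal.ofReal (φ x) ∂(limitMeasure (beta₁ α r) G g))) := by
  set μ := densityMeasure g with hμ
  set γ := limitMeasure (beta₁ α r) G g with hγ
  set θ := 1 / beta₂ α r with hθdef
  have hθ : θ ∈ Ioo (0 : ℝ) 1 := one_div_beta₂_mem hr hα
  have hθ0 : 0 < θ := hθ.1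
  have hθ1 : 0 < 1 - θ := by linarith [hθ.2]
  have hL : 0 ≤ L := (hφ0 0).trans (hφL 0)
  have hsum : ∀ M : Measure ℝ, ∫⁻ x, ENNReal.ofReal (φ x) ∂M + ∫⁻ x, ENNReal.ofReal (L - φ x) ∂M =
      ENNReal.ofReal L * M univ := by
    intro M
    rw [← lintegral_add_left hφ.measurable.ennreal_ofReal, ← lintegral_const]
    refine lintegral_congr fun x => ?_
    rw [← ENNReal.ofReal_add (hφ0 x) (sub_nonneg.2 (hφL x)), add_sub_cancel]
  have hlim : ∀ ψ : ℝ → ℝ, Continuous ψ → (∀ x, 0 ≤ ψ x) → ∀ V : Ultrafilter ℕ,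
      ↑V ≤ (atTop : Filter ℕ) →
      ∀ a b : ℝ≥0∞, Tendsto (fun n => ∫⁻ x, ENNReal.ofReal (ψ x) ∂(entropyMeasure α μ (q n))) V
        (𝓝 a) →
      Tendsto (fun n => ∫⁻ x, ENNReal.ofReal (ψ x) ∂(distortionMeasure α r G μ (q n))) V
        (𝓝 b) →
      ∀ t : ℝ, 0 < t → ∫⁻ x, ENNReal.ofReal (ψ x) ∂γ ≤
        ENNReal.ofReal (θ * t ^ (1 - θ)) * b + ENNReal.ofReal ((1 - θ) * t ^ (-θ)) * a := by
    intro ψ hψ hψ0 V hV a b ha hb t ht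
    -- Portmanteau argument: lower bounds on open sets pass to nonnegative continuous functions.
    have h1 := lintegral_le_liminf_lintegral_of_forall_isOpen_measure_le_liminf_measure hψ hψ0
      (fun U hU => limitMeasure_le_liminf_mixMeasure hr hα hG ht hgm hO hg hpos hU hOc huniv hq hs
        hD)
    refine h1.trans ((liminf_le_liminf_of_le hV).trans (le_of_eq (Tendsto.liminf_eq ?_)))
    simp_rw [lintegral_mixMeasure]
    exact (ENNReal.Tendsto.const_mul hb (Or.inr ENNReal.ofReal_ne_top)).add
      (ENNReal.Tendsto.const_mul ha (Or.inr ENNReal.ofReal_ne_top))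
  have hmain : ∀ V : Ultrafilter ℕ, ↑V ≤ (atTop : Filter ℕ) →
      Tendsto (fun n => ∫⁻ x, ENNReal.ofReal (φ x) ∂(entropyMeasure α μ (q n))) V
        (𝓝 (∫⁻ x, ENNReal.ofReal (φ x) ∂γ)) ∧
      Tendsto (fun n => ∫⁻ x, ENNReal.ofReal (φ x) ∂(distortionMeasure α r G μ (q n))) V
        (𝓝 (∫⁻ x, ENNReal.ofReal (φ x) ∂γ)) := by
    intro V hV
    -- Compactness of `[0, ∞]` gives all limits along an ultrafilter, so no subsequences are needed.
    have hex : ∀ u : ℕ → ℝ≥0∞, ∃ a, Tendsto u V (𝓝 a) := fun u => ⟨_, (V.map u).le_nhds_lim⟩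
    have hφ' : Continuous fun x => L - φ x := continuous_const.sub hφ
    have hφ'0 : ∀ x, 0 ≤ L - φ x := fun x => sub_nonneg.2 (hφL x)
    obtain ⟨a, ha⟩ := hex fun n => ∫⁻ x, ENNReal.ofReal (φ x) ∂(entropyMeasure α μ (q n))
    obtain ⟨b, hb⟩ := hex fun n => ∫⁻ x, ENNReal.ofReal (φ x) ∂(distortionMeasure α r G μ (q n))
    obtain ⟨a', ha'⟩ := hex fun n => ∫⁻ x, ENNReal.ofReal (L - φ x) ∂(entropyMeasure α μ (q n))
    obtain ⟨b', hb'⟩ := hex fun n =>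
      ∫⁻ x, ENNReal.ofReal (L - φ x) ∂(distortionMeasure α r G μ (q n))
    obtain ⟨β, hβ⟩ := hex fun n => distortionMeasure α r G μ (q n) univ
    have hβ1 : β ≤ 1 := by
      rw [← hβ.limsup_eq]
      exact (limsup_le_limsup_of_le hV).trans hB
    have haa : a + a' = ENNReal.ofReal L := by
      refine tendsto_nhds_unique (ha.add ha') (tendsto_const_nhds.congr' ?_)
      filter_upwards [hV hs] with n hn
      rw [hsum, entropyMeasure_univ (hq n) hα.1 μ hn.1 hn.2, mul_one]
    have hbb : b + b' ≤ ENNReal.ofReal L := by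
      have : b + b' = ENNReal.ofReal L * β := by
        refine tendsto_nhds_unique (hb.add hb') ?_
        simp_rw [hsum]
        exact ENNReal.Tendsto.const_mul hβ (Or.inr ENNReal.ofReal_ne_top)
      rw [this]
      -- Here the optimality of the sequence enters: the limiting mass `β` of the distortion
      -- measures is at most 1.
      exact mul_le_of_le_one_right (zero_le) hβ1
    have hcc := hsum γ
    rw [huniv, mul_one] at hcc
    have hay := hlim φ hφ hφ0 V hV a b ha hb
    have hay' := hlim _ hφ' hφ'0 V hV a' b' ha' hb' 1 one_pos
    generalize ∫⁻ x, ENNReal.ofReal (φ x) ∂γ = c at *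
    generalize ∫⁻ x, ENNReal.ofReal (L - φ x) ∂γ = c' at *
    have fin : ∀ x y : ℝ≥0∞, x + y ≤ ENNReal.ofReal L → x ≠ ∞ ∧ y ≠ ∞ := fun x y hxy =>
      ⟨ne_top_of_le_ne_top ENNReal.ofReal_ne_top (le_self_add.trans hxy),
        ne_top_of_le_ne_top ENNReal.ofReal_ne_top (le_add_self.trans hxy)⟩
    obtain ⟨fa, fa'⟩ := fin a a' haa.le
    obtain ⟨fb, fb'⟩ := fin b b' hbb
    obtain ⟨fc, fc'⟩ := fin c c' hcc.le
    lift a to NNReal using fa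
    lift a' to NNReal using fa'
    lift b to NNReal using fb
    lift b' to NNReal using fb'
    lift c to NNReal using fc
    lift c' to NNReal using fc'
    have tr : ∀ x : NNReal, (x : ℝ≥0∞) = ENNReal.ofReal (x : ℝ) := fun x =>
      (ENNReal.ofReal_coe_nnreal).symm
    have key : (a : ℝ) = c ∧ (b : ℝ) = c := by
      refine eq_of_forall_young (a' := a') (b' := b') (c' := c') (L := L) hθ ?_ ?_ ?_ ?_ ?_
      · rw [tr a, tr a', ← ENNReal.ofReal_add (by positivity) (by positivity),
          ENNReal.ofReal_eq_ofReal_iff (by positivity) hL] at haa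
        exact haa
      · rw [tr b, tr b', ← ENNReal.ofReal_add (by positivity) (by positivity),
          ENNReal.ofReal_le_ofReal_iff hL] at hbb
        exact hbb
      · rw [tr c, tr c', ← ENNReal.ofReal_add (by positivity) (by positivity),
          ENNReal.ofReal_eq_ofReal_iff (by positivity) hL] at hcc
        exact hcc
      · intro t ht
        have := hay t ht
        rw [tr a, tr b, tr c, ← ENNReal.ofReal_mul (by positivity),
          ← ENNReal.ofReal_mul (by positivity), ← ENNReal.ofReal_add (by positivity)
          (by positivity), ENNReal.ofReal_le_ofReal_iff (by positivity)] at this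
        exact this
      · rw [tr a', tr b', tr c', ← ENNReal.ofReal_mul (by positivity),
          ← ENNReal.ofReal_mul (by positivity), ← ENNReal.ofReal_add (by positivity)
          (by positivity), ENNReal.ofReal_le_ofReal_iff (by positivity)] at hay'
        simpa using hay'
    obtain ⟨k1, k2⟩ := key
    rw [NNReal.coe_inj] at k1 k2
    rw [k1] at ha
    rw [k2] at hb
    exact ⟨ha, hb⟩
  exact ⟨(tendsto_iff_ultrafilter _ _ _).2 fun V hV => (hmain V hV).1,
    (tendsto_iff_ultrafilter _ _ _).2 fun V hV => (hmain V hV).2⟩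

/-! ### Passing to the limit with varying integrands. -/

/-- Weak convergence of measures, combined with locally uniform convergence of the bounded
integrands on an open set of full measure for the limit. -/
theorem tendsto_lintegral_of_locally_uniform {P : ℕ → Measure ℝ} {γ : Measure ℝ}
    [IsFiniteMeasure γ] {O : Set ℝ} (hO : IsOpen O) (hOc : γ Oᶜ = 0)
    (hP : ∀ φ : ℝ → ℝ, Continuous φ → (∀ x, 0 ≤ φ x) → ∀ L : ℝ, (∀ x, φ x ≤ L) →
      Tendsto (fun n => ∫⁻ x, ENNReal.ofReal (φ x) ∂(P n)) atTop
        (𝓝 (∫⁻ x, ENNReal.ofReal (φ x) ∂γ)))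
    {ψ : ℕ → ℝ → ℝ} {Ψ : ℝ → ℝ} {L : ℝ} (h0 : ∀ n x, 0 ≤ ψ n x) (hL : ∀ n x, ψ n x ≤ L)
    (hΨ0 : ∀ x, 0 ≤ Ψ x) (hΨL : ∀ x, Ψ x ≤ L) (hΨ : ContinuousOn Ψ O)
    (hunif : ∀ K ⊆ O, IsCompact K → ∀ ε > 0, ∀ᶠ n in atTop, ∀ x ∈ K, |ψ n x - Ψ x| ≤ ε) :
    Tendsto (fun n => ∫⁻ x, ENNReal.ofReal (ψ n x) ∂(P n)) atTop
      (𝓝 (∫⁻ x, ENNReal.ofReal (Ψ x) ∂γ)) := by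
  rw [tendsto_iff_ultrafilter]
  intro V hV
  obtain ⟨l, hl⟩ : ∃ l, Tendsto (fun n => ∫⁻ x, ENNReal.ofReal (ψ n x) ∂(P n)) V (𝓝 l) :=
    ⟨_, (V.map fun n => ∫⁻ x, ENNReal.ofReal (ψ n x) ∂(P n)).le_nhds_lim⟩
  have hL0 : 0 ≤ L := (hΨ0 0).trans (hΨL 0)
  set c := γ univ + ENNReal.ofReal L with hc
  have hctop : c ≠ ∞ := by simp [hc]
  have key : ∀ ε : ℝ, 0 < ε → l ≤ ∫⁻ x, ENNReal.ofReal (Ψ x) ∂γ + ENNReal.ofReal ε * c ∧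
      ∫⁻ x, ENNReal.ofReal (Ψ x) ∂γ ≤ l + ENNReal.ofReal ε * c := by
    intro ε hε
    obtain ⟨K, hKO, hK, hγK⟩ : ∃ K ⊆ O, IsCompact K ∧ γ Kᶜ ≤ ENNReal.ofReal ε := by
      obtain ⟨K, hKO, hK, hlt⟩ := hO.measurableSet.exists_isCompact_lt_add (measure_ne_top γ O)
        (ENNReal.ofReal_pos.2 hε).ne'
      refine ⟨K, hKO, hK, ?_⟩
      have hO' : γ O = γ univ := by
        rw [← measure_add_measure_compl hO.measurableSet (μ := γ), hOc, add_zero]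
      rw [hO', ← measure_add_measure_compl hK.measurableSet (μ := γ)] at hlt
      exact (ENNReal.add_le_add_iff_left (measure_ne_top γ K)).1 hlt.le
    obtain ⟨χ, hχ1, hχc, hχO, hχ01⟩ := exists_continuousMap_one_of_isCompact_subset_isOpen hK hO hKO
    -- `Ψ` is continuous only on `O`, but the support of the cutoff `χ` lies in `O`.
    have hχΨ : Continuous fun x => χ x * Ψ x := by
      refine continuous_of_tsupport fun x hx => ?_
      have hxO : x ∈ O := hχO (tsupport_mul_subset_left hx)
      exact χ.continuous.continuousAt.mul (hΨ.continuousAt (hO.mem_nhds hxO))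
    have hχΨ0 : ∀ x, 0 ≤ χ x * Ψ x := fun x => mul_nonneg (hχ01 x).1 (hΨ0 x)
    have hχΨL : ∀ x, χ x * Ψ x ≤ L := fun x =>
      (mul_le_of_le_one_left (hΨ0 x) (hχ01 x).2).trans (hΨL x)
    have hrest : ∫⁻ x, ENNReal.ofReal (L * (1 - χ x)) ∂γ ≤ ENNReal.ofReal ε * ENNReal.ofReal L := by
      calc ∫⁻ x, ENNReal.ofReal (L * (1 - χ x)) ∂γ
          ≤ ∫⁻ x, (Kᶜ).indicator (fun _ => ENNReal.ofReal L) x ∂γ := by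
            refine lintegral_mono fun x => ?_
            by_cases hx : x ∈ K
            · simp [hχ1 hx]
            · rw [indicator_of_mem (show x ∈ Kᶜ from hx)]
              refine ENNReal.ofReal_le_ofReal (mul_le_of_le_one_right hL0 ?_)
              linarith [(hχ01 x).1]
        _ = ENNReal.ofReal L * γ Kᶜ := by
            rw [lintegral_indicator_const hK.measurableSet.compl]
        _ ≤ _ := by
            rw [mul_comm]
            gcongr
    have hχψ : ∀ᶠ n in (V : Filter ℕ), ∀ x, |χ x * ψ n x - χ x * Ψ x| ≤ ε := by
      filter_upwards [hV (hunif (tsupport χ) hχO hχc ε hε)] with n hn x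
      by_cases hx : x ∈ tsupport χ
      · rw [← mul_sub, abs_mul, abs_of_nonneg (hχ01 x).1]
        exact (mul_le_of_le_one_left (abs_nonneg _) (hχ01 x).2).trans (hn x hx)
      · simp [image_eq_zero_of_notMem_tsupport hx, hε.le]
    constructor
    · have hφ : Continuous fun x => χ x * Ψ x + (ε + L * (1 - χ x)) :=
        hχΨ.add (continuous_const.add (continuous_const.mul (continuous_const.sub χ.continuous)))
      have hrest0 : ∀ x, 0 ≤ L * (1 - χ x) := fun x => mul_nonneg hL0 (sub_nonneg.2 (hχ01 x).2)
      have hlim := (hP _ hφ (fun x => add_nonneg (hχΨ0 x) (add_nonneg hε.le (hrest0 x)))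
        (L + (ε + L * 1)) fun x => by
          have h1 := hχΨL x
          have h2 : L * (1 - χ x) ≤ L * 1 :=
            mul_le_mul_of_nonneg_left (by linarith [(hχ01 x).1]) hL0
          linarith).mono_left hV
      have hle : l ≤ ∫⁻ x, ENNReal.ofReal (χ x * Ψ x + (ε + L * (1 - χ x))) ∂γ := by
        refine le_of_tendsto_of_tendsto hl hlim ?_
        filter_upwards [hχψ] with n hn
        refine lintegral_mono fun x => ENNReal.ofReal_le_ofReal ?_
        have h1 := (abs_le.1 (hn x)).2
        have h2 : (1 - χ x) * ψ n x ≤ (1 - χ x) * L :=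
          mul_le_mul_of_nonneg_left (hL n x) (sub_nonneg.2 (hχ01 x).2)
        nlinarith
      refine hle.trans ?_
      calc ∫⁻ x, ENNReal.ofReal (χ x * Ψ x + (ε + L * (1 - χ x))) ∂γ
          ≤ ∫⁻ x, (ENNReal.ofReal (Ψ x) +
              (ENNReal.ofReal ε + ENNReal.ofReal (L * (1 - χ x)))) ∂γ := by
            refine lintegral_mono fun x => ?_
            rw [ENNReal.ofReal_add (hχΨ0 x) (add_nonneg hε.le (hrest0 x)),
              ENNReal.ofReal_add hε.le (hrest0 x)]
            gcongr
            exact mul_le_of_le_one_left (hΨ0 x) (hχ01 x).2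
        _ = ∫⁻ x, ENNReal.ofReal (Ψ x) ∂γ + (ENNReal.ofReal ε * γ univ +
              ∫⁻ x, ENNReal.ofReal (L * (1 - χ x)) ∂γ) := by
            rw [lintegral_add_right, lintegral_add_left measurable_const, lintegral_const]
            exact measurable_const.add (continuous_const.mul
              (continuous_const.sub χ.continuous)).measurable.ennreal_ofReal
        _ ≤ _ := by
            rw [hc, mul_add]
            gcongr
    · have hlim := (hP _ hχΨ hχΨ0 L hχΨL).mono_left hV
      have hone := (hP (fun _ => ε) continuous_const (fun _ => hε.le) ε fun _ => le_rfl).mono_left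
        hV
      -- From below, `χ Ψ ≤ ψ n + ε` eventually; the integral of the constant `ε` converges too,
      -- which controls the masses of `P n`.
      have hle : ∫⁻ x, ENNReal.ofReal (χ x * Ψ x) ∂γ ≤ l + ∫⁻ _, ENNReal.ofReal ε ∂γ := by
        refine le_of_tendsto_of_tendsto hlim (hl.add hone) ?_
        filter_upwards [hχψ] with n hn
        rw [← lintegral_add_right _ measurable_const]
        refine lintegral_mono fun x => ?_
        rw [← ENNReal.ofReal_add (h0 n x) hε.le]
        refine ENNReal.ofReal_le_ofReal ?_
        have h1 := (abs_le.1 (hn x)).1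
        have h2 := mul_le_of_le_one_left (h0 n x) (hχ01 x).2
        linarith
      rw [lintegral_const] at hle
      calc ∫⁻ x, ENNReal.ofReal (Ψ x) ∂γ
          ≤ ∫⁻ x, (ENNReal.ofReal (χ x * Ψ x) + ENNReal.ofReal (L * (1 - χ x))) ∂γ := by
            refine lintegral_mono fun x => ?_
            rw [← ENNReal.ofReal_add (hχΨ0 x) (mul_nonneg hL0 (sub_nonneg.2 (hχ01 x).2))]
            refine ENNReal.ofReal_le_ofReal ?_
            have h2 : (1 - χ x) * Ψ x ≤ (1 - χ x) * L :=
              mul_le_mul_of_nonneg_left (hΨL x) (sub_nonneg.2 (hχ01 x).2)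
            nlinarith
        _ = ∫⁻ x, ENNReal.ofReal (χ x * Ψ x) ∂γ + ∫⁻ x, ENNReal.ofReal (L * (1 - χ x)) ∂γ :=
            lintegral_add_left hχΨ.measurable.ennreal_ofReal _
        _ ≤ (l + ENNReal.ofReal ε * γ univ) + ENNReal.ofReal ε * ENNReal.ofReal L := by gcongr
        _ = _ := by rw [hc, mul_add, add_assoc]
  have hz : ∀ z : ℝ≥0∞, Tendsto (fun ε : ℝ => z + ENNReal.ofReal ε * c) (𝓝[>] 0) (𝓝 z) := by
    intro z
    have h1 : Tendsto (fun ε : ℝ => z + ENNReal.ofReal ε * c) (𝓝[>] 0)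
        (𝓝 (z + ENNReal.ofReal 0 * c)) :=
      tendsto_nhdsWithin_of_tendsto_nhds (tendsto_const_nhds.add
        (ENNReal.Tendsto.mul_const (ENNReal.tendsto_ofReal tendsto_id) (Or.inr hctop)))
    simpa using h1
  have heq : l = ∫⁻ x, ENNReal.ofReal (Ψ x) ∂γ :=
    le_antisymm (ge_of_tendsto (hz _) (eventually_mem_nhdsWithin.mono fun ε hε => (key ε hε).1))
      (ge_of_tendsto (hz _) (eventually_mem_nhdsWithin.mono fun ε hε => (key ε hε).2))
  rwa [← heq]

/-- Subadditivity of `t ↦ t ^ α`. It carries uniform convergence of the mass ratios over to their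
`α`-th powers. -/
lemma abs_rpow_sub_rpow_le {α u v : ℝ} (hα : α ∈ Ioo (0 : ℝ) 1) (hu : 0 ≤ u) (hv : 0 ≤ v) :
    |u ^ α - v ^ α| ≤ |u - v| ^ α := by
  wlog h : v ≤ u generalizing u v
  · rw [abs_sub_comm, abs_sub_comm u]
    exact this hv hu (le_of_not_ge h)
  · have h1 := Real.rpow_add_le_add_rpow hv (sub_nonneg.2 h) hα.1.le hα.2.le
    rw [add_sub_cancel] at h1
    rw [abs_of_nonneg (sub_nonneg.2 h),
      abs_of_nonneg (sub_nonneg.2 (Real.rpow_le_rpow hv h hα.1.le))]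
    linarith

/-- The ratios of the cell masses of two measures converge locally uniformly to the ratio of the
densities. -/
lemma exists_cell_ratio_close {g ρ : ℝ → ℝ} (hgm : Measurable g)
    (hρ0 : ∀ x, 0 ≤ ρ x)
    [IsFiniteMeasure (densityMeasure g)] {O K : Set ℝ} (hO : IsOpen O) (hg : ContinuousOn g O)
    (hpos : ∀ x ∈ O, 0 < g x) (hρ : ContinuousOn ρ O) (hK : IsCompact K) (hKO : K ⊆ O) {r : ℝ}
    (hr : 1 < r) {ε : ℝ} (hε : 0 < ε) :
    ∃ d > 0, ∀ q, IsQuantizer q → distortion r (densityMeasure g) q < d → ∀ x ∈ K,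
      |(densityMeasure (fun y => ρ y * g y) (q ⁻¹' {q x}) /
        densityMeasure g (q ⁻¹' {q x})).toReal - ρ x| ≤ ε := by
  obtain ⟨ζ, hζ, hcont⟩ := exists_uniform_continuity hO hρ hK hKO hε
  obtain ⟨d, hd, hsmall⟩ := exists_cells_small hgm hO hg hpos hK hKO hr hζ
  refine ⟨d, hd, fun q hq hdist x hx => ?_⟩
  have hI := hq.measurable (measurableSet_singleton (q x))
  set I := q ⁻¹' {q x} with hIdef
  have hIx : ∀ y ∈ I, y ∈ O ∧ |ρ y - ρ x| < ε := fun y hy =>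
    hcont x hx y (hsmall q hq hdist x hx y hy)
  have hμ : densityMeasure g I = ∫⁻ y in I, ENNReal.ofReal (g y) := by
    rw [densityMeasure, withDensity_apply _ hI]
  have hν : densityMeasure (fun y => ρ y * g y) I =
      ∫⁻ y in I, ENNReal.ofReal (ρ y) * ENNReal.ofReal (g y) := by
    rw [densityMeasure, withDensity_apply _ hI]
    exact lintegral_congr fun y => ENNReal.ofReal_mul (hρ0 y)
  -- The cell has nonempty interior and lies in `O`, where `g` is positive.
  have hμ0 : densityMeasure g I ≠ 0 := by
    rw [hμ, ← pos_iff_ne_zero, setLIntegral_pos_iff hgm.ennreal_ofReal]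
    refine (isOpen_interior.measure_pos volume
      ⟨_, hq.mem_interior (q x) ⟨x, rfl⟩⟩).trans_le (measure_mono fun y hy => ?_)
    have hyI : y ∈ I := interior_subset hy
    exact ⟨by simpa using hpos y (hIx y hyI).1, hyI⟩
  have hμt : densityMeasure g I ≠ ∞ := measure_ne_top _ _
  have hup : densityMeasure (fun y => ρ y * g y) I ≤
      ENNReal.ofReal (ρ x + ε) * densityMeasure g I := by
    rw [hν, hμ, ← lintegral_const_mul _ hgm.ennreal_ofReal]
    refine setLIntegral_mono' hI fun y hy => ?_
    gcongr
    linarith [(abs_lt.1 (hIx y hy).2).2]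
  have hlow : ENNReal.ofReal (ρ x - ε) * densityMeasure g I ≤
      densityMeasure (fun y => ρ y * g y) I := by
    rw [hν, hμ, ← lintegral_const_mul _ hgm.ennreal_ofReal]
    refine setLIntegral_mono' hI fun y hy => ?_
    gcongr
    linarith [(abs_lt.1 (hIx y hy).2).1]
  have hρε : 0 ≤ ρ x + ε := add_nonneg (hρ0 x) hε.le
  have h1 := ENNReal.div_le_of_le_mul hup
  have h2 := (ENNReal.le_div_iff_mul_le (Or.inl hμ0) (Or.inl hμt)).2 hlow
  have hfin : densityMeasure (fun y => ρ y * g y) I / densityMeasure g I ≠ ∞ :=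
    ne_top_of_le_ne_top ENNReal.ofReal_ne_top h1
  have h3 := ENNReal.toReal_le_of_le_ofReal hρε h1
  have h4 := (ENNReal.ofReal_le_iff_le_toReal hfin).1 h2
  rw [abs_le]
  constructor <;> linarith

/-! ### Midpoint quantizers of subdivided partitions. -/

/-- The left end point of the `k`-th of `N` equal parts of `[u, v)`. -/
def gridPoint (u v : ℝ) (N : ℕ) (k : ℝ) : ℝ := u + k * ((v - u) / N)

lemma gridPoint_add_one_sub (u v : ℝ) (N : ℕ) (k : ℝ) :
    gridPoint u v N (k + 1) - gridPoint u v N k = (v - u) / N := by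
  unfold gridPoint
  ring

lemma existsUnique_gridPoint {u v x : ℝ} (huv : u < v) {N : ℕ} (hN : 0 < N) (hx : x ∈ Ico u v) :
    ∃! k : Fin N, x ∈ Ico (gridPoint u v N k) (gridPoint u v N ((k : ℝ) + 1)) := by
  have hN' : (0 : ℝ) < N := Nat.cast_pos.2 hN
  have hd : 0 < (v - u) / N := div_pos (sub_pos.2 huv) hN'
  have hmem : ∀ k : ℕ, x ∈ Ico (gridPoint u v N k) (gridPoint u v N ((k : ℝ) + 1)) ↔
      ⌊(x - u) / ((v - u) / N)⌋₊ = k := by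
    intro k
    rw [Nat.floor_eq_iff (div_nonneg (sub_nonneg.2 hx.1) hd.le), le_div_iff₀ hd, div_lt_iff₀ hd,
      mem_Ico, gridPoint, gridPoint, le_sub_iff_add_le', sub_lt_iff_lt_add']
  have hlt : ⌊(x - u) / ((v - u) / N)⌋₊ < N := by
    rw [Nat.floor_lt (div_nonneg (sub_nonneg.2 hx.1) hd.le), div_lt_iff₀ hd,
      mul_div_cancel₀ _ hN'.ne']
    linarith [hx.2]
  refine ⟨⟨_, hlt⟩, (hmem _).2 rfl, fun k hk => Fin.ext ((hmem k).1 hk).symm⟩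

lemma Ico_gridPoint_subset {u v : ℝ} (huv : u ≤ v) {N k : ℕ} (hk : k < N) :
    Ico (gridPoint u v N k) (gridPoint u v N ((k : ℝ) + 1)) ⊆ Ico u v := by
  have hN' : (0 : ℝ) < N := Nat.cast_pos.2 (by omega)
  have hd : 0 ≤ (v - u) / N := div_nonneg (sub_nonneg.2 huv) hN'.le
  refine Ico_subset_Ico ?_ ?_
  · unfold gridPoint
    have : 0 ≤ (k : ℝ) * ((v - u) / N) := by positivity
    linarith
  · unfold gridPoint
    have h1 : (k : ℝ) + 1 ≤ N := by exact_mod_cast hk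
    have h2 := mul_le_mul_of_nonneg_right h1 hd
    rw [mul_div_cancel₀ _ hN'.ne'] at h2
    linarith

/-- The quantizer mapping each interval of a countable partition to its midpoint. -/
lemma exists_midpoint_quantizer {ι : Type*} [Countable ι] {u v : ι → ℝ} (huv : ∀ i, u i < v i)
    (hpart : ∀ x, ∃! i, x ∈ Ico (u i) (v i)) :
    ∃ q, IsQuantizer q ∧
      (∀ (α : ℝ) (μ : Measure ℝ), cellSum α μ q ≤ ∑' i, μ (Ico (u i) (v i)) ^ α) ∧
      ∀ (r : ℝ) (μ : Measure ℝ), distortion r μ q =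
        ∑' i, ∫⁻ x in Ico (u i) (v i), ENNReal.ofReal (|x - (u i + v i) / 2| ^ r) ∂μ := by
  choose J hJ hJu using hpart
  have hmid : ∀ i, (u i + v i) / 2 ∈ Ico (u i) (v i) := fun i =>
    ⟨by linarith [huv i], by linarith [huv i]⟩
  -- Each midpoint lies in its own interval, so different intervals have different codepoints and
  -- the codecells are exactly the intervals.
  have hinj : ∀ i j, (u i + v i) / 2 = (u j + v j) / 2 → i = j := fun i j hij =>
    (hJu _ i (hmid i)).trans (hJu _ j (hij ▸ hmid j)).symm
  have hJmem : ∀ x i, x ∈ Ico (u i) (v i) ↔ J x = i := fun x i =>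
    ⟨fun h => (hJu x i h).symm, fun h => h ▸ hJ x⟩
  set q : ℝ → ℝ := fun x => (u (J x) + v (J x)) / 2 with hq
  have hpre : ∀ i, q ⁻¹' {(u i + v i) / 2} = Ico (u i) (v i) := by
    intro i
    ext x
    rw [hJmem]
    exact ⟨fun h => hinj _ _ h, fun h => by simp [hq, h]⟩
  have hrange : ∀ c ∈ range q, ∃ i, c = (u i + v i) / 2 := by
    rintro c ⟨x, rfl⟩
    exact ⟨J x, rfl⟩
  have hquant : IsQuantizer q := by
    refine ⟨?_, ?_, ?_, ?_⟩
    · intro A _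
      have : q ⁻¹' A = ⋃ i : {i // (u i + v i) / 2 ∈ A}, Ico (u i) (v i) := by
        ext x
        simp only [mem_iUnion, hJmem]
        exact ⟨fun h => ⟨⟨J x, h⟩, rfl⟩, fun ⟨⟨i, hi⟩, h⟩ => by
          simp only at h
          subst h
          exact hi⟩
      rw [this]
      exact MeasurableSet.iUnion fun i => measurableSet_Ico
    · refine (countable_range fun i => (u i + v i) / 2).mono ?_
      rintro c hc
      obtain ⟨i, rfl⟩ := hrange c hc
      exact ⟨i, rfl⟩
    · intro c hc
      obtain ⟨i, rfl⟩ := hrange c hc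
      rw [hpre]
      exact ordConnected_Ico
    · intro c hc
      obtain ⟨i, rfl⟩ := hrange c hc
      rw [hpre, interior_Ico]
      exact ⟨by linarith [huv i], by linarith [huv i]⟩
  refine ⟨q, hquant, fun α μ => ?_, fun r μ => ?_⟩
  · choose e he using fun c : range q => hrange c c.2
    have hei : Function.Injective e := fun c d hcd => Subtype.ext (by rw [he c, he d, hcd])
    refine le_trans (le_of_eq (tsum_congr fun c => ?_))
      (ENNReal.tsum_comp_le_tsum_of_injective hei fun i => μ (Ico (u i) (v i)) ^ α)
    rw [he c, hpre]
  · rw [distortion, ← setLIntegral_univ, show (univ : Set ℝ) = ⋃ i, Ico (u i) (v i) by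
        ext x; simpa using ⟨J x, hJ x⟩,
      lintegral_iUnion (fun i => measurableSet_Ico)]
    · refine tsum_congr fun i => setLIntegral_congr_fun measurableSet_Ico fun x hx => ?_
      simp only [hq, (hJmem x i).1 hx]
    · intro i j hij
      refine Set.disjoint_left.2 fun x hx hy => hij ?_
      rw [← (hJmem x i).1 hx, ← (hJmem x j).1 hy]

/-- Subdividing each interval of a countable partition into finitely many equal parts. -/
lemma exists_subdivision_quantizer {ι : Type*} [Countable ι] {u v : ι → ℝ} (huv : ∀ i, u i < v i)
    (hpart : ∀ x, ∃! i, x ∈ Ico (u i) (v i)) {N : ι → ℕ} (hN : ∀ i, 0 < N i) :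
    ∃ q, IsQuantizer q ∧
      (∀ (α : ℝ) (μ : Measure ℝ), cellSum α μ q ≤ ∑' i, ∑ k : Fin (N i),
        μ (Ico (gridPoint (u i) (v i) (N i) k) (gridPoint (u i) (v i) (N i) ((k : ℝ) + 1))) ^ α) ∧
      ∀ (r : ℝ) (μ : Measure ℝ), distortion r μ q = ∑' i, ∑ k : Fin (N i),
        ∫⁻ x in Ico (gridPoint (u i) (v i) (N i) k) (gridPoint (u i) (v i) (N i) ((k : ℝ) + 1)),
          ENNReal.ofReal (|x - (gridPoint (u i) (v i) (N i) k +
            gridPoint (u i) (v i) (N i) ((k : ℝ) + 1)) / 2| ^ r) ∂μ := by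
  obtain ⟨q, hq, h1, h2⟩ := exists_midpoint_quantizer (ι := Σ i, Fin (N i))
    (u := fun p => gridPoint (u p.1) (v p.1) (N p.1) (p.2 : ℕ))
    (v := fun p => gridPoint (u p.1) (v p.1) (N p.1) (((p.2 : ℕ) : ℝ) + 1)) (fun p => by
      have := gridPoint_add_one_sub (u p.1) (v p.1) (N p.1) (p.2 : ℕ)
      have h3 : 0 < (v p.1 - u p.1) / N p.1 :=
        div_pos (sub_pos.2 (huv _)) (Nat.cast_pos.2 (hN _))
      linarith) (fun x => by
      obtain ⟨i, hi, hiu⟩ := hpart x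
      obtain ⟨k, hk, hku⟩ := existsUnique_gridPoint (huv i) (hN i) hi
      refine ⟨⟨i, k⟩, hk, ?_⟩
      rintro ⟨j, l⟩ hjl
      obtain rfl := hiu j (Ico_gridPoint_subset (huv j).le l.2 hjl)
      rw [hku l hjl])
  refine ⟨q, hq, fun α μ => (h1 α μ).trans (le_of_eq ?_), fun r μ => (h2 r μ).trans ?_⟩
  · rw [ENNReal.tsum_sigma']
    exact tsum_congr fun i => tsum_fintype _
  · rw [ENNReal.tsum_sigma']
    exact tsum_congr fun i => tsum_fintype _

lemma sum_measure_gridPoint {u v : ℝ} (huv : u < v) {N : ℕ} (hN : 0 < N) (μ : Measure ℝ) :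
    ∑ k : Fin N, μ (Ico (gridPoint u v N k) (gridPoint u v N ((k : ℝ) + 1))) = μ (Ico u v) := by
  rw [← tsum_fintype (L := .unconditional _),
    ← measure_iUnion _ fun _ => measurableSet_Ico]
  · congr 1
    ext x
    rw [mem_iUnion]
    exact ⟨fun ⟨k, hk⟩ => Ico_gridPoint_subset huv.le k.2 hk,
      fun hx => (existsUnique_gridPoint huv hN hx).exists⟩
  · intro k l hkl
    refine Set.disjoint_left.2 fun x hx hy => hkl ?_
    exact (existsUnique_gridPoint huv hN (Ico_gridPoint_subset huv.le k.2 hx)).unique hx hy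

/-! ### Entropy and distortion of one subdivided interval. -/

/-- Hölder's inequality against the constant 1, with exponents `1 / (1 - α)` and `1 / α`. -/
lemma sum_rpow_le {N : ℕ} (p : Fin N → ℝ≥0∞) {α : ℝ} (hα : α ∈ Ioo (0 : ℝ) 1) :
    ∑ k, p k ^ α ≤ (N : ℝ≥0∞) ^ (1 - α) * (∑ k, p k) ^ α := by
  have h1 : 0 < 1 - α := by linarith [hα.2]
  have h0 := hα.1
  have hpq : (1 / (1 - α)).HolderConjugate (1 / α) := by
    rw [Real.holderConjugate_iff]
    constructor
    · rw [lt_div_iff₀ h1]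
      linarith
    · field_simp
      ring
  have := ENNReal.inner_le_Lp_mul_Lq Finset.univ (fun _ : Fin N => (1 : ℝ≥0∞)) (fun k => p k ^ α)
    hpq
  simpa [← ENNReal.rpow_mul, h0.ne'] using this

lemma sum_cells_rpow_le {u v : ℝ} (huv : u < v) {N : ℕ} (hN : 0 < N) (μ : Measure ℝ) {α : ℝ}
    (hα : α ∈ Ioo (0 : ℝ) 1) :
    ∑ k : Fin N, μ (Ico (gridPoint u v N k) (gridPoint u v N ((k : ℝ) + 1))) ^ α ≤
      (N : ℝ≥0∞) ^ (1 - α) * μ (Ico u v) ^ α := by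
  rw [← sum_measure_gridPoint huv hN]
  exact sum_rpow_le _ hα

/-- A crude bound of the error by the cell length, for the tails, where only the mass of the
interval is controlled. -/
lemma sum_cells_distortion_le {u v : ℝ} (huv : u < v) {N : ℕ} (hN : 0 < N) (μ : Measure ℝ) {r : ℝ}
    (hr : 1 < r) :
    ∑ k : Fin N, ∫⁻ x in Ico (gridPoint u v N k) (gridPoint u v N ((k : ℝ) + 1)),
        ENNReal.ofReal (|x - (gridPoint u v N k + gridPoint u v N ((k : ℝ) + 1)) / 2| ^ r) ∂μ ≤
      ENNReal.ofReal (((v - u) / N) ^ r) * μ (Ico u v) := by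
  rw [← sum_measure_gridPoint huv hN, Finset.mul_sum]
  refine Finset.sum_le_sum fun k _ => ?_
  rw [← setLIntegral_const]
  refine setLIntegral_mono' measurableSet_Ico fun x hx => ENNReal.ofReal_le_ofReal ?_
  refine Real.rpow_le_rpow (abs_nonneg _) ?_ (by linarith)
  have h1 := gridPoint_add_one_sub u v N k
  rw [abs_le]
  constructor <;> linarith [hx.1, hx.2]

lemma sum_cells_rpow_le_of_le {u v M : ℝ} (huv : u < v) {N : ℕ} (hN : 0 < N) {g : ℝ → ℝ}
    (hM : ∀ x ∈ Ico u v, g x ≤ M) (hM0 : 0 ≤ M) {α : ℝ} (hα : α ∈ Ioo (0 : ℝ) 1) :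
    ∑ k : Fin N, densityMeasure g
        (Ico (gridPoint u v N k) (gridPoint u v N ((k : ℝ) + 1))) ^ α ≤
      ENNReal.ofReal ((N : ℝ) ^ (1 - α) * (M * (v - u)) ^ α) := by
  have hN' : (0 : ℝ) < N := Nat.cast_pos.2 hN
  have huv' : 0 < v - u := sub_pos.2 huv
  refine (sum_cells_rpow_le huv hN _ hα).trans ?_
  have hα0 := hα.1.le
  rw [ENNReal.ofReal_mul (by positivity), ← ENNReal.ofReal_rpow_of_pos hN', ENNReal.ofReal_natCast,
    ← ENNReal.ofReal_rpow_of_nonneg (by positivity) hα0]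
  gcongr
  rw [densityMeasure, withDensity_apply _ measurableSet_Ico, ENNReal.ofReal_mul hM0,
    ← Real.volume_Ico, ← setLIntegral_const]
  exact setLIntegral_mono' measurableSet_Ico fun x hx => ENNReal.ofReal_le_ofReal (hM x hx)

/-- The bound with the sharp constant: after replacing `g` by `M` the midpoint integrals are exact,
and `N` cells of length `(v - u) / N` contribute `N · ((v - u) / N) ^ (r + 1)`. -/
lemma sum_cells_distortion_le_of_le {u v M : ℝ} (huv : u < v) {N : ℕ} (hN : 0 < N) {g : ℝ → ℝ}
    (hgm : Measurable g) (hM : ∀ x ∈ Ico u v, g x ≤ M) (hM0 : 0 ≤ M) {r : ℝ} (hr : 1 < r) :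
    ∑ k : Fin N, ∫⁻ x in Ico (gridPoint u v N k) (gridPoint u v N ((k : ℝ) + 1)),
        ENNReal.ofReal (|x - (gridPoint u v N k + gridPoint u v N ((k : ℝ) + 1)) / 2| ^ r)
          ∂(densityMeasure g) ≤
      ENNReal.ofReal (M * (constC r * (v - u) ^ (r + 1)) * (N : ℝ) ^ (-r)) := by
  have hN' : (0 : ℝ) < N := Nat.cast_pos.2 hN
  have huv' : 0 < v - u := sub_pos.2 huv
  have hC := constC_pos r hr
  have hcell : ∀ k : Fin N,
      ∫⁻ x in Ico (gridPoint u v N k) (gridPoint u v N ((k : ℝ) + 1)),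
        ENNReal.ofReal (|x - (gridPoint u v N k + gridPoint u v N ((k : ℝ) + 1)) / 2| ^ r)
          ∂(densityMeasure g) ≤
      ENNReal.ofReal (M * (constC r * ((v - u) / N) ^ (r + 1))) := by
    intro k
    have h1 := gridPoint_add_one_sub u v N k
    have h2 : 0 < (v - u) / N := by positivity
    rw [setLIntegral_densityMeasure hgm measurableSet_Ico (by fun_prop), ENNReal.ofReal_mul hM0,
      ← h1, ← setLIntegral_abs_sub_midpoint r hr _ _ (by linarith),
      ← setLIntegral_congr Ico_ae_eq_Icc, ← lintegral_const_mul _ (by fun_prop)]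
    refine setLIntegral_mono' measurableSet_Ico fun x hx => ?_
    gcongr
    exact hM x (Ico_gridPoint_subset huv.le k.2 hx)
  refine (Finset.sum_le_sum fun k _ => hcell k).trans (le_of_eq ?_)
  rw [Finset.sum_const, Finset.card_univ, Fintype.card_fin, nsmul_eq_mul, ← ENNReal.ofReal_natCast,
    ← ENNReal.ofReal_mul hN'.le, Real.div_rpow huv'.le hN'.le, Real.rpow_add_one hN'.ne',
    Real.rpow_neg hN'.le]
  congr 1
  field_simp

/-! ### Dyadic shells and tails. -/

/-- The left end points of the partition of the line into `k` equal parts of `[-T, T)` and dyadic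
shells outside. -/
def shellLeft (T : ℝ) (k : ℕ) : Fin k ⊕ (ℕ ⊕ ℕ) → ℝ :=
  Sum.elim (fun j => gridPoint (-T) T k j)
    (Sum.elim (fun i => T * 2 ^ i) fun i => -(T * 2 ^ (i + 1)))

/-- The right end points of the partition of the line into `k` equal parts of `[-T, T)` and dyadic
shells outside. -/
def shellRight (T : ℝ) (k : ℕ) : Fin k ⊕ (ℕ ⊕ ℕ) → ℝ :=
  Sum.elim (fun j => gridPoint (-T) T k ((j : ℝ) + 1))
    (Sum.elim (fun i => T * 2 ^ (i + 1)) fun i => -(T * 2 ^ i))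

lemma shellLeft_lt_shellRight {T : ℝ} (hT : 0 < T) {k : ℕ} (hk : 0 < k) (i : Fin k ⊕ (ℕ ⊕ ℕ)) :
    shellLeft T k i < shellRight T k i := by
  rcases i with j | i | i
  · have h1 := gridPoint_add_one_sub (-T) T k j
    have h2 : 0 < (T - -T) / k := div_pos (by linarith) (Nat.cast_pos.2 hk)
    simp only [shellLeft, shellRight, Sum.elim_inl]
    linarith
  all_goals
    have h1 : (0 : ℝ) < T * 2 ^ i := by positivity
    simp only [shellLeft, shellRight, Sum.elim_inl, Sum.elim_inr, pow_succ]
    linarith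

lemma pairwise_disjoint_dyadic {T : ℝ} (hT : 0 < T) :
    Pairwise (Function.onFun Disjoint fun i : ℕ => Ico (T * (2 : ℝ) ^ i) (T * 2 ^ (i + 1))) := by
  have hmono : Monotone fun i : ℕ => T * (2 : ℝ) ^ i := fun i j hij =>
    mul_le_mul_of_nonneg_left (pow_le_pow_right₀ one_le_two hij) hT.le
  exact hmono.pairwise_disjoint_on_Ico_succ

lemma pairwise_disjoint_dyadic_neg {T : ℝ} (hT : 0 < T) :
    Pairwise (Function.onFun Disjoint
      fun i : ℕ => Ico (-(T * (2 : ℝ) ^ (i + 1))) (-(T * 2 ^ i))) := by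
  have hmono : Antitone fun i : ℕ => -(T * (2 : ℝ) ^ i) := fun i j hij =>
    neg_le_neg (mul_le_mul_of_nonneg_left (pow_le_pow_right₀ one_le_two hij) hT.le)
  exact hmono.pairwise_disjoint_on_Ico_succ

lemma existsUnique_shell {T : ℝ} (hT : 0 < T) {k : ℕ} (hk : 0 < k) (x : ℝ) :
    ∃! i, x ∈ Ico (shellLeft T k i) (shellRight T k i) := by
  have hTT : -T < T := by linarith
  have hpow : ∀ i : ℕ, T ≤ T * (2 : ℝ) ^ i := fun i =>
    le_mul_of_one_le_right hT.le (one_le_pow₀ one_le_two)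
  have hmain : ∀ j : Fin k, x ∈ Ico (shellLeft T k (Sum.inl j)) (shellRight T k (Sum.inl j)) →
      x ∈ Ico (-T) T := fun j hj => Ico_gridPoint_subset hTT.le j.2 hj
  have hr : ∀ i : ℕ, x ∈ Ico (shellLeft T k (Sum.inr (Sum.inl i)))
      (shellRight T k (Sum.inr (Sum.inl i))) → T ≤ x := fun i hi => (hpow i).trans hi.1
  have hl : ∀ i : ℕ, x ∈ Ico (shellLeft T k (Sum.inr (Sum.inr i)))
      (shellRight T k (Sum.inr (Sum.inr i))) → x < -T := fun i hi =>
    hi.2.trans_le (neg_le_neg (hpow i))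
  refine existsUnique_of_exists_of_unique ?_ ?_
  · rcases lt_or_ge x (-T) with h | h
    · have hex : ∃ n : ℕ, -x ≤ T * 2 ^ (n + 1) := by
        obtain ⟨n, hn⟩ := pow_unbounded_of_one_lt (-x / T) (one_lt_two (α := ℝ))
        refine ⟨n, ?_⟩
        rw [div_lt_iff₀ hT] at hn
        have : (0 : ℝ) < 2 ^ n * T := by positivity
        rw [pow_succ]
        linarith
      classical
      -- The left shells are closed at the far end, so the index is the least `n` with `-x ≤ T * 2 ^
      -- (n + 1)`; minimality gives the other bound, except for `n = 0`, where it is `x < -T`.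
      refine ⟨Sum.inr (Sum.inr (Nat.find hex)), ?_, ?_⟩
      · have := Nat.find_spec hex
        simp only [shellLeft, Sum.elim_inr]
        linarith
      · simp only [shellRight, Sum.elim_inr]
        rcases Nat.eq_zero_or_pos (Nat.find hex) with h0 | h0
        · rw [h0]
          simpa using h
        · have := Nat.find_min hex (Nat.sub_lt h0 one_pos)
          rw [show Nat.find hex - 1 + 1 = Nat.find hex by omega, not_le] at this
          linarith
    · rcases lt_or_ge x T with h' | h'
      · obtain ⟨j, hj, -⟩ := existsUnique_gridPoint hTT hk (⟨h, h'⟩ : x ∈ Ico (-T) T)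
        exact ⟨Sum.inl j, hj⟩
      · obtain ⟨n, hn1, hn2⟩ := exists_nat_pow_near ((one_le_div hT).2 h') (one_lt_two (α := ℝ))
        rw [le_div_iff₀ hT] at hn1
        rw [div_lt_iff₀ hT] at hn2
        refine ⟨Sum.inr (Sum.inl n), ?_, ?_⟩
        · simp only [shellLeft, Sum.elim_inr, Sum.elim_inl]
          linarith
        · simp only [shellRight, Sum.elim_inr, Sum.elim_inl]
          linarith
  · rintro (j | i | i) (j' | i' | i') h1 h2
    · have := (existsUnique_gridPoint hTT hk (hmain j h1)).unique h1 h2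
      rw [this]
    · have := hmain j h1
      have := hr i' h2
      linarith [(hmain j h1).2]
    · have := hl i' h2
      linarith [(hmain j h1).1]
    · have := hr i h1
      linarith [(hmain j' h2).2]
    · by_contra hne
      exact Set.disjoint_left.1 (pairwise_disjoint_dyadic hT (i := i) (j := i')
        fun h => hne (by rw [h])) h1 h2
    · have := hr i h1
      have := hl i' h2
      linarith
    · have := hl i h1
      linarith [(hmain j' h2).1]
    · have := hl i h1
      have := hr i' h2
      linarith
    · by_contra hne
      exact Set.disjoint_left.1 (pairwise_disjoint_dyadic_neg hT (i := i) (j := i')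
        fun h => hne (by rw [h])) h1 h2

/-- The contribution of dyadic shells to the distortion. -/
lemma tsum_shell_distortion_le {μ : Measure ℝ} {E : ℕ → Set ℝ} (hE : ∀ i, MeasurableSet (E i))
    (hdisj : Pairwise (Function.onFun Disjoint E)) {T : ℝ} (hT : 1 ≤ T)
    (hET : ∀ i, ∀ x ∈ E i, T * 2 ^ i ≤ |x|) {r : ℝ} (hr : 1 < r) {N : ℕ} :
    ∑' i, ENNReal.ofReal ((T * 2 ^ i / N) ^ r) * μ (E i) ≤
      ENNReal.ofReal ((N : ℝ) ^ (-r)) * ∫⁻ x in {x | T ≤ |x|}, ENNReal.ofReal (|x| ^ r) ∂μ := by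
  calc ∑' i, ENNReal.ofReal ((T * 2 ^ i / N) ^ r) * μ (E i)
      ≤ ∑' i, ENNReal.ofReal ((N : ℝ) ^ (-r)) * ∫⁻ x in E i, ENNReal.ofReal (|x| ^ r) ∂μ := by
        refine ENNReal.tsum_le_tsum fun i => ?_
        rw [Real.div_rpow (by positivity) (by positivity), div_eq_mul_inv,
          ← Real.rpow_neg (by positivity), mul_comm _ ((N : ℝ) ^ (-r)),
          ENNReal.ofReal_mul (by positivity), mul_assoc, ← setLIntegral_const]
        gcongr _ * ?_
        -- The length `T * 2 ^ i` of a shell is at most `|x|` on it, so the shells are charged to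
        -- the tail moment.
        refine setLIntegral_mono' (hE i) fun x hx => ENNReal.ofReal_le_ofReal ?_
        exact Real.rpow_le_rpow (by positivity) (hET i x hx) (by linarith)
    _ = ENNReal.ofReal ((N : ℝ) ^ (-r)) * ∫⁻ x in ⋃ i, E i, ENNReal.ofReal (|x| ^ r) ∂μ := by
        rw [ENNReal.tsum_mul_left, lintegral_iUnion hE hdisj]
    _ ≤ _ := by
        gcongr
        refine iUnion_subset fun i x hx => ?_
        exact (le_mul_of_one_le_right (by linarith) (one_le_pow₀ one_le_two)).trans (hET i x hx)

/-- The contribution of dyadic shells to the sum defining the entropy. -/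
lemma tsum_shell_rpow_le {μ : Measure ℝ} {E : ℕ → Set ℝ} (hE : ∀ i, MeasurableSet (E i))
    {T : ℝ} (hT : 1 ≤ T)
    (hET : ∀ i, ∀ x ∈ E i, T * 2 ^ i ≤ |x|) {r α : ℝ} (hr : 1 < r) (hα : α ∈ Ioo (0 : ℝ) 1) :
    ∑' i, μ (E i) ^ α ≤
      (∫⁻ x in {x | T ≤ |x|}, ENNReal.ofReal (|x| ^ r) ∂μ) ^ α *
        (1 - ENNReal.ofReal (2 ^ (-r)) ^ α)⁻¹ := by
  set ξ := ∫⁻ x in {x | T ≤ |x|}, ENNReal.ofReal (|x| ^ r) ∂μ with hξ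
  -- Markov's inequality with `|x| ≥ 2 ^ i` on the `i`-th shell; the `α`-th powers then form a
  -- geometric series.
  have h1 : ∀ i, μ (E i) ≤ ξ * ENNReal.ofReal (2 ^ (-r)) ^ i := by
    intro i
    have h2 : (0 : ℝ) < 2 ^ (-r) := by positivity
    rw [← ENNReal.ofReal_pow h2.le, ← Real.rpow_natCast, ← Real.rpow_mul (by norm_num), neg_mul,
      Real.rpow_neg (by norm_num), mul_comm r, Real.rpow_mul (by norm_num), Real.rpow_natCast,
      ENNReal.ofReal_inv_of_pos (by positivity), ← div_eq_mul_inv,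
      ENNReal.le_div_iff_mul_le (Or.inl (by simp; positivity)) (Or.inl ENNReal.ofReal_ne_top),
      mul_comm, ← setLIntegral_const]
    refine le_trans (setLIntegral_mono' (hE i) (g := fun x => ENNReal.ofReal (|x| ^ r))
      fun x hx => ENNReal.ofReal_le_ofReal ?_) (lintegral_mono_set fun x hx => ?_)
    · refine Real.rpow_le_rpow (by positivity) ?_ (by linarith)
      exact (le_mul_of_one_le_left (by positivity) hT).trans (hET i x hx)
    · exact (le_mul_of_one_le_right (by linarith) (one_le_pow₀ one_le_two)).trans (hET i x hx)
  calc ∑' i, μ (E i) ^ α ≤ ∑' i : ℕ, ξ ^ α * (ENNReal.ofReal (2 ^ (-r)) ^ α) ^ i := by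
        refine ENNReal.tsum_le_tsum fun i => ?_
        refine (ENNReal.rpow_le_rpow (h1 i) hα.1.le).trans (le_of_eq ?_)
        rw [ENNReal.mul_rpow_of_nonneg _ _ hα.1.le, ← ENNReal.rpow_natCast, ← ENNReal.rpow_natCast,
          ← ENNReal.rpow_mul, ← ENNReal.rpow_mul, mul_comm α]
    _ = _ := by rw [ENNReal.tsum_mul_left, ENNReal.tsum_geometric]

/-- The finite measure `|x| ^ r μ` is tight. -/
lemma exists_tail_le {μ : Measure ℝ} [IsFiniteMeasure μ] {r : ℝ}
    (hmom : ∫⁻ x, ENNReal.ofReal (|x| ^ r) ∂μ ≠ ∞) {δ : ℝ≥0∞} (hδ : δ ≠ 0) :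
    ∃ T : ℝ, 1 ≤ T ∧ ∫⁻ x in {x | T ≤ |x|}, ENNReal.ofReal (|x| ^ r) ∂μ ≤ δ := by
  set η := μ.withDensity fun x => ENNReal.ofReal (|x| ^ r) with hη
  have : IsFiniteMeasure η := isFiniteMeasure_withDensity hmom
  obtain ⟨K, -, hK, hlt⟩ := MeasurableSet.univ.exists_isCompact_lt_add (measure_ne_top η univ) hδ
  obtain ⟨R, hR⟩ := hK.isBounded.subset_closedBall 0
  have hcompl : η Kᶜ ≤ δ := by
    rw [← measure_add_measure_compl hK.measurableSet (μ := η)] at hlt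
    exact (ENNReal.add_le_add_iff_left (measure_ne_top η K)).1 hlt.le
  have hset : MeasurableSet {x : ℝ | max 1 (R + 1) ≤ |x|} :=
    measurableSet_le measurable_const continuous_abs.measurable
  refine ⟨max 1 (R + 1), le_max_left _ _, ?_⟩
  rw [← withDensity_apply _ hset]
  refine (measure_mono fun x hx hxK => ?_).trans hcompl
  have h1 := hR hxK
  rw [Metric.mem_closedBall, Real.dist_eq, sub_zero] at h1
  have h2 : R + 1 ≤ |x| := (le_max_right _ _).trans hx
  linarith

/-! ### Construction of near-optimal quantizers. -/

/-- Convergence of upper Darboux sums of a bounded almost everywhere continuous function. -/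
lemma exists_upper_sum_le {g : ℝ → ℝ} (hg0 : ∀ x, 0 ≤ g x) {B : ℝ} (hB : ∀ x, g x ≤ B)
    (hcont : ∀ᵐ x, ContinuousAt g x) {b : ℝ} (hb : 0 ≤ b) {T : ℝ} (hT : 0 < T) {ε : ℝ≥0∞}
    (hε : ε ≠ 0) :
    ∃ k : ℕ, 0 < k ∧ ∃ M : Fin k → ℝ, (∀ j, 0 ≤ M j) ∧
      (∀ j : Fin k, ∀ x ∈ Ico (gridPoint (-T) T k j) (gridPoint (-T) T k ((j : ℝ) + 1)),
        g x ≤ M j) ∧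
      ∑ j : Fin k, ENNReal.ofReal ((T - -T) / k * M j ^ b) ≤
        (∫⁻ x, ENNReal.ofReal (g x ^ b)) + ε := by
  have hTT : -T < T := by linarith
  rcases eq_or_ne (∫⁻ x, ENNReal.ofReal (g x ^ b)) ∞ with htop | htop
  · refine ⟨1, one_pos, fun _ => B, fun _ => (hg0 0).trans (hB 0), fun _ x _ => hB x, ?_⟩
    rw [htop]
    simp
  have hbdd : ∀ s, BddAbove (g '' s) := fun s => ⟨B, by rintro _ ⟨x, -, rfl⟩; exact hB x⟩
  -- The grid is continued over the whole line with integer indices, so that every point has a cell,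
  -- read off by a floor function. Using `n + 1` parts avoids division by 0.
  set cell : ℕ → ℤ → Set ℝ := fun n z =>
    Ico (gridPoint (-T) T (n + 1) z) (gridPoint (-T) T (n + 1) ((z : ℝ) + 1)) with hcell
  set idx : ℕ → ℝ → ℤ := fun n x => ⌊(x + T) / ((T - -T) / ((n + 1 : ℕ) : ℝ))⌋ with hidx
  have hd : ∀ n : ℕ, 0 < (T - -T) / ((n + 1 : ℕ) : ℝ) := fun n =>
    div_pos (by linarith) (Nat.cast_pos.2 n.succ_pos)
  have hmem : ∀ n x z, x ∈ cell n z ↔ idx n x = z := by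
    intro n x z
    simp only [hidx, hcell]
    rw [Int.floor_eq_iff, le_div_iff₀ (hd n), div_lt_iff₀ (hd n), mem_Ico, gridPoint, gridPoint]
    constructor <;> rintro ⟨h1, h2⟩ <;> constructor <;> linarith
  set U : ℕ → ℝ → ℝ := fun n x => sSup (g '' cell n (idx n x)) with hU
  have hgU : ∀ n x, g x ≤ U n x := fun n x =>
    le_csSup (hbdd _) ⟨x, (hmem n x _).2 rfl, rfl⟩
  have hU0 : ∀ n x, 0 ≤ U n x := fun n x => (hg0 x).trans (hgU n x)
  have hUB : ∀ n x, U n x ≤ B := by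
    intro n x
    refine csSup_le ⟨_, x, (hmem n x _).2 rfl, rfl⟩ ?_
    rintro _ ⟨y, -, rfl⟩
    exact hB y
  have hUm : ∀ n, Measurable (U n) := by
    intro n
    have h1 : Measurable (idx n) := by
      refine Int.measurable_floor.comp ?_
      fun_prop
    exact (measurable_of_countable fun z : ℤ => sSup (g '' cell n z)).comp h1
  have hUlim : ∀ x, ContinuousAt g x → Tendsto (fun n => U n x) atTop (𝓝 (g x)) := by
    intro x hx
    rw [Metric.tendsto_atTop]
    intro e he
    obtain ⟨δ, hδ, hδ'⟩ := Metric.continuousAt_iff.1 hx (e / 2) (half_pos he)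
    obtain ⟨n₀, hn₀⟩ := exists_nat_gt ((T - -T) / δ)
    refine ⟨n₀, fun n hn => ?_⟩
    have hsmall : (T - -T) / ((n + 1 : ℕ) : ℝ) < δ := by
      have h3 : (n₀ : ℝ) ≤ ((n + 1 : ℕ) : ℝ) := by exact_mod_cast hn.trans n.le_succ
      rw [div_lt_iff₀ (Nat.cast_pos.2 n.succ_pos)]
      rw [div_lt_iff₀ hδ] at hn₀
      nlinarith
    have hle : U n x ≤ g x + e / 2 := by
      have hxc := (hmem n x _).2 rfl
      refine csSup_le ⟨_, x, hxc, rfl⟩ ?_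
      rintro _ ⟨y, hy, rfl⟩
      have h1 := gridPoint_add_one_sub (-T) T (n + 1) (idx n x)
      have h2 : dist y x < δ := by
        rw [Real.dist_eq, abs_lt]
        constructor <;> linarith [hy.1, hy.2, hxc.1, hxc.2]
      have h3 := hδ' h2
      rw [Real.dist_eq, abs_lt] at h3
      linarith
    rw [Real.dist_eq, abs_of_nonneg (sub_nonneg.2 (hgU n x))]
    linarith
  -- The cellwise suprema converge to `g` at continuity points; dominated convergence with the
  -- constant bound `B` applies on `[-T, T)`.
  have hlim : Tendsto (fun n => ∫⁻ x in Ico (-T) T, ENNReal.ofReal (U n x ^ b)) atTop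
      (𝓝 (∫⁻ x in Ico (-T) T, ENNReal.ofReal (g x ^ b))) := by
    refine tendsto_lintegral_of_dominated_convergence (fun _ => ENNReal.ofReal (B ^ b))
      (fun n => ((hUm n).pow_const b).ennreal_ofReal) (fun n => Eventually.of_forall fun x => ?_)
      ?_ ?_
    · exact ENNReal.ofReal_le_ofReal (Real.rpow_le_rpow (hU0 n x) (hUB n x) hb)
    · rw [setLIntegral_const, Real.volume_Ico]
      exact ENNReal.mul_ne_top ENNReal.ofReal_ne_top ENNReal.ofReal_ne_top
    · filter_upwards [ae_restrict_of_ae hcont] with x hx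
      exact ENNReal.tendsto_ofReal ((hUlim x hx).rpow_const (Or.inr hb))
  have hlt : ∫⁻ x in Ico (-T) T, ENNReal.ofReal (g x ^ b) <
      (∫⁻ x, ENNReal.ofReal (g x ^ b)) + ε :=
    (setLIntegral_le_lintegral _ _).trans_lt (ENNReal.lt_add_right htop hε)
  obtain ⟨n, hn⟩ := (hlim.eventually (gt_mem_nhds hlt)).exists
  refine ⟨n + 1, n.succ_pos, fun j => sSup (g '' cell n ((j : ℕ) : ℤ)), fun j => ?_,
    fun j x hx => ?_, ?_⟩
  · exact Real.sSup_nonneg (by rintro _ ⟨y, -, rfl⟩; exact hg0 y)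
  · exact le_csSup (hbdd _) ⟨x, by simpa [hcell] using hx, rfl⟩
  · refine le_trans (le_of_eq ?_) hn.le
    rw [← withDensity_apply _ measurableSet_Ico, ← sum_measure_gridPoint hTT n.succ_pos]
    refine Finset.sum_congr rfl fun j _ => ?_
    have hc : Ico (gridPoint (-T) T (n + 1) j) (gridPoint (-T) T (n + 1) ((j : ℝ) + 1)) =
        cell n ((j : ℕ) : ℤ) := by simp [hcell]
    rw [withDensity_apply _ measurableSet_Ico]
    have hcon : ∀ x ∈ Ico (gridPoint (-T) T (n + 1) j) (gridPoint (-T) T (n + 1) ((j : ℝ) + 1)),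
        ENNReal.ofReal (U n x ^ b) =
          ENNReal.ofReal (sSup (g '' cell n ((j : ℕ) : ℤ)) ^ b) := by
      intro x hx
      rw [hc, hmem] at hx
      simp only [hU, hx]
    rw [setLIntegral_congr_fun measurableSet_Ico hcon, setLIntegral_const, Real.volume_Ico,
      gridPoint_add_one_sub, mul_comm, ENNReal.ofReal_mul (Real.rpow_nonneg
        (Real.sSup_nonneg (by rintro _ ⟨y, -, rfl⟩; exact hg0 y)) _)]

lemma beta₁_pos {r α : ℝ} (hr : 1 < r) (hα : α ∈ Ioo (0 : ℝ) 1) : 0 < beta₁ α r := by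
  obtain ⟨h0, h1⟩ := hα
  have : 0 < 1 - α := by linarith
  unfold beta₁
  positivity

lemma beta₁_lt_one {r α : ℝ} (hr : 1 < r) (hα : α ∈ Ioo (0 : ℝ) 1) : beta₁ α r < 1 := by
  obtain ⟨h0, h1⟩ := hα
  unfold beta₁
  rw [div_lt_one (by linarith)]
  nlinarith

/-- An interval of length `L` with `g ≤ M` gets about `N L M ^ (1 / β₂)` cells; the exponent is such
that `(1 - α) / β₂ + α = β₁`. Since `(x + 1) ^ (1 - α) ≤ x ^ (1 - α) + 1`, rounding costs a term
independent of `N`. -/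
lemma floor_entropy_le {r α : ℝ} (hr : 1 < r) (hα : α ∈ Ioo (0 : ℝ) 1) {N L M : ℝ} (hN : 0 ≤ N)
    (hL : 0 < L) (hM : 0 ≤ M) :
    ((⌊N * (L * M ^ (1 / beta₂ α r))⌋₊ + 1 : ℕ) : ℝ) ^ (1 - α) * (M * L) ^ α ≤
      N ^ (1 - α) * (L * M ^ beta₁ α r) + (M * L) ^ α := by
  obtain ⟨h0, h1⟩ := hα
  have h1α : 0 < 1 - α := by linarith
  rcases hM.eq_or_lt with rfl | hM
  · simp [Real.zero_rpow h0.ne', Real.zero_rpow (beta₁_pos hr ⟨h0, h1⟩).ne']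
  have hx : 0 ≤ N * (L * M ^ (1 / beta₂ α r)) := by positivity
  calc ((⌊N * (L * M ^ (1 / beta₂ α r))⌋₊ + 1 : ℕ) : ℝ) ^ (1 - α) * (M * L) ^ α
      ≤ ((N * (L * M ^ (1 / beta₂ α r))) ^ (1 - α) + 1) * (M * L) ^ α := by
        gcongr
        rw [Nat.cast_add, Nat.cast_one]
        refine (Real.rpow_le_rpow (by positivity) (add_le_add_left (Nat.floor_le hx) 1)
          h1α.le).trans ?_
        simpa using Real.rpow_add_le_add_rpow hx zero_le_one h1α.le (by linarith : 1 - α ≤ 1)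
    _ = N ^ (1 - α) * (L * M ^ beta₁ α r) + (M * L) ^ α := by
        rw [add_mul, one_mul, Real.mul_rpow hN (by positivity),
          Real.mul_rpow hL.le (by positivity), Real.mul_rpow hM.le hL.le, ← Real.rpow_mul hM.le]
        have e1 : L ^ (1 - α) * L ^ α = L := by
          rw [← Real.rpow_add hL, sub_add_cancel, Real.rpow_one]
        have e2 : M ^ (1 / beta₂ α r * (1 - α)) * M ^ α = M ^ beta₁ α r := by
          rw [← Real.rpow_add hM]
          congr 1
          unfold beta₁ beta₂
          have : 1 - α + r ≠ 0 := by linarith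
          field_simp
          ring
        rw [← e2]
        linear_combination N ^ (1 - α) * (M ^ (1 / beta₂ α r * (1 - α)) * M ^ α) * e1

/-- Here `1 - r / β₂ = β₁`, and there is no error term: the cell count is at least its target and
enters with a negative exponent. -/
lemma floor_distortion_le {r α : ℝ} (hr : 1 < r) (hα : α ∈ Ioo (0 : ℝ) 1) {N L M : ℝ} (hN : 0 < N)
    (hL : 0 < L) (hM : 0 ≤ M) :
    M * (constC r * L ^ (r + 1)) *
        ((⌊N * (L * M ^ (1 / beta₂ α r))⌋₊ + 1 : ℕ) : ℝ) ^ (-r) ≤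
      N ^ (-r) * (constC r * (L * M ^ beta₁ α r)) := by
  have hC := constC_pos r hr
  rcases hM.eq_or_lt with rfl | hM
  · simp [Real.zero_rpow (beta₁_pos hr hα).ne']
  obtain ⟨h0, h1⟩ := hα
  have h1α : 0 < 1 - α := by linarith
  have hx : 0 < N * (L * M ^ (1 / beta₂ α r)) := by positivity
  calc M * (constC r * L ^ (r + 1)) * ((⌊N * (L * M ^ (1 / beta₂ α r))⌋₊ + 1 : ℕ) : ℝ) ^ (-r)
      ≤ M * (constC r * L ^ (r + 1)) * (N * (L * M ^ (1 / beta₂ α r))) ^ (-r) := by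
        refine mul_le_mul_of_nonneg_left ?_ (by positivity)
        refine Real.rpow_le_rpow_of_nonpos hx ?_ (by linarith)
        rw [Nat.cast_add, Nat.cast_one]
        exact (Nat.lt_floor_add_one _).le
    _ = N ^ (-r) * (constC r * (L * M ^ beta₁ α r)) := by
        rw [Real.mul_rpow hN.le (by positivity),
          Real.mul_rpow hL.le (by positivity), ← Real.rpow_mul hM.le]
        have e1 : L ^ (r + 1) * L ^ (-r) = L := by
          rw [← Real.rpow_add hL, show r + 1 + -r = 1 by ring, Real.rpow_one]
        have e2 : M * M ^ (1 / beta₂ α r * -r) = M ^ beta₁ α r := by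
          nth_rw 1 [← Real.rpow_one M]
          rw [← Real.rpow_add hM]
          congr 1
          unfold beta₁ beta₂
          have : 1 - α + r ≠ 0 := by linarith
          field_simp
          ring
        rw [← e2]
        linear_combination N ^ (-r) * constC r * (M * M ^ (1 / beta₂ α r * -r)) * e1

/-- Near-optimal quantizers with about `N` cells per unit of the optimal point density. -/
theorem exists_quantizer_le {r α : ℝ} (hr : 1 < r) (hα : α ∈ Ioo (0 : ℝ) 1) {g : ℝ → ℝ}
    (hgm : Measurable g) (hg0 : ∀ x, 0 ≤ g x) {B : ℝ} (hB : ∀ x, g x ≤ B)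
    (hcont : ∀ᵐ x, ContinuousAt g x) [IsFiniteMeasure (densityMeasure g)]
    (hmom : ∫⁻ x, ENNReal.ofReal (|x| ^ r) ∂(densityMeasure g) ≠ ∞) {G : ℝ} (hG0 : 0 ≤ G)
    (hG : ∫⁻ x, ENNReal.ofReal (g x ^ beta₁ α r) = ENNReal.ofReal G) {ε : ℝ} (hε : 0 < ε) :
    ∃ c : ℝ, 0 ≤ c ∧ ∀ N : ℕ, 0 < N → ∃ q, IsQuantizer q ∧
      cellSum α (densityMeasure g) q ≤ ENNReal.ofReal ((N : ℝ) ^ (1 - α) * (G + ε) + c) ∧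
      distortion r (densityMeasure g) q ≤
        ENNReal.ofReal ((N : ℝ) ^ (-r) * (constC r * G + ε)) := by
  have hC := constC_pos r hr
  have hC1 : constC r ≤ 1 := by
    unfold constC
    rw [div_le_one (by positivity)]
    exact one_le_mul_of_one_le_of_one_le (Real.one_le_rpow one_le_two (by linarith)) (by linarith)
  set κ := (1 - ENNReal.ofReal (2 ^ (-r)) ^ α)⁻¹ with hκ
  have hκtop : κ ≠ ∞ := by
    rw [hκ, Ne, ENNReal.inv_eq_top, tsub_eq_zero_iff_le, not_le]
    refine ENNReal.rpow_lt_one ?_ hα.1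
    rw [← ENNReal.ofReal_one]
    refine (ENNReal.ofReal_lt_ofReal_iff one_pos).2 ?_
    exact Real.rpow_lt_one_of_one_lt_of_neg one_lt_two (by linarith)
  -- A tail moment at most `δ` makes each of the two families of shells contribute at most `ε / 4`,
  -- both to the entropy sum and to the distortion, up to the powers of `N`.
  obtain ⟨δ, hδ, hδκ, hδε⟩ : ∃ δ : ℝ, 0 < δ ∧
      ENNReal.ofReal δ ^ α * κ ≤ ENNReal.ofReal (ε / 4) ∧ δ ≤ ε / 4 := by
    have hlim : Tendsto (fun δ : ℝ => ENNReal.ofReal δ ^ α * κ) (𝓝[>] 0)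
        (𝓝 (ENNReal.ofReal 0 ^ α * κ)) :=
      tendsto_nhdsWithin_of_tendsto_nhds (ENNReal.Tendsto.mul_const
        ((ENNReal.tendsto_ofReal tendsto_id).ennrpow_const α) (Or.inr hκtop))
    rw [ENNReal.ofReal_zero, ENNReal.zero_rpow_of_pos hα.1, zero_mul] at hlim
    obtain ⟨δ, h1, h2⟩ := ((hlim.eventually (gt_mem_nhds (ENNReal.ofReal_pos.2
      (show 0 < ε / 4 by linarith)))).and (Ioc_mem_nhdsGT (show 0 < ε / 4 by linarith))).exists
    exact ⟨δ, h2.1, h1.le, h2.2⟩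
  obtain ⟨T, hT, hξ⟩ := exists_tail_le hmom (ENNReal.ofReal_pos.2 hδ).ne'
  have hT0 : 0 < T := by linarith
  obtain ⟨k, hk, M, hM0, hM, hsum⟩ := exists_upper_sum_le hg0 hB hcont (beta₁_pos hr hα).le hT0
    (ENNReal.ofReal_pos.2 (half_pos hε)).ne'
  have hk' : (0 : ℝ) < k := Nat.cast_pos.2 hk
  set L := (T - -T) / k with hL
  have hL0 : 0 < L := div_pos (by linarith) hk'
  rw [hG, ← ENNReal.ofReal_add hG0 (half_pos hε).le] at hsum
  set μ := densityMeasure g with hμ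
  set E₁ : ℕ → Set ℝ := fun i => Ico (T * 2 ^ i) (T * 2 ^ (i + 1)) with hE₁
  set E₂ : ℕ → Set ℝ := fun i => Ico (-(T * 2 ^ (i + 1))) (-(T * 2 ^ i)) with hE₂
  have hE₁T : ∀ i, ∀ x ∈ E₁ i, T * 2 ^ i ≤ |x| := fun i x hx => hx.1.trans (le_abs_self x)
  have hE₂T : ∀ i, ∀ x ∈ E₂ i, T * 2 ^ i ≤ |x| := fun i x hx => by
    have := neg_le_abs x
    linarith [hx.2]
  have hlen₁ : ∀ i : ℕ, T * 2 ^ (i + 1) - T * 2 ^ i = T * (2 : ℝ) ^ i := fun i => by ring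
  have hlen₂ : ∀ i : ℕ, -(T * 2 ^ i) - -(T * 2 ^ (i + 1)) = T * (2 : ℝ) ^ i := fun i => by ring
  have hlt₁ : ∀ i : ℕ, T * 2 ^ i < T * (2 : ℝ) ^ (i + 1) := fun i => by
    have h1 : (0 : ℝ) < T * 2 ^ i := by positivity
    linarith [hlen₁ i]
  -- The rounding terms of `floor_entropy_le`.
  refine ⟨∑ j, (M j * L) ^ α, Finset.sum_nonneg fun j _ => Real.rpow_nonneg
    (mul_nonneg (hM0 j) hL0.le) _, fun N hN => ?_⟩
  have hN' : (0 : ℝ) < N := Nat.cast_pos.2 hN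
  set Nf : Fin k ⊕ (ℕ ⊕ ℕ) → ℕ :=
    -- The shells are all cut into `N` parts, which suffices because their contribution is small.
    Sum.elim (fun j => ⌊(N : ℝ) * (L * M j ^ (1 / beta₂ α r))⌋₊ + 1) fun _ => N with hNf
  have hNfpos : ∀ i, 0 < Nf i := by
    rintro (j | i)
    · exact Nat.succ_pos _
    · exact hN
  obtain ⟨q, hq, hq1, hq2⟩ := exists_subdivision_quantizer
    (shellLeft_lt_shellRight hT0 hk) (existsUnique_shell hT0 hk) hNfpos
  refine ⟨q, hq, (hq1 α μ).trans ?_, (hq2 r μ).le.trans ?_⟩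
  · rw [Summable.tsum_sum ENNReal.summable ENNReal.summable,
      Summable.tsum_sum ENNReal.summable ENNReal.summable, tsum_fintype]
    have hmain : ∀ j : Fin k, ∑ l : Fin (Nf (Sum.inl j)),
        μ (Ico (gridPoint (shellLeft T k (Sum.inl j)) (shellRight T k (Sum.inl j))
          (Nf (Sum.inl j)) l) (gridPoint (shellLeft T k (Sum.inl j)) (shellRight T k (Sum.inl j))
          (Nf (Sum.inl j)) ((l : ℝ) + 1))) ^ α ≤
        ENNReal.ofReal ((N : ℝ) ^ (1 - α)) * ENNReal.ofReal (L * M j ^ beta₁ α r) +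
          ENNReal.ofReal ((M j * L) ^ α) := by
      intro j
      refine (sum_cells_rpow_le_of_le (shellLeft_lt_shellRight hT0 hk (Sum.inl j)) (hNfpos _) (hM j) (hM0 j)
        hα).trans ?_
      have h1 : shellRight T k (Sum.inl j) - shellLeft T k (Sum.inl j) = L :=
        gridPoint_add_one_sub _ _ _ _
      have h2 := hM0 j
      rw [h1, ← ENNReal.ofReal_mul (by positivity), ← ENNReal.ofReal_add (by positivity)
        (by positivity)]
      exact ENNReal.ofReal_le_ofReal (floor_entropy_le hr hα hN'.le hL0 (hM0 j))
    have htail : ∀ {E : ℕ → Set ℝ}, (∀ i, MeasurableSet (E i)) →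
        (∀ i, ∀ x ∈ E i, T * 2 ^ i ≤ |x|) →
        ∑' i, (N : ℝ≥0∞) ^ (1 - α) * μ (E i) ^ α ≤
          ENNReal.ofReal ((N : ℝ) ^ (1 - α)) * ENNReal.ofReal (ε / 4) := by
      intro E hE hET
      rw [ENNReal.tsum_mul_left, ← ENNReal.ofReal_rpow_of_pos hN', ENNReal.ofReal_natCast]
      gcongr
      refine (tsum_shell_rpow_le hE hT hET hr hα).trans (le_trans ?_ hδκ)
      have := hα.1.le
      gcongr
    calc _ ≤ ∑ j : Fin k, (ENNReal.ofReal ((N : ℝ) ^ (1 - α)) *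
              ENNReal.ofReal (L * M j ^ beta₁ α r) + ENNReal.ofReal ((M j * L) ^ α)) +
            (∑' i, (N : ℝ≥0∞) ^ (1 - α) * μ (E₁ i) ^ α +
              ∑' i, (N : ℝ≥0∞) ^ (1 - α) * μ (E₂ i) ^ α) := by
          refine add_le_add (Finset.sum_le_sum fun j _ => hmain j) (add_le_add ?_ ?_)
          · exact ENNReal.tsum_le_tsum fun i =>
              sum_cells_rpow_le (shellLeft_lt_shellRight hT0 hk _) hN μ hα
          · exact ENNReal.tsum_le_tsum fun i =>
              sum_cells_rpow_le (shellLeft_lt_shellRight hT0 hk _) hN μ hα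
      _ ≤ ENNReal.ofReal ((N : ℝ) ^ (1 - α)) * ENNReal.ofReal (G + ε / 2) +
            ENNReal.ofReal (∑ j, (M j * L) ^ α) +
            (ENNReal.ofReal ((N : ℝ) ^ (1 - α)) * ENNReal.ofReal (ε / 4) +
              ENNReal.ofReal ((N : ℝ) ^ (1 - α)) * ENNReal.ofReal (ε / 4)) := by
          rw [Finset.sum_add_distrib, ← Finset.mul_sum, ENNReal.ofReal_sum_of_nonneg fun j _ =>
            Real.rpow_nonneg (mul_nonneg (hM0 j) hL0.le) _]
          gcongr
          · exact htail (fun i => measurableSet_Ico) hE₁T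
          · exact htail (fun i => measurableSet_Ico) hE₂T
      _ = _ := by
          have hc : 0 ≤ ∑ j, (M j * L) ^ α := Finset.sum_nonneg fun j _ => Real.rpow_nonneg
            (mul_nonneg (hM0 j) hL0.le) _
          rw [← ENNReal.ofReal_mul (by positivity), ← ENNReal.ofReal_mul (by positivity),
            ← ENNReal.ofReal_add (by positivity) hc, ← ENNReal.ofReal_add (by positivity)
            (by positivity), ← ENNReal.ofReal_add (by positivity) (by positivity)]
          congr 1
          ring
  · rw [Summable.tsum_sum ENNReal.summable ENNReal.summable,
      Summable.tsum_sum ENNReal.summable ENNReal.summable, tsum_fintype]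
    have hmain : ∀ j : Fin k, ∑ l : Fin (Nf (Sum.inl j)),
        ∫⁻ x in Ico (gridPoint (shellLeft T k (Sum.inl j)) (shellRight T k (Sum.inl j))
          (Nf (Sum.inl j)) l) (gridPoint (shellLeft T k (Sum.inl j)) (shellRight T k (Sum.inl j))
          (Nf (Sum.inl j)) ((l : ℝ) + 1)), ENNReal.ofReal (|x - (gridPoint
            (shellLeft T k (Sum.inl j)) (shellRight T k (Sum.inl j)) (Nf (Sum.inl j)) l +
            gridPoint (shellLeft T k (Sum.inl j)) (shellRight T k (Sum.inl j)) (Nf (Sum.inl j))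
              ((l : ℝ) + 1)) / 2| ^ r) ∂μ ≤
        ENNReal.ofReal ((N : ℝ) ^ (-r)) * (ENNReal.ofReal (constC r) *
          ENNReal.ofReal (L * M j ^ beta₁ α r)) := by
      intro j
      refine (sum_cells_distortion_le_of_le (shellLeft_lt_shellRight hT0 hk (Sum.inl j)) (hNfpos _) hgm
        (hM j) (hM0 j) hr).trans ?_
      have h1 : shellRight T k (Sum.inl j) - shellLeft T k (Sum.inl j) = L :=
        gridPoint_add_one_sub _ _ _ _
      have h2 := hM0 j
      rw [h1, ← ENNReal.ofReal_mul (by positivity), ← ENNReal.ofReal_mul (by positivity)]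
      exact ENNReal.ofReal_le_ofReal (floor_distortion_le hr hα hN' hL0 (hM0 j))
    have htail : ∀ {E : ℕ → Set ℝ}, (∀ i, MeasurableSet (E i)) →
        Pairwise (Function.onFun Disjoint E) →
        (∀ i, ∀ x ∈ E i, T * 2 ^ i ≤ |x|) →
        ∑' i, ENNReal.ofReal ((T * 2 ^ i / N) ^ r) * μ (E i) ≤
          ENNReal.ofReal ((N : ℝ) ^ (-r)) * ENNReal.ofReal (ε / 4) := by
      intro E hE hdisj hET
      refine (tsum_shell_distortion_le hE hdisj hT hET hr).trans ?_
      gcongr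
      exact hξ.trans (ENNReal.ofReal_le_ofReal hδε)
    calc _ ≤ ∑ j : Fin k, ENNReal.ofReal ((N : ℝ) ^ (-r)) * (ENNReal.ofReal (constC r) *
              ENNReal.ofReal (L * M j ^ beta₁ α r)) +
            (∑' i, ENNReal.ofReal ((T * 2 ^ i / N) ^ r) * μ (E₁ i) +
              ∑' i, ENNReal.ofReal ((T * 2 ^ i / N) ^ r) * μ (E₂ i)) := by
          refine add_le_add (Finset.sum_le_sum fun j _ => hmain j) (add_le_add ?_ ?_)
          · refine ENNReal.tsum_le_tsum fun i => ?_
            refine (sum_cells_distortion_le (shellLeft_lt_shellRight hT0 hk _) hN μ hr).trans ?_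
            simp only [shellLeft, shellRight, Sum.elim_inr, Sum.elim_inl, hlen₁]
            exact le_rfl
          · refine ENNReal.tsum_le_tsum fun i => ?_
            refine (sum_cells_distortion_le (shellLeft_lt_shellRight hT0 hk _) hN μ hr).trans ?_
            simp only [shellLeft, shellRight, Sum.elim_inr, hlen₂]
            exact le_rfl
      _ ≤ ENNReal.ofReal ((N : ℝ) ^ (-r)) * (ENNReal.ofReal (constC r) *
              ENNReal.ofReal (G + ε / 2)) +
            (ENNReal.ofReal ((N : ℝ) ^ (-r)) * ENNReal.ofReal (ε / 4) +
              ENNReal.ofReal ((N : ℝ) ^ (-r)) * ENNReal.ofReal (ε / 4)) := by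
          rw [← Finset.mul_sum, ← Finset.mul_sum]
          gcongr
          · exact htail (fun i => measurableSet_Ico) (pairwise_disjoint_dyadic hT0) hE₁T
          · exact htail (fun i => measurableSet_Ico) (pairwise_disjoint_dyadic_neg hT0) hE₂T
      _ ≤ _ := by
          rw [← ENNReal.ofReal_mul (by positivity), ← ENNReal.ofReal_mul (by positivity),
            ← ENNReal.ofReal_mul (by positivity),
            ← ENNReal.ofReal_add (by positivity) (by positivity),
            ← ENNReal.ofReal_add (by positivity) (by positivity)]
          refine ENNReal.ofReal_le_ofReal ?_
          have h1 : constC r * (ε / 2) ≤ ε / 2 := mul_le_of_le_one_left (by linarith) hC1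
          have h2 : (0 : ℝ) < (N : ℝ) ^ (-r) := by positivity
          nlinarith

/-! ### Consequences of asymptotic optimality. -/

lemma optimalDistortion_le {r α : ℝ} (hα : α ∈ Ioo (0 : ℝ) 1) {μ : Measure ℝ} {q q' : ℝ → ℝ}
    (hq' : IsQuantizer q') (h : cellSum α μ q' ≤ cellSum α μ q) :
    optimalDistortion α r μ (entropy α μ q) ≤ distortion r μ q' := by
  refine iInf_le_of_le q' (iInf_le_of_le hq' (iInf_le_of_le ?_ le_rfl))
  unfold entropy
  refine mul_le_mul_of_nonneg_left (ENNReal.log_monotone h) ?_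
  exact EReal.coe_nonneg.2 (inv_nonneg.2 (sub_nonneg.2 hα.2.le))

lemma tendsto_cellSum {α : ℝ} (hα : α ∈ Ioo (0 : ℝ) 1) {μ : Measure ℝ} {q : ℕ → ℝ → ℝ}
    (h : Tendsto (fun n => entropy α μ (q n)) atTop (𝓝 ⊤)) :
    Tendsto (fun n => cellSum α μ (q n)) atTop (𝓝 ∞) := by
  rw [ENNReal.tendsto_nhds_top_iff_nnreal]
  intro x
  have hx : (((1 - α)⁻¹ : ℝ) : EReal) * ENNReal.log ((x + 1 : NNReal) : ℝ≥0∞) < ⊤ := by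
    rw [ENNReal.log_of_nnreal (by positivity), ← EReal.coe_mul]
    exact EReal.coe_lt_top _
  filter_upwards [h.eventually (lt_mem_nhds hx)] with n hn
  by_contra hle
  rw [not_lt] at hle
  refine absurd hn (not_lt.2 ?_)
  refine mul_le_mul_of_nonneg_left (ENNReal.log_monotone (hle.trans ?_))
    (EReal.coe_nonneg.2 (inv_nonneg.2 (sub_nonneg.2 hα.2.le)))
  exact_mod_cast (le_add_of_nonneg_right zero_le_one : x ≤ x + 1)

/-- Quantizers of prescribed entropy whose distortion is within any constant factor of the
asymptotic optimum. -/
lemma exists_quantizer_cellSum_le {r α : ℝ} (hr : 1 < r) (hα : α ∈ Ioo (0 : ℝ) 1) {g : ℝ → ℝ}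
    (hgm : Measurable g) (hg0 : ∀ x, 0 ≤ g x) {B : ℝ} (hB : ∀ x, g x ≤ B)
    (hcont : ∀ᵐ x, ContinuousAt g x) [IsFiniteMeasure (densityMeasure g)]
    (hmom : ∫⁻ x, ENNReal.ofReal (|x| ^ r) ∂(densityMeasure g) ≠ ∞) {G : ℝ} (hG0 : 0 < G)
    (hG : ∫⁻ x, ENNReal.ofReal (g x ^ beta₁ α r) = ENNReal.ofReal G) {τ : ℝ}
    (hτ : constC r * G ^ beta₂ α r < τ) :
    ∀ᶠ s : ℝ in atTop, ∃ q, IsQuantizer q ∧ cellSum α (densityMeasure g) q ≤ ENNReal.ofReal s ∧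
      distortion r (densityMeasure g) q ≤ ENNReal.ofReal (τ * s ^ (-(r / (1 - α)))) := by
  have hC := constC_pos r hr
  have h1α : 0 < 1 - α := by linarith [hα.2]
  -- As `ε → 0` the left side tends to `C(r) G ^ β₂`, because `β₂ = r / (1 - α) + 1`.
  obtain ⟨ε, hε, hετ⟩ : ∃ ε : ℝ, 0 < ε ∧
      (G + 2 * ε) ^ (r / (1 - α)) * (constC r * G + ε) < τ := by
    have hlim : Tendsto (fun ε : ℝ => (G + 2 * ε) ^ (r / (1 - α)) * (constC r * G + ε)) (𝓝[>] 0)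
        (𝓝 ((G + 2 * 0) ^ (r / (1 - α)) * (constC r * G + 0))) := by
      refine tendsto_nhdsWithin_of_tendsto_nhds (Tendsto.mul (Tendsto.rpow_const ?_
        (Or.inr (by positivity))) (tendsto_const_nhds.add tendsto_id))
      exact tendsto_const_nhds.add (tendsto_const_nhds.mul tendsto_id)
    have he : (G + 2 * 0) ^ (r / (1 - α)) * (constC r * G + 0) = constC r * G ^ beta₂ α r := by
      have : beta₂ α r = r / (1 - α) + 1 := by
        unfold beta₂
        field_simp
        ring
      rw [this, Real.rpow_add_one hG0.ne', mul_zero, add_zero, add_zero]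
      ring
    rw [he] at hlim
    obtain ⟨ε, h1, h2⟩ := ((hlim.eventually (gt_mem_nhds hτ)).and eventually_mem_nhdsWithin).exists
    exact ⟨ε, h2, h1⟩
  obtain ⟨c, hc0, hc⟩ := exists_quantizer_le hr hα hgm hg0 hB hcont hmom hG0.le hG hε
  -- The number `w` solves `w ^ (1 - α) (G + 2 ε) = s`, and `N = ⌊w⌋` is used. One `ε` is the slack
  -- in the entropy bound; the second absorbs `c` once `s` is large.
  have hw : Tendsto (fun s : ℝ => (s / (G + 2 * ε)) ^ (1 / (1 - α))) atTop atTop :=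
    (tendsto_rpow_atTop (by positivity)).comp (tendsto_id.atTop_div_const (by positivity))
  have hfloor : ∀ᶠ w : ℝ in atTop, ((⌊w⌋₊ : ℝ) / w) ^ (-r) *
      ((G + 2 * ε) ^ (r / (1 - α)) * (constC r * G + ε)) < τ := by
    have h1 : Tendsto (fun w : ℝ => ((⌊w⌋₊ : ℝ) / w) ^ (-r) *
        ((G + 2 * ε) ^ (r / (1 - α)) * (constC r * G + ε))) atTop
        (𝓝 ((1 : ℝ) ^ (-r) * ((G + 2 * ε) ^ (r / (1 - α)) * (constC r * G + ε)))) :=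
      ((tendsto_nat_floor_div_atTop).rpow_const (Or.inl one_ne_zero)).mul_const _
    rw [Real.one_rpow, one_mul] at h1
    exact h1.eventually (gt_mem_nhds hετ)
  filter_upwards [hw.eventually hfloor, hw.eventually (eventually_ge_atTop 1),
    eventually_gt_atTop 0, eventually_ge_atTop (c * (G + 2 * ε) / ε)] with s h1 h2 hs h3
  set w := (s / (G + 2 * ε)) ^ (1 / (1 - α)) with hwdef
  have hN : 0 < ⌊w⌋₊ := Nat.floor_pos.2 h2
  have hN' : (0 : ℝ) < ⌊w⌋₊ := Nat.cast_pos.2 hN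
  have hw0 : 0 < w := by linarith
  have hww : w ^ (1 - α) = s / (G + 2 * ε) := by
    rw [hwdef, ← Real.rpow_mul (by positivity), one_div, inv_mul_cancel₀ h1α.ne', Real.rpow_one]
  have hwr : w ^ (-r) = s ^ (-(r / (1 - α))) * (G + 2 * ε) ^ (r / (1 - α)) := by
    rw [hwdef, ← Real.rpow_mul (by positivity), Real.div_rpow hs.le (by positivity),
      div_eq_mul_inv, ← Real.rpow_neg (by positivity)]
    congr 2 <;> ring
  obtain ⟨q, hq, hq1, hq2⟩ := hc _ hN
  refine ⟨q, hq, hq1.trans (ENNReal.ofReal_le_ofReal ?_), hq2.trans (ENNReal.ofReal_le_ofReal ?_)⟩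
  · have h4 : (⌊w⌋₊ : ℝ) ^ (1 - α) ≤ s / (G + 2 * ε) := by
      rw [← hww]
      exact Real.rpow_le_rpow hN'.le (Nat.floor_le hw0.le) h1α.le
    have h5 : s / (G + 2 * ε) * (G + ε) + c ≤ s := by
      rw [div_le_iff₀ hε] at h3
      rw [div_mul_eq_mul_div, div_add' _ _ _ (by positivity), div_le_iff₀ (by positivity)]
      linarith
    have h6 := mul_le_mul_of_nonneg_right h4 (show 0 ≤ G + ε by positivity)
    linarith
  · rw [Real.div_rpow hN'.le hw0.le, hwr] at h1
    have hp : 0 < s ^ (-(r / (1 - α))) := by positivity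
    have hp2 : 0 < (G + 2 * ε) ^ (r / (1 - α)) := by positivity
    have e : (⌊w⌋₊ : ℝ) ^ (-r) * (constC r * G + ε) =
        (⌊w⌋₊ : ℝ) ^ (-r) / (s ^ (-(r / (1 - α))) * (G + 2 * ε) ^ (r / (1 - α))) *
          ((G + 2 * ε) ^ (r / (1 - α)) * (constC r * G + ε)) * s ^ (-(r / (1 - α))) := by
      field_simp
    rw [e]
    exact mul_le_mul_of_nonneg_right h1.le hp.le

/-- The distortion of an asymptotically optimal sequence, in terms of its entropy. -/
lemma IsAsymptoticallyOptimal.eventually_distortion_le {r α : ℝ} (hr : 1 < r)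
    (hα : α ∈ Ioo (0 : ℝ) 1) {g : ℝ → ℝ}
    (hgm : Measurable g) (hg0 : ∀ x, 0 ≤ g x) {B : ℝ} (hB : ∀ x, g x ≤ B)
    (hcont : ∀ᵐ x, ContinuousAt g x) [IsFiniteMeasure (densityMeasure g)]
    (hmom : ∫⁻ x, ENNReal.ofReal (|x| ^ r) ∂(densityMeasure g) ≠ ∞) {G : ℝ} (hG0 : 0 < G)
    (hG : ∫⁻ x, ENNReal.ofReal (g x ^ beta₁ α r) = ENNReal.ofReal G) {q : ℕ → ℝ → ℝ}
    (hq : IsAsymptoticallyOptimal α r (densityMeasure g) q) {a : ℝ} (ha : 1 < a) :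
    ∀ᶠ n in atTop, (cellSum α (densityMeasure g) (q n) ≠ 0 ∧
        cellSum α (densityMeasure g) (q n) ≠ ∞) ∧
      distortion r (densityMeasure g) (q n) * cellSum α (densityMeasure g) (q n) ^ (r / (1 - α)) ≤
        ENNReal.ofReal (a * (a * (constC r * G ^ beta₂ α r))) := by
  have hC := constC_pos r hr
  have h1α : 0 < 1 - α := by linarith [hα.2]
  have hp : 0 < r / (1 - α) := by positivity
  set μ := densityMeasure g with hμ
  set K := constC r * G ^ beta₂ α r with hK
  have hK0 : 0 < K := by positivity
  -- One factor `a` comes from the constructed quantizers, the other from the ratio to the optimal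
  -- distortion.
  have hτ : K < a * K := lt_mul_of_one_lt_left hK0 ha
  have hquant := exists_quantizer_cellSum_le hr hα hgm hg0 hB hcont hmom hG0 hG hτ
  obtain ⟨s₀, hs₀⟩ := eventually_atTop.1 hquant
  have hsum := tendsto_cellSum hα hq.tendsto_entropy
  have hratio : ∀ᶠ n in atTop, distortion r μ (q n) /
      optimalDistortion α r μ (entropy α μ (q n)) ∈ Ioo 0 (ENNReal.ofReal a) := by
    refine hq.tendsto_ratio.eventually (Ioo_mem_nhds one_pos ?_)
    rw [← ENNReal.ofReal_one]
    exact (ENNReal.ofReal_lt_ofReal_iff (by linarith)).2 ha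
  filter_upwards [hratio, hsum.eventually (lt_mem_nhds
    (ENNReal.ofReal_lt_top : ENNReal.ofReal (max s₀ 1) < ∞))] with n hn1 hn2
  have hs0 : cellSum α μ (q n) ≠ 0 := (pos_of_gt hn2).ne'
  -- With an infinite sum the entropy constraint is void and the optimal distortion is 0; the
  -- quotient would be 0 or `∞`, outside the interval `(0, a)`.
  have hs_fin : cellSum α μ (q n) ≠ ∞ := by
    intro htop
    have hopt : optimalDistortion α r μ (entropy α μ (q n)) = 0 := by
      have hle : ∀ᶠ s : ℝ in atTop, optimalDistortion α r μ (entropy α μ (q n)) ≤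
          ENNReal.ofReal (a * K * s ^ (-(r / (1 - α)))) := by
        filter_upwards [hquant] with s hs
        obtain ⟨q', hq', -, h2⟩ := hs
        exact (optimalDistortion_le hα hq' (by rw [htop]; exact le_top)).trans h2
      have hlim : Tendsto (fun s : ℝ => ENNReal.ofReal (a * K * s ^ (-(r / (1 - α))))) atTop
          (𝓝 (ENNReal.ofReal (a * K * 0))) :=
        ENNReal.tendsto_ofReal ((tendsto_rpow_neg_atTop hp).const_mul _)
      rw [mul_zero, ENNReal.ofReal_zero] at hlim
      exact le_antisymm (ge_of_tendsto hlim hle) (zero_le)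
    rw [hopt] at hn1
    rcases eq_or_ne (distortion r μ (q n)) 0 with h0 | h0
    · rw [h0, ENNReal.zero_div] at hn1
      exact lt_irrefl _ hn1.1
    · rw [ENNReal.div_zero h0] at hn1
      exact not_top_lt hn1.2
  refine ⟨⟨hs0, hs_fin⟩, ?_⟩
  set s := (cellSum α μ (q n)).toReal with hs
  have hss : cellSum α μ (q n) = ENNReal.ofReal s := (ENNReal.ofReal_toReal hs_fin).symm
  rw [hss, ENNReal.ofReal_lt_ofReal_iff_of_nonneg (le_max_of_le_right zero_le_one)] at hn2
  have hspos : 0 < s := lt_of_lt_of_le one_pos ((le_max_right s₀ 1).trans hn2.le)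
  obtain ⟨q', hq', h1, h2⟩ := hs₀ s ((le_max_left s₀ 1).trans hn2.le)
  have hopt : optimalDistortion α r μ (entropy α μ (q n)) ≤
      ENNReal.ofReal (a * K * s ^ (-(r / (1 - α)))) :=
    (optimalDistortion_le hα hq' (by rw [hss]; exact h1)).trans h2
  have hD : distortion r μ (q n) ≤
      ENNReal.ofReal a * ENNReal.ofReal (a * K * s ^ (-(r / (1 - α)))) := by
    refine le_trans ?_ (mul_le_mul_right hopt (ENNReal.ofReal a))
    exact (ENNReal.div_le_iff_le_mul (Or.inr ENNReal.ofReal_ne_top)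
      (Or.inl (ne_top_of_le_ne_top ENNReal.ofReal_ne_top hopt))).1 hn1.2.le
  rw [hss, ENNReal.ofReal_rpow_of_pos hspos]
  refine (mul_le_mul_left hD _).trans (le_of_eq ?_)
  rw [← ENNReal.ofReal_mul (by positivity), ← ENNReal.ofReal_mul (by positivity)]
  congr 1
  rw [Real.rpow_neg hspos.le]
  have : s ^ (r / (1 - α)) ≠ 0 := by positivity
  field_simp

/-! ### Integrability and the integrands of the limits. -/

lemma isFiniteMeasure_densityMeasure {g : ℝ → ℝ} (hg : IsDensity g) :
    IsFiniteMeasure (densityMeasure g) :=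
  isFiniteMeasure_withDensity (by rw [hg.lintegral_eq_one]; exact ENNReal.one_ne_top)

lemma lintegral_densityMeasure {g : ℝ → ℝ} (hg : Measurable g) {F : ℝ → ℝ≥0∞} (hF : Measurable F) :
    ∫⁻ x, F x ∂(densityMeasure g) = ∫⁻ x, ENNReal.ofReal (g x) * F x := by
  simpa using setLIntegral_densityMeasure hg MeasurableSet.univ hF

lemma lintegral_moment_ne_top {μ : Measure ℝ} [IsFiniteMeasure μ] {p r : ℝ} (hp : 0 ≤ p)
    (hpr : p ≤ r) (h : ∫⁻ x, ENNReal.ofReal (|x| ^ r) ∂μ < ∞) :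
    ∫⁻ x, ENNReal.ofReal (|x| ^ p) ∂μ ≠ ∞ := by
  have hle : ∫⁻ x, ENNReal.ofReal (|x| ^ p) ∂μ ≤ ∫⁻ x, (1 + ENNReal.ofReal (|x| ^ r)) ∂μ := by
    refine lintegral_mono fun x => ?_
    rw [← ENNReal.ofReal_one, ← ENNReal.ofReal_add zero_le_one (by positivity)]
    refine ENNReal.ofReal_le_ofReal ?_
    rcases le_total |x| 1 with h1 | h1
    · have h2 := Real.rpow_le_one (abs_nonneg x) h1 hp
      have h3 : 0 ≤ |x| ^ r := by positivity
      linarith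
    · have h2 := Real.rpow_le_rpow_of_exponent_le h1 hpr
      linarith
  refine ne_top_of_le_ne_top ?_ hle
  rw [lintegral_add_left measurable_const, lintegral_const, one_mul]
  exact ENNReal.add_ne_top.2 ⟨measure_ne_top _ _, h.ne⟩

/-- Finiteness of `∫ g ^ β₁`, by Hölder's inequality and the moment condition. -/
lemma integrable_rpow_beta₁ {r α : ℝ} (hr : 1 < r) (hα : α ∈ Ioo (0 : ℝ) 1) {g : ℝ → ℝ}
    (hgm : Measurable g) (hg0 : ∀ x, 0 ≤ g x) [IsFiniteMeasure (densityMeasure g)]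
    (hmom : ∫⁻ x, ENNReal.ofReal (|x| ^ r) ∂(densityMeasure g) ≠ ∞) :
    Integrable fun x => g x ^ beta₁ α r := by
  have hb0 := beta₁_pos hr hα
  have hb1 : 0 < 1 - beta₁ α r := sub_pos.2 (beta₁_lt_one hr hα)
  set b := beta₁ α r with hb
  -- This exponent makes the powers of `1 + |x|` cancel in the weighted mean of `g (1 + |x|) ^ r`
  -- and `(1 + |x|) ^ (-e)`, leaving `g ^ b`. Both are integrable, the second because `e > 1`.
  set e := r * b / (1 - b) with he
  have he1 : 1 < e := by
    obtain ⟨h0, h1⟩ := hα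
    have h1α : 0 < 1 - α := by linarith
    have h2 : 0 < 1 - α + r := by linarith
    have h3 : (1 - b) = r * (1 - α) / (1 - α + r) := by
      rw [hb]
      unfold beta₁
      field_simp
      ring
    rw [he, h3, lt_div_iff₀ (by positivity), one_mul, hb]
    unfold beta₁
    rw [mul_div_assoc', div_lt_div_iff_of_pos_right h2]
    have : 0 < r * (α * r) := by positivity
    linarith
  have hint1 : Integrable fun x : ℝ => (1 + ‖x‖) ^ (-e) :=
    integrable_one_add_norm (by simpa using he1)
  have hint2 : Integrable fun x : ℝ => g x * (1 + |x|) ^ r := by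
    refine ⟨(hgm.mul (by fun_prop)).aestronglyMeasurable, ?_⟩
    rw [hasFiniteIntegral_iff_ofReal (Eventually.of_forall fun x =>
      mul_nonneg (hg0 x) (by positivity))]
    have hle : ∫⁻ x, ENNReal.ofReal (g x * (1 + |x|) ^ r) ≤
        ∫⁻ x, ENNReal.ofReal (2 ^ r) * (1 + ENNReal.ofReal (|x| ^ r)) ∂(densityMeasure g) := by
      rw [lintegral_densityMeasure hgm (by fun_prop)]
      refine lintegral_mono fun x => ?_
      rw [ENNReal.ofReal_mul (hg0 x)]
      gcongr
      rw [← ENNReal.ofReal_one, ← ENNReal.ofReal_add zero_le_one (by positivity),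
        ← ENNReal.ofReal_mul (by positivity)]
      refine ENNReal.ofReal_le_ofReal ?_
      have h1 : (1 + |x|) ^ r ≤ (2 * max 1 |x|) ^ r := by
        refine Real.rpow_le_rpow (by positivity) ?_ (by linarith)
        linarith [le_max_left 1 |x|, le_max_right 1 |x|]
      rw [Real.mul_rpow (by norm_num) (by positivity)] at h1
      refine h1.trans (mul_le_mul_of_nonneg_left ?_ (by positivity))
      have h2 : 0 ≤ |x| ^ r := by positivity
      rcases max_choice 1 |x| with h | h <;> rw [h]
      · rw [Real.one_rpow]
        linarith
      · linarith
    refine hle.trans_lt ?_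
    rw [lintegral_const_mul _ (by fun_prop), lintegral_add_left measurable_const, lintegral_const]
    exact ENNReal.mul_lt_top ENNReal.ofReal_lt_top (ENNReal.add_lt_top.2
      ⟨by simp, hmom.lt_top⟩)
  refine Integrable.mono' ((hint2.const_mul b).add (hint1.const_mul (1 - b)))
    (hgm.pow_const b).aestronglyMeasurable (Eventually.of_forall fun x => ?_)
  have hx : (0 : ℝ) < 1 + |x| := by positivity
  rw [Real.norm_of_nonneg (Real.rpow_nonneg (hg0 x) _)]
  have hy := Real.geom_mean_le_arith_mean2_weighted hb0.le hb1.le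
    (mul_nonneg (hg0 x) (Real.rpow_nonneg hx.le r)) (Real.rpow_nonneg hx.le (-e)) (by ring)
  refine le_trans (le_of_eq ?_) hy
  rw [Real.mul_rpow (hg0 x) (by positivity), ← Real.rpow_mul hx.le, ← Real.rpow_mul hx.le, mul_assoc,
    ← Real.rpow_add hx]
  have : r * b + -e * (1 - b) = 0 := by
    rw [he]
    field_simp
    ring
  rw [this, Real.rpow_zero, mul_one]

/-- Together with `mul_rpow_beta₂_neg` this expresses the integrands of the second limit through `f
/ g` and `g ^ β₁`. For `v = 0` both sides are 0. -/
lemma rpow_mul_rpow_beta₂ {r α : ℝ} (hr : 1 < r) (hα : α ∈ Ioo (0 : ℝ) 1) {u v : ℝ} (hu : 0 ≤ u)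
    (hv : 0 ≤ v) :
    u ^ α * (v ^ (1 / beta₂ α r)) ^ (1 - α) = (u / v) ^ α * v ^ beta₁ α r := by
  have h1α : 0 < 1 - α := by linarith [hα.2]
  have hθ := (one_div_beta₂_mem hr hα).1
  rcases hv.eq_or_lt with rfl | hv
  · rw [Real.zero_rpow hθ.ne', Real.zero_rpow h1α.ne', Real.zero_rpow (beta₁_pos hr hα).ne']
    simp
  · have e : 1 / beta₂ α r * (1 - α) + α = beta₁ α r := by
      unfold beta₁ beta₂
      have : 1 - α + r ≠ 0 := by linarith
      field_simp
      ring
    have hvα : v ^ α ≠ 0 := (Real.rpow_pos_of_pos hv α).ne'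
    rw [Real.div_rpow hu hv.le, ← Real.rpow_mul hv.le, ← e, Real.rpow_add hv]
    field_simp

lemma mul_rpow_beta₂_neg {r α : ℝ} (hr : 1 < r) (hα : α ∈ Ioo (0 : ℝ) 1) {u v : ℝ} (hv : 0 ≤ v) :
    u * (v ^ (1 / beta₂ α r)) ^ (-r) = u / v * v ^ beta₁ α r := by
  have h1α : 0 < 1 - α := by linarith [hα.2]
  have hθ := (one_div_beta₂_mem hr hα).1
  rcases hv.eq_or_lt with rfl | hv
  · rw [Real.zero_rpow hθ.ne', Real.zero_rpow (by linarith), Real.zero_rpow (beta₁_pos hr hα).ne']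
    simp
  · have e : 1 / beta₂ α r * -r + 1 = beta₁ α r := by
      unfold beta₁ beta₂
      have : 1 - α + r ≠ 0 := by linarith
      field_simp
      ring
    rw [← Real.rpow_mul hv.le, ← e, Real.rpow_add_one hv.ne']
    field_simp

/-! ### The mismatch limits. -/

/-- The sum defining the entropy with respect to `ρ g` as an integral against the entropy measure
of `g`. -/
lemma lintegral_ratio_entropyMeasure {α : ℝ} (hα : α ∈ Ioo (0 : ℝ) 1) {μ ν : Measure ℝ}
    [IsFiniteMeasure μ] [IsFiniteMeasure ν] (hνμ : ν ≪ μ) {q : ℝ → ℝ} (hq : IsQuantizer q) :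
    ∫⁻ x, ENNReal.ofReal ((ν (q ⁻¹' {q x}) / μ (q ⁻¹' {q x})).toReal ^ α) ∂(entropyMeasure α μ q) =
      cellSum α ν q * (cellSum α μ q)⁻¹ := by
  rw [lintegral_eq_tsum_cells hq, cellSum, ← ENNReal.tsum_mul_right]
  refine tsum_congr fun c => ?_
  have hm := hq.measurable (measurableSet_singleton (c : ℝ))
  have hcon : ∀ x ∈ q ⁻¹' {(c : ℝ)},
      ENNReal.ofReal ((ν (q ⁻¹' {q x}) / μ (q ⁻¹' {q x})).toReal ^ α) =
      ENNReal.ofReal ((ν (q ⁻¹' {(c : ℝ)}) / μ (q ⁻¹' {(c : ℝ)})).toReal ^ α) := by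
    intro x hx
    have : q x = c := hx
    rw [this]
  rw [setLIntegral_congr_fun hm hcon, setLIntegral_const, entropyMeasure_cell hq hα.1]
  rcases eq_or_ne (μ (q ⁻¹' {(c : ℝ)})) 0 with h0 | h0
  · rw [h0, hνμ h0, ENNReal.zero_rpow_of_pos hα.1]
    simp
  · rw [← ENNReal.ofReal_rpow_of_nonneg ENNReal.toReal_nonneg hα.1.le, ENNReal.ofReal_toReal
      (ENNReal.div_ne_top (measure_ne_top _ _) h0), ← mul_assoc,
      ← ENNReal.mul_rpow_of_nonneg _ _ hα.1.le,
      ENNReal.div_mul_cancel h0 (measure_ne_top _ _)]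

/-- Undoes the normalization of the distortion measure; `ρ = 1` gives its total mass. -/
lemma lintegral_distortionMeasure {α r G : ℝ} (hr : 1 < r) (hG : 0 < G) {g ρ : ℝ → ℝ}
    (hgm : Measurable g) (hρm : Measurable ρ) (hρ0 : ∀ x, 0 ≤ ρ x) {q : ℝ → ℝ}
    (hq : IsQuantizer q) :
    (∫⁻ x, ENNReal.ofReal (ρ x) ∂(distortionMeasure α r G (densityMeasure g) q)) *
        ENNReal.ofReal (constC r * G ^ beta₂ α r) =
      cellSum α (densityMeasure g) q ^ (r / (1 - α)) *
        distortion r (densityMeasure fun x => ρ x * g x) q := by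
  have hC := constC_pos r hr
  have hK : ENNReal.ofReal (constC r * G ^ beta₂ α r) ≠ 0 := by
    rw [Ne, ENNReal.ofReal_eq_zero, not_le]
    positivity
  have hKt : ENNReal.ofReal (constC r * G ^ beta₂ α r) ≠ ∞ := ENNReal.ofReal_ne_top
  have herr := hq.measurable_error r
  rw [distortionMeasure, lintegral_withDensity_eq_lintegral_mul _ (herr.mul_const _)
    hρm.ennreal_ofReal, distortion, 
    lintegral_densityMeasure (g := fun x => ρ x * g x) (hρm.mul hgm) herr]
  simp only [Pi.mul_apply]
  generalize cellSum α (densityMeasure g) q ^ (r / (1 - α)) = S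
  generalize ENNReal.ofReal (constC r * G ^ beta₂ α r) = K at *
  have hm : Measurable fun x => ENNReal.ofReal (|x - q x| ^ r) * (S * K⁻¹) * ENNReal.ofReal (ρ x) :=
    (herr.mul_const _).mul hρm.ennreal_ofReal
  have hm' : Measurable fun x => ENNReal.ofReal (ρ x * g x) * ENNReal.ofReal (|x - q x| ^ r) :=
    (hρm.mul hgm).ennreal_ofReal.mul herr
  rw [lintegral_densityMeasure hgm hm]
  have e : ∀ x, ENNReal.ofReal (g x) * (ENNReal.ofReal (|x - q x| ^ r) * (S * K⁻¹) *
      ENNReal.ofReal (ρ x)) =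
      ENNReal.ofReal (ρ x * g x) * ENNReal.ofReal (|x - q x| ^ r) * (S * K⁻¹) := fun x => by
    rw [ENNReal.ofReal_mul (hρ0 x)]
    ring
  simp_rw [e]
  rw [lintegral_mul_const _ hm', mul_assoc, mul_assoc, ENNReal.inv_mul_cancel hK hKt, mul_one,
    mul_comm]

/-- Both sums are positive and finite, so the logarithms are real and the difference can be computed
in `ℝ`. -/
lemma exp_entropy_sub {α : ℝ} (hα : α ∈ Ioo (0 : ℝ) 1) {μ ν : Measure ℝ} {q : ℝ → ℝ}
    (hμ0 : cellSum α μ q ≠ 0) (hμ : cellSum α μ q ≠ ∞) (hν0 : cellSum α ν q ≠ 0)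
    (hν : cellSum α ν q ≠ ∞) :
    EReal.exp (((1 - α : ℝ) : EReal) * (entropy α ν q - entropy α μ q)) =
      cellSum α ν q * (cellSum α μ q)⁻¹ := by
  have h1α : 1 - α ≠ 0 := by linarith [hα.2]
  have e : ∀ m : Measure ℝ, entropy α m q =
      (((1 - α)⁻¹ : ℝ) : EReal) * ENNReal.log (cellSum α m q) := fun _ => rfl
  rw [e, e, ENNReal.log_pos_real hν0 hν, ENNReal.log_pos_real hμ0 hμ, ← EReal.coe_mul,
    ← EReal.coe_mul, ← EReal.coe_sub, ← EReal.coe_mul, EReal.exp_coe]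
  have ha : 0 < (cellSum α ν q).toReal := ENNReal.toReal_pos hν0 hν
  have hb : 0 < (cellSum α μ q).toReal := ENNReal.toReal_pos hμ0 hμ
  rw [← mul_sub, mul_inv_cancel_left₀ h1α, Real.exp_sub, Real.exp_log ha, Real.exp_log hb,
    ENNReal.ofReal_div_of_pos hb, ENNReal.ofReal_toReal hν, ENNReal.ofReal_toReal hμ,
    div_eq_mul_inv]

lemma exp_mul_entropy {α : ℝ} (r : ℝ) (μ : Measure ℝ) (q : ℝ → ℝ) :
    EReal.exp ((r : EReal) * entropy α μ q) = cellSum α μ q ^ (r / (1 - α)) := by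
  rw [ENNReal.rpow_eq_exp_mul_log, div_eq_mul_inv, EReal.coe_mul, mul_assoc]
  rfl

lemma cellSum_ne_zero {α : ℝ} (hα : 0 < α) {μ : Measure ℝ} (hμ : μ univ ≠ 0) {q : ℝ → ℝ}
    (hq : IsQuantizer q) : cellSum α μ q ≠ 0 := by
  intro h
  apply hμ
  rw [measure_eq_tsum_cells hq μ MeasurableSet.univ, ENNReal.tsum_eq_zero]
  intro c
  have := (ENNReal.tsum_eq_zero.1 h) c
  rw [ENNReal.rpow_eq_zero_iff_of_pos hα] at this
  rwa [univ_inter]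

/-- The mismatch limits for `ν = ρ μ` with `ρ` bounded and continuous on an open set `O` carrying
`μ`. -/
theorem tendsto_mismatch {r α : ℝ} (hr : 1 < r) (hα : α ∈ Ioo (0 : ℝ) 1) {g ρ : ℝ → ℝ}
    (hgm : Measurable g) (hg0 : ∀ x, 0 ≤ g x) {B : ℝ} (hB : ∀ x, g x ≤ B)
    (hcont : ∀ᵐ x, ContinuousAt g x) [IsFiniteMeasure (densityMeasure g)]
    (hmom : ∫⁻ x, ENNReal.ofReal (|x| ^ r) ∂(densityMeasure g) ≠ ∞) {G : ℝ} (hG0 : 0 < G)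
    (hG : ∫⁻ x, ENNReal.ofReal (g x ^ beta₁ α r) = ENNReal.ofReal G) {O : Set ℝ} (hO : IsOpen O)
    (hg : ContinuousOn g O) (hpos : ∀ x ∈ O, 0 < g x)
    (hOc : ∀ᵐ x, x ∈ Oᶜ → g x = 0)
    (hρm : Measurable ρ) (hρ0 : ∀ x, 0 ≤ ρ x) {M : ℝ} (hρM : ∀ x, ρ x ≤ M) (hρ : ContinuousOn ρ O)
    [IsFiniteMeasure (densityMeasure fun x => ρ x * g x)]
    {q : ℕ → ℝ → ℝ} (hq : IsAsymptoticallyOptimal α r (densityMeasure g) q) :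
    (∀ᶠ n in atTop, cellSum α (densityMeasure g) (q n) ≠ 0 ∧
      cellSum α (densityMeasure g) (q n) ≠ ∞) ∧
    Tendsto (fun n => cellSum α (densityMeasure fun x => ρ x * g x) (q n) *
        (cellSum α (densityMeasure g) (q n))⁻¹) atTop
      (𝓝 (∫⁻ x, ENNReal.ofReal (ρ x ^ α) ∂(limitMeasure (beta₁ α r) G g))) ∧
    Tendsto (fun n => cellSum α (densityMeasure g) (q n) ^ (r / (1 - α)) *
        distortion r (densityMeasure fun x => ρ x * g x) (q n)) atTop
      (𝓝 ((∫⁻ x, ENNReal.ofReal (ρ x) ∂(limitMeasure (beta₁ α r) G g)) *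
        ENNReal.ofReal (constC r * G ^ beta₂ α r))) := by
  have hC := constC_pos r hr
  have h1α : 0 < 1 - α := by linarith [hα.2]
  have hp : 0 < r / (1 - α) := by positivity
  set μ := densityMeasure g with hμ
  set ν := densityMeasure fun x => ρ x * g x with hν
  set γ := limitMeasure (beta₁ α r) G g with hγ
  set K := constC r * G ^ beta₂ α r with hK
  have hK0 : 0 < K := by positivity
  have hKne : ENNReal.ofReal K ≠ 0 := (ENNReal.ofReal_pos.2 hK0).ne'
  have hbound := fun a ha => hq.eventually_distortion_le hr hα hgm hg0 hB hcont hmom hG0 hG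
    (a := a) ha
  have hs : ∀ᶠ n in atTop, cellSum α μ (q n) ≠ 0 ∧ cellSum α μ (q n) ≠ ∞ :=
    (hbound 2 one_lt_two).mono fun n hn => hn.1
  have hsum := tendsto_cellSum hα hq.tendsto_entropy
  -- The product of the distortion with `s ^ (r / (1 - α))` stays bounded while `s → ∞`.
  have hD : Tendsto (fun n => distortion r μ (q n)) atTop (𝓝 0) := by
    have hinv : Tendsto (fun n => ENNReal.ofReal (2 * (2 * K)) *
        (cellSum α μ (q n) ^ (r / (1 - α)))⁻¹) atTop (𝓝 0) := by
      have h1 := (ENNReal.tendsto_rpow_at_top hp).comp hsum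
      have h2 := ENNReal.Tendsto.const_mul (a := ENNReal.ofReal (2 * (2 * K)))
        (tendsto_inv_iff.2 h1) (Or.inr ENNReal.ofReal_ne_top)
      simpa using h2
    refine tendsto_of_tendsto_of_tendsto_of_le_of_le' tendsto_const_nhds hinv
      (Eventually.of_forall fun n => zero_le) ?_
    filter_upwards [hbound 2 one_lt_two] with n hn
    rw [← div_eq_mul_inv, ENNReal.le_div_iff_mul_le
      (Or.inl (by simpa [hp, hp.le, hp.not_gt] using hn.1.1))
      (Or.inl (ENNReal.rpow_ne_top_of_nonneg hp.le hn.1.2))]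
    exact hn.2
  have hBuniv : ∀ n, distortionMeasure α r G μ (q n) univ * ENNReal.ofReal K =
      cellSum α μ (q n) ^ (r / (1 - α)) * distortion r μ (q n) := by
    intro n
    have := lintegral_distortionMeasure (α := α) hr hG0 hgm (ρ := fun _ => 1) measurable_const
      (fun _ => zero_le_one) (hq.isQuantizer n)
    simpa using this
  have hlimsup : limsup (fun n => distortionMeasure α r G μ (q n) univ) atTop ≤ 1 := by
    have hle : ∀ a : ℝ, 1 < a →
        limsup (fun n => distortionMeasure α r G μ (q n) univ) atTop ≤ ENNReal.ofReal (a * a) := by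
      intro a ha
      refine limsup_le_of_le ?_ ?_
      · isBoundedDefault
      filter_upwards [hbound a ha] with n hn
      have h1 := hn.2
      rw [mul_comm, ← hBuniv, ← mul_assoc, 
        ENNReal.ofReal_mul (p := a * a) (q := K) (by nlinarith)] at h1
      exact (ENNReal.mul_le_mul_iff_left hKne ENNReal.ofReal_ne_top).1 h1
    have hlim : Tendsto (fun a : ℝ => ENNReal.ofReal (a * a)) (𝓝[>] 1)
        (𝓝 (ENNReal.ofReal (1 * 1))) :=
      tendsto_nhdsWithin_of_tendsto_nhds (ENNReal.tendsto_ofReal (tendsto_id.mul tendsto_id))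
    rw [mul_one, ENNReal.ofReal_one] at hlim
    exact ge_of_tendsto hlim (eventually_mem_nhdsWithin.mono hle)
  have hγuniv : γ univ = 1 := by
    rw [hγ, limitMeasure, withDensity_apply _ MeasurableSet.univ, setLIntegral_univ]
    simp_rw [ENNReal.ofReal_div_of_pos hG0, div_eq_mul_inv]
    rw [lintegral_mul_const _ (hgm.pow_const _).ennreal_ofReal, hG,
      ENNReal.mul_inv_cancel (ENNReal.ofReal_pos.2 hG0).ne' ENNReal.ofReal_ne_top]
  have : IsFiniteMeasure γ := ⟨by rw [hγuniv]; exact ENNReal.one_lt_top⟩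
  have hγO : γ Oᶜ = 0 := by
    rw [hγ, limitMeasure, withDensity_apply _ hO.measurableSet.compl, lintegral_eq_zero_iff
      ((hgm.pow_const _).div_const G).ennreal_ofReal]
    rw [Filter.EventuallyEq, ae_restrict_iff' hO.measurableSet.compl]
    filter_upwards [hOc] with x hx hxO
    simp [hx hxO, Real.zero_rpow (beta₁_pos hr hα).ne']
  have hweak := fun (φ : ℝ → ℝ) (hφ : Continuous φ) (hφ0 : ∀ x, 0 ≤ φ x) (L : ℝ)
    (hL : ∀ x, φ x ≤ L) => tendsto_lintegral_entropyMeasure_distortionMeasure hr hα hG0 hgm hO hg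
      hpos hγO hγuniv hq.isQuantizer hs hD hlimsup hφ hφ0 hL
  have hM0 : 0 ≤ M := (hρ0 0).trans (hρM 0)
  have hνμ : ∀ E, MeasurableSet E → ν E ≤ ENNReal.ofReal M * μ E := by
    intro E hE
    rw [hν, hμ, densityMeasure, densityMeasure, withDensity_apply _ hE, withDensity_apply _ hE,
      ← lintegral_const_mul _ hgm.ennreal_ofReal]
    refine lintegral_mono fun x => ?_
    rw [← ENNReal.ofReal_mul hM0]
    exact ENNReal.ofReal_le_ofReal (mul_le_mul_of_nonneg_right (hρM x) (hg0 x))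
  have hac : ν ≪ μ := Measure.AbsolutelyContinuous.mk fun E hE h0 => by
    have := hνμ E hE
    rw [h0, mul_zero] at this
    exact le_antisymm this (zero_le)
  refine ⟨hs, ?_, ?_⟩
  · have hlim := tendsto_lintegral_of_locally_uniform (P := fun n => entropyMeasure α μ (q n))
      (γ := γ) hO hγO (fun φ hφ hφ0 L hL => (hweak φ hφ hφ0 L hL).1)
      (ψ := fun n x => (ν (q n ⁻¹' {q n x}) / μ (q n ⁻¹' {q n x})).toReal ^ α)
      (Ψ := fun x => ρ x ^ α) (L := M ^ α) (fun n x => by positivity) (fun n x => ?_)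
      (fun x => Real.rpow_nonneg (hρ0 x) _)
      (fun x => Real.rpow_le_rpow (hρ0 x) (hρM x) hα.1.le)
      (hρ.rpow_const fun x _ => Or.inr hα.1.le) ?_
    · refine hlim.congr fun n => ?_
      exact lintegral_ratio_entropyMeasure hα hac (hq.isQuantizer n)
    · refine Real.rpow_le_rpow ENNReal.toReal_nonneg ?_ hα.1.le
      exact ENNReal.toReal_le_of_le_ofReal hM0 (ENNReal.div_le_of_le_mul
        (hνμ _ ((hq.isQuantizer n).measurable (measurableSet_singleton _))))
    · intro K' hK'O hK' ε hε
      -- Ratios within `ε ^ (1 / α)` have `α`-th powers within `ε`.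
      have hε' : 0 < ε ^ (1 / α) := Real.rpow_pos_of_pos hε _
      obtain ⟨d, hd, hclose⟩ := exists_cell_ratio_close hgm hρ0 hO hg hpos hρ hK' hK'O hr hε'
      filter_upwards [hD.eventually (gt_mem_nhds hd)] with n hn x hx
      refine (abs_rpow_sub_rpow_le hα ENNReal.toReal_nonneg (hρ0 x)).trans ?_
      refine (Real.rpow_le_rpow (abs_nonneg _) (hclose (q n) (hq.isQuantizer n) hn x hx)
        hα.1.le).trans (le_of_eq ?_)
      rw [← Real.rpow_mul hε.le, one_div, inv_mul_cancel₀ hα.1.ne', Real.rpow_one]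
  · have hlim := tendsto_lintegral_of_locally_uniform
      (P := fun n => distortionMeasure α r G μ (q n))
      (γ := γ) hO hγO (fun φ hφ hφ0 L hL => (hweak φ hφ hφ0 L hL).2)
      -- For the distortion the integrand is `ρ` itself, independent of `n`; the lemma serves
      -- because `ρ` is continuous only on `O`.
      (ψ := fun _ => ρ) (Ψ := ρ) (L := M) (fun _ => hρ0) (fun _ => hρM) hρ0 hρM hρ
      (fun _ _ _ ε hε => Eventually.of_forall fun n x _ => by simpa using hε.le)
    have hmul := ENNReal.Tendsto.mul_const (b := ENNReal.ofReal K) hlim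
      (Or.inr ENNReal.ofReal_ne_top)
    refine hmul.congr fun n => ?_
    exact lintegral_distortionMeasure hr hG0 hgm hρm hρ0 (hq.isQuantizer n)

end RenyiQuantization

end

/-! ### The theorem for weakly unimodal densities. -/

theorem theorem4p1 (r α : ℝ) (hr : 1 < r) (hα : α ∈ Set.Ioo (0 : ℝ) 1)
    (g f : ℝ → ℝ) (hg : IsWeaklyUnimodal g) (hf : IsWeaklyUnimodal f)
    (hfg : ∃ M : ℝ, ∀ᵐ x, f x ≤ M * g x)
    (hmoment : ∃ δ : ℝ, 0 < δ ∧
      ∫⁻ x, ENNReal.ofReal (|x| ^ (r + δ)) ∂(densityMeasure g) < ∞)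
    (q : ℕ → ℝ → ℝ) (hq : IsAsymptoticallyOptimal α r (densityMeasure g) q) :
    (Integrable (fun x => g x ^ beta₁ α r) ∧
      Integrable (fun x => (f x / g x) ^ α * g x ^ beta₁ α r) ∧
      Tendsto
        (fun n => EReal.exp (((1 - α : ℝ) : EReal) *
          (entropy α (densityMeasure f) (q n) - entropy α (densityMeasure g) (q n))))
        atTop
        (𝓝 (ENNReal.ofReal
          ((∫ x, (f x / g x) ^ α * g x ^ beta₁ α r) / ∫ x, g x ^ beta₁ α r)))) ∧
    (Integrable (fun x => f x ^ α * (g x ^ (1 / beta₂ α r)) ^ (1 - α)) ∧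
      Integrable (fun x => f x * (g x ^ (1 / beta₂ α r)) ^ (-r)) ∧
      Tendsto
        (fun n => EReal.exp ((r : EReal) * entropy α (densityMeasure f) (q n)) *
          distortion r (densityMeasure f) (q n))
        atTop
        (𝓝 (ENNReal.ofReal
          (constC r *
            (∫ x, f x ^ α * (g x ^ (1 / beta₂ α r)) ^ (1 - α)) ^ (r / (1 - α)) *
            ∫ x, f x * (g x ^ (1 / beta₂ α r)) ^ (-r))))) := by
  have hC := constC_pos r hr
  have h1α : 0 < 1 - α := by linarith [hα.2]
  have hp : 0 < r / (1 - α) := by positivity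
  have hgm := hg.isDensity.measurable
  have hfm := hf.isDensity.measurable
  have hg0 := hg.isDensity.nonneg
  have hf0 := hf.isDensity.nonneg
  have : IsFiniteMeasure (densityMeasure g) := isFiniteMeasure_densityMeasure hg.isDensity
  obtain ⟨B, -, hB⟩ := hg.bddAbove
  obtain ⟨δ, hδ, hmomδ⟩ := hmoment
  have hmom : ∫⁻ x, ENNReal.ofReal (|x| ^ r) ∂(densityMeasure g) ≠ ∞ :=
    lintegral_moment_ne_top (by linarith) (by linarith : r ≤ r + δ) hmomδ
  obtain ⟨M₀, hM₀⟩ := hfg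
  set M := max M₀ 0 with hM
  have hM0 : 0 ≤ M := le_max_right _ _
  have hfgM : ∀ᵐ x, f x ≤ M * g x := by
    filter_upwards [hM₀] with x hx
    exact hx.trans (mul_le_mul_of_nonneg_right (le_max_left _ _) (hg0 x))
  simp_rw [fun x => rpow_mul_rpow_beta₂ hr hα (hf0 x) (hg0 x),
    fun x => mul_rpow_beta₂_neg (u := f x) hr hα (hg0 x)]
  have hgi : Integrable fun x => g x ^ beta₁ α r := integrable_rpow_beta₁ hr hα hgm hg0 hmom
  have hdiv : ∀ᵐ x, f x / g x ≤ M := by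
    filter_upwards [hfgM] with x hx
    rcases (hg0 x).eq_or_lt with h | h
    · rw [← h, div_zero]
      exact hM0
    · rwa [div_le_iff₀ h]
  have hgb0 : ∀ x, 0 ≤ g x ^ beta₁ α r := fun x => Real.rpow_nonneg (hg0 x) _
  have hdiv0 : ∀ x, 0 ≤ f x / g x := fun x => div_nonneg (hf0 x) (hg0 x)
  have hi1 : Integrable fun x => (f x / g x) ^ α * g x ^ beta₁ α r := by
    refine (hgi.const_mul (M ^ α)).mono'
      (((hfm.div hgm).pow_const α).mul (hgm.pow_const _)).aestronglyMeasurable ?_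
    filter_upwards [hdiv] with x hx
    rw [Real.norm_of_nonneg (mul_nonneg (Real.rpow_nonneg (hdiv0 x) _) (hgb0 x))]
    exact mul_le_mul_of_nonneg_right (Real.rpow_le_rpow (hdiv0 x) hx hα.1.le) (hgb0 x)
  have hi2 : Integrable fun x => f x / g x * g x ^ beta₁ α r := by
    refine (hgi.const_mul M).mono' ((hfm.div hgm).mul (hgm.pow_const _)).aestronglyMeasurable ?_
    filter_upwards [hdiv] with x hx
    rw [Real.norm_of_nonneg (mul_nonneg (hdiv0 x) (hgb0 x))]
    exact mul_le_mul_of_nonneg_right hx (hgb0 x)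
  set G := ∫ x, g x ^ beta₁ α r with hGdef
  have hG : ∫⁻ x, ENNReal.ofReal (g x ^ beta₁ α r) = ENNReal.ofReal G :=
    (ofReal_integral_eq_lintegral_ofReal hgi (Eventually.of_forall hgb0)).symm
  have hG0 : 0 < G := by
    rw [hGdef, integral_pos_iff_support_of_nonneg hgb0 hgi]
    obtain ⟨l, hl, hpos⟩ := hg.isDensity.measure_superlevel_pos
    refine hpos.trans_le (measure_mono fun x hx => ?_)
    exact (Real.rpow_pos_of_pos (hl.trans_le hx) _).ne'
  -- The quotient is bounded only almost everywhere; truncation at `M` gives a version bounded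
  -- everywhere with the same measure.
  set ρ : ℝ → ℝ := fun x => min (f x / g x) M with hρdef
  have hρ0 : ∀ x, 0 ≤ ρ x := fun x => le_min (hdiv0 x) hM0
  have hρM : ∀ x, ρ x ≤ M := fun x => min_le_right _ _
  have hρm : Measurable ρ := (hfm.div hgm).min measurable_const
  have hρae : ∀ᵐ x, ρ x = f x / g x := by
    filter_upwards [hdiv] with x hx using min_eq_left hx
  have hfρ : densityMeasure f = densityMeasure fun x => ρ x * g x := by
    refine withDensity_congr_ae ?_
    filter_upwards [hρae, hfgM] with x hx hx'
    rw [hx]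
    rcases (hg0 x).eq_or_lt with h | h
    · rw [← h, mul_zero] at hx' ⊢
      rw [le_antisymm hx' (hf0 x)]
    · rw [div_mul_cancel₀ _ h.ne']
  have hfin : IsFiniteMeasure (densityMeasure f) := isFiniteMeasure_densityMeasure hf.isDensity
  have hfuniv : densityMeasure f univ ≠ 0 := by
    rw [densityMeasure, withDensity_apply _ MeasurableSet.univ, setLIntegral_univ,
      hf.isDensity.lintegral_eq_one]
    exact one_ne_zero
  have hfin' : IsFiniteMeasure (densityMeasure fun x => ρ x * g x) := hfρ ▸ hfin
  -- On this open set `g` is positive and both densities are continuous. What is missing from the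
  -- positivity set of `g` lies in two frontiers of intervals, which are null.
  set O := interior {x | 0 < g x} \ frontier {x | 0 < f x} with hOdef
  have hO : IsOpen O := isOpen_interior.sdiff isClosed_frontier
  have hpos : ∀ x ∈ O, 0 < g x := fun x hx =>
    (interior_subset hx.1 : x ∈ {x | 0 < g x})
  have hgO : ContinuousOn g O := hg.continuousOn_pos.mono hpos
  have hfO : ContinuousOn f O := fun x hx =>
    (hf.continuousAt_of_notMem_frontier hx.2).continuousWithinAt
  have hρO : ContinuousOn ρ O :=
    (hfO.div hgO fun x hx => (hpos x hx).ne').inf continuousOn_const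
  have hOc : ∀ᵐ x, x ∈ Oᶜ → g x = 0 := by
    have h1 : ∀ᵐ x, x ∉ frontier {x | 0 < g x} := by
      rw [ae_iff]
      simpa using hg.volume_frontier_pos
    have h2 : ∀ᵐ x, x ∉ frontier {x | 0 < f x} := by
      rw [ae_iff]
      simpa using hf.volume_frontier_pos
    filter_upwards [h1, h2] with x hx1 hx2 hxO
    by_contra hne
    have hgx : 0 < g x := lt_of_le_of_ne (hg0 x) (Ne.symm hne)
    refine hxO ⟨?_, hx2⟩
    by_contra hi
    exact hx1 ⟨subset_closure hgx, hi⟩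
  obtain ⟨hs, hlim1, hlim2⟩ := tendsto_mismatch hr hα hgm hg0 hB hg.ae_continuousAt hmom hG0 hG hO
    hgO hpos hOc hρm hρ0 hρM hρO hq
  rw [← hfρ] at hlim1 hlim2
  have hint : ∀ h h' : ℝ → ℝ, Measurable h → (∀ x, 0 ≤ h' x) → (∀ᵐ x, h x = h' x) →
      Integrable (fun x => h' x * g x ^ beta₁ α r) →
      ∫⁻ x, ENNReal.ofReal (h x) ∂(limitMeasure (beta₁ α r) G g) =
        ENNReal.ofReal ((∫ x, h' x * g x ^ beta₁ α r) / G) := by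
    intro h h' hm h0 hae hi
    rw [limitMeasure, lintegral_withDensity_eq_lintegral_mul _
      ((hgm.pow_const _).div_const G).ennreal_ofReal hm.ennreal_ofReal, ← integral_div,
      ofReal_integral_eq_lintegral_ofReal (hi.div_const G) (Eventually.of_forall fun x =>
        div_nonneg (mul_nonneg (h0 x) (hgb0 x)) hG0.le)]
    refine lintegral_congr_ae ?_
    filter_upwards [hae] with x hx
    rw [Pi.mul_apply, hx, ← ENNReal.ofReal_mul (div_nonneg (hgb0 x) hG0.le)]
    congr 1
    ring
  rw [hint (fun x => ρ x ^ α) (fun x => (f x / g x) ^ α) (hρm.pow_const α)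
    (fun x => Real.rpow_nonneg (hdiv0 x) _) (hρae.mono fun x hx => by simp only [hx]) hi1] at hlim1
  rw [hint ρ (fun x => f x / g x) hρm hdiv0 hρae hi2] at hlim2
  set X := ∫ x, (f x / g x) ^ α * g x ^ beta₁ α r with hX
  set Y := ∫ x, f x / g x * g x ^ beta₁ α r with hY
  have hX0 : 0 ≤ X := integral_nonneg fun x => mul_nonneg (Real.rpow_nonneg (hdiv0 x) _) (hgb0 x)
  have hY0 : 0 ≤ Y := integral_nonneg fun x => mul_nonneg (hdiv0 x) (hgb0 x)
  refine ⟨⟨hgi, hi1, ?_⟩, hi1, hi2, ?_⟩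
  · refine hlim1.congr' ?_
    filter_upwards [hs, hlim1.eventually (gt_mem_nhds ENNReal.ofReal_lt_top)] with n hn hn'
    refine (exp_entropy_sub hα hn.1 hn.2 (cellSum_ne_zero hα.1 hfuniv (hq.isQuantizer n)) ?_).symm
    -- The quotient of the sums has a finite limit, so the sum for `f` is eventually finite.
    intro htop
    rw [htop, ENNReal.top_mul (ENNReal.inv_ne_zero.2 hn.2)] at hn'
    exact lt_irrefl _ hn'
  -- The quantity is the product of the quotient of the cell sums, raised to `r / (1 - α)`, and
  -- `cellSum ^ (r / (1 - α))` for `g` times the distortion for `f`.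
  · have hmul := ENNReal.Tendsto.mul (hlim1.ennrpow_const (r / (1 - α)))
      (Or.inr (ENNReal.mul_ne_top ENNReal.ofReal_ne_top ENNReal.ofReal_ne_top)) hlim2
      (Or.inr (ENNReal.rpow_ne_top_of_nonneg hp.le ENNReal.ofReal_ne_top))
    have hval : ENNReal.ofReal (X / G) ^ (r / (1 - α)) *
        (ENNReal.ofReal (Y / G) * ENNReal.ofReal (constC r * G ^ beta₂ α r)) =
        ENNReal.ofReal (constC r * X ^ (r / (1 - α)) * Y) := by
      rw [ENNReal.ofReal_rpow_of_nonneg (by positivity) hp.le, ← ENNReal.ofReal_mul (by positivity),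
        ← ENNReal.ofReal_mul (by positivity)]
      congr 1
      -- All powers of `G` cancel through this identity.
      have hb : beta₂ α r = r / (1 - α) + 1 := by
        unfold beta₂
        field_simp
        ring
      have : G ^ (r / (1 - α)) ≠ 0 := by positivity
      rw [hb, Real.rpow_add_one hG0.ne', Real.div_rpow hX0 hG0.le]
      field_simp
    rw [hval] at hmul
    refine hmul.congr' ?_
    filter_upwards [hs] with n hn
    rw [exp_mul_entropy, ENNReal.mul_rpow_of_nonneg _ _ hp.le, ENNReal.inv_rpow, mul_assoc,
      ← mul_assoc (cellSum α (densityMeasure g) (q n) ^ (r / (1 - α)))⁻¹,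
      ENNReal.inv_mul_cancel, one_mul]
    · simpa [hp, hp.le, hp.not_gt] using hn.1
    · exact ENNReal.rpow_ne_top_of_nonneg hp.le hn.2
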